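/- Let $n\geq 1$ and let $(W_n,S_n)$ be a Coxeter group of type $B_n$, $S_n=\{t,s_1,\dots,s_{n-1}\}$, where the Dynkin diagram is the line $t - s_1 - \cdots - s_{n-1}$ with the double bond between $t$ and $s_1$. Let $W_n'$ be the subgroup (of type $D_n$) generated by $S_n'=\{ts_1t,s_1,\dots,s_{n-1}\}$ ($S_1'=\varnothing$). For $m\leq n$ put $S_m=\{t,s_1,\dots,s_{m-1}\}$ ($S_0=\varnothing$), and $S_m'=\{ts_1t,s_1,\dots,s_{m-1}\}$ if $m\ge 2$, $S_1'=\varnothing$; let $W_m$, $W_m'$ be the subgroups they generate. For $K$ one of these generating sets, with generated group $W_K$ and length function $\ell_K$, and for $I\subset K$, put $X_I^K=\{w\in W_K : \ell_K(ws)>\ell_K(w)\ \forall s\in I\}$ and $x_I^K=\sum_{w\in X_I^K}w\in\mathbb{Q}W_K$; let $\Sigma(W_K)$ be the $\mathbb{Q}$-span of the $x_I^K$, $I\subset K$. Let $W_I$ be the subgroup generated by $I$. For a finite group $G$, $\mathbb{Q}\,\mathrm{Irr}\,G$ is the $\mathbb{Q}$-span of the characters of finite-dimensional complex representations of $G$.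 Consider the linear maps * $\theta_K:\Sigma(W_K)\to\mathbb{Q}\,\mathrm{Irr}\,W_K$, $x_I^K\mapsto \mathrm{Ind}_{W_I}^{W_K}1$, for $K=S_n$ (written $\theta_n$) and for $K=S_n'$ (written $\theta_n'$); * $\mathrm{Res}^L_K:\Sigma(W_L)\to\Sigma(W_K)$, $x_I^L\mapsto\sum_{d} x^K_{K\cap dId^{-1}}$, the sum over $d\in (X^L_K)^{-1}\cap X^L_I$, for $(L,K)=(S_n,S_{n-1})$ and, if $n\ge 2$, for $(L,K)=(S_n',S_{n-1}')$; * $\mathrm{Res}_m:\Sigma(W_m)\to\Sigma(W_m')$, $x_I^{S_m}\mapsto\sum_{d} x^{S_m'}_{d^{-1}W_Id\,\cap\, S_m'}$, the sum over $d\in\{1,t\}\cap (X_I^{S_m})^{-1}$, for $m=n$ and, if $n\ge 2$, for $m=n-1$. These formulas determine well-defined linear maps, and: (a) $(1+t)\,\mathrm{Res}_n(x)=x\,(1+t)$ for all $x\in\Sigma(W_n)$. (b) $\Sigma(W_n)$ and $\Sigma(W_n')$ are unital subalgebras of $\mathbb{Q}W_n$, and $\mathrm{Res}_n$ is a homomorphism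 of (unital) algebras. (c) If $n\ge 2$, then $\mathrm{Res}^{S_n'}_{S_{n-1}'}\circ\mathrm{Res}_n=\mathrm{Res}_{n-1}\circ\mathrm{Res}^{S_n}_{S_{n-1}}$. (d) $\theta_n'\circ\mathrm{Res}_n=\mathrm{Res}^{W_n}_{W_n'}\circ\theta_n$, where $\mathrm{Res}^{W_n}_{W_n'}:\mathbb{Q}\,\mathrm{Irr}\,W_n\to\mathbb{Q}\,\mathrm{Irr}\,W_n'$ is restriction of characters. (e) The image of $\mathrm{Res}_n$ is $\{y\in\Sigma(W_n') : tyt^{-1}=y\}$, the subalgebra of $\Sigma(W_n')$ fixed by the automorphism $\sigma_n$ induced by conjugation by $t$. (f) The map $\mathrm{Res}^{S_n}_{S_{n-1}}:\Sigma(W_n)\to\Sigma(W_{n-1})$ is surjective. -/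

import Mathlib

open scoped Pointwise

noncomputable section

namespace DescentAlgebra

section General

/-! For a subset `K` of a group `G`, the pair `(W_K, K)` consists of the subgroup `W_K` of `G`
generated by `K` and of its generating set `K`.  All group algebras `ℚ W_K` are regarded as
subalgebras of `ℚ G`. -/

variable {G : Type*} [Group G]

/-- The length of `w` with respect to `K`: the least number of factors in an expression of `w` as a
product of elements of `K` (only used when `w` is such a product). -/
def wordLength (K : Set G) (w : G) : ℕ :=
  sInf {k : ℕ | ∃ l : List G, l.length = k ∧ (∀ s ∈ l, s ∈ K) ∧ l.prod = w}

/-- `X_I^K = {w ∈ W_K | ws > w for all s ∈ I}`. -/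
def minReps (K I : Set G) : Set G :=
  {w | w ∈ Subgroup.closure K ∧ ∀ s ∈ I, wordLength K w < wordLength K (w * s)}

/-- `x_I^K`, the sum of the elements of `X_I^K` in the group algebra. -/
def x (K I : Set G) : MonoidAlgebra ℚ G :=
  ∑ᶠ w ∈ minReps K I, MonoidAlgebra.single w 1

/-- `Σ(W_K)`, the linear span of the `x_I^K` with `I ⊆ K`. -/
def descentSpace (K : Set G) : Submodule ℚ (MonoidAlgebra ℚ G) :=
  Submodule.span ℚ {a | ∃ I ⊆ K, a = x K I}

theorem x_mem (K : Set G) {I : Set G} (h : I ⊆ K) : x K I ∈ descentSpace K :=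
  Submodule.subset_span ⟨I, h, rfl⟩

/-- `x_I^K` as an element of `Σ(W_K)`. -/
def basisElt (K I : Set G) (h : I ⊆ K) : descentSpace K := ⟨x K I, x_mem K h⟩

/-- `R` is the restriction morphism `Res_K^L : Σ(W_L) → Σ(W_K)`, that is, the linear map with
`x_I^L ↦ ∑_d x_{K ∩ dId⁻¹}^K` for `I ⊆ L`, where `d` runs over `X_{KI} = (X_K^L)⁻¹ ∩ X_I^L`. -/
def IsParabolicRestriction (L K : Set G) (R : descentSpace L →ₗ[ℚ] descentSpace K) : Prop :=
  ∀ (I : Set G) (hI : I ⊆ L), R (basisElt L I hI) =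
    ∑ᶠ d ∈ (minReps L K)⁻¹ ∩ minReps L I,
      basisElt K (K ∩ MulAut.conj d '' I) Set.inter_subset_left

/-- `R` maps `Σ(W_L)` into `Σ(W_K)` as a homomorphism of unital algebras; in particular both
spaces are unital subalgebras of the group algebra. -/
def IsAlgebraHom (L K : Set G) (R : descentSpace L →ₗ[ℚ] descentSpace K) : Prop :=
  ∃ (A B : Subalgebra ℚ (MonoidAlgebra ℚ G)) (φ : A →ₐ[ℚ] B),
    Subalgebra.toSubmodule A = descentSpace L ∧ Subalgebra.toSubmodule B = descentSpace K ∧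
    ∀ (a : A) (y : descentSpace L), (a : MonoidAlgebra ℚ G) = y →
      (φ a : MonoidAlgebra ℚ G) = R y

/-- Conjugation by `g` on the group algebra. -/
def conj (g : G) (a : MonoidAlgebra ℚ G) : MonoidAlgebra ℚ G :=
  MonoidAlgebra.single g 1 * a * MonoidAlgebra.single g⁻¹ 1

/-- `ℚ Irr G` for a finite group `G`: the rational Grothendieck group of finite dimensional complex
representations, realized as the `ℚ`-span of their characters. -/
def QIrr (G : Type*) [Group G] : Submodule ℚ (G → ℂ) :=
  Submodule.span ℚ {χ | ∃ (m : ℕ) (ρ : Representation ℂ G (Fin m → ℂ)), χ = ρ.character}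

/-- Restriction of characters along `f : H → G`, as a map `ℚ Irr G → ℚ Irr H`. -/
def resChar {H : Type*} [Group H] (f : H →* G) : QIrr G →ₗ[ℚ] QIrr H :=
  (LinearMap.funLeft ℚ ℂ f).restrict (by
    intro χ hχ
    refine Submodule.span_induction (p := fun χ _ => LinearMap.funLeft ℚ ℂ f χ ∈ QIrr H)
      ?_ ?_ ?_ ?_ hχ
    · rintro _ ⟨m, ρ, rfl⟩
      exact Submodule.subset_span ⟨m, ρ.comp f, rfl⟩
    · simp
    · intro a b _ _ ha hb
      rw [map_add]
      exact add_mem ha hb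
    · intro c a _ ha
      rw [map_smul]
      exact Submodule.smul_mem _ c ha)

/-- The character of `W_K` induced from the trivial character of `W_I`, where `I ⊆ K`. -/
def indTrivial (K I : Set G) : Subgroup.closure K → ℂ :=
  (Representation.ind ((Subgroup.closure I).subgroupOf (Subgroup.closure K)).subtype
    (Representation.trivial ℂ ((Subgroup.closure I).subgroupOf (Subgroup.closure K)) ℂ)).character

/-- `θ` is the linear map `θ_K : Σ(W_K) → ℚ Irr W_K` with `x_I^K ↦ Ind_{W_I}^{W_K} 1`. -/
def IsTheta (K : Set G) (θ : descentSpace K →ₗ[ℚ] QIrr (Subgroup.closure K)) : Prop :=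
  ∀ (I : Set G) (hI : I ⊆ K),
    (θ (basisElt K I hI) : Subgroup.closure K → ℂ) = indTrivial K I

/-- `R` is, for generating sets `S` (type `B`) and `S'` (type `D`), the linear map
`Σ(W_S) → Σ(W_{S'})` with `x_I^S ↦ ∑_d x^{S'}_{d⁻¹ W_I d ∩ S'}` for `I ⊆ S`, where `d` runs
over `{1, t} ∩ (X_I^S)⁻¹`. -/
def IsRestrictionBD (t : G) (S S' : Set G) (R : descentSpace S →ₗ[ℚ] descentSpace S') : Prop :=
  ∀ (I : Set G) (hI : I ⊆ S), R (basisElt S I hI) =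
    ∑ᶠ d ∈ ({1, t} : Set G) ∩ (minReps S I)⁻¹,
      basisElt S' ((MulAut.conj d⁻¹ '' (Subgroup.closure I : Set G)) ∩ S') Set.inter_subset_right

end General

section TypeB

variable {n : ℕ} {W : Type*} [Group W]

/-- The simple reflections of type `B_n`, numbered from the end of the Dynkin diagram that carries
the bond of order `4`: `gen cs 0 = t` and `gen cs i = s_i` for `1 ≤ i ≤ n - 1`. -/
def gen (cs : CoxeterSystem (CoxeterMatrix.B n) W) (i : Fin n) : W := cs.simple i.rev

/-- `S_m = {t, s_1, …, s_{m-1}}`, for `m ≤ n`. -/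
def SB (cs : CoxeterSystem (CoxeterMatrix.B n) W) (m : ℕ) : Set W :=
  {w | ∃ i : Fin n, (i : ℕ) < m ∧ w = gen cs i}

/-- `S_m' = {t s_1 t, s_1, …, s_{m-1}}` for `2 ≤ m ≤ n`, and `S_m' = ∅` for `m ≤ 1`. -/
def SD [NeZero n] (cs : CoxeterSystem (CoxeterMatrix.B n) W) (m : ℕ) : Set W :=
  {w | ∃ i : Fin n, 1 ≤ (i : ℕ) ∧ (i : ℕ) < m ∧ w = gen cs i} ∪
  {w | ∃ i : Fin n, (i : ℕ) = 1 ∧ (i : ℕ) < m ∧ w = gen cs 0 * gen cs i * gen cs 0}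

theorem gen_zero_mem_closure [NeZero n] (cs : CoxeterSystem (CoxeterMatrix.B n) W) {m : ℕ}
    (hm : 1 ≤ m) : gen cs 0 ∈ Subgroup.closure (SB cs m) :=
  Subgroup.subset_closure ⟨0, by simpa using Nat.pos_of_ne_zero (by omega), rfl⟩

/-- `W_m' ⊆ W_m`. -/
theorem closure_SD_le [NeZero n] (cs : CoxeterSystem (CoxeterMatrix.B n) W) (m : ℕ) :
    Subgroup.closure (SD cs m) ≤ Subgroup.closure (SB cs m) := by
  rw [Subgroup.closure_le]
  rintro w (⟨i, _, hi, rfl⟩ | ⟨i, h1, hi, rfl⟩)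
  · exact Subgroup.subset_closure ⟨i, hi, rfl⟩
  · have ht := gen_zero_mem_closure cs (m := m) (by omega)
    exact mul_mem (mul_mem ht (Subgroup.subset_closure ⟨i, hi, rfl⟩)) ht

end TypeB

end DescentAlgebra

end

/-! Let `W_K` act on integer vectors by reflections, with a chosen set of positive roots and a
functional `h` positive on them. A functional `f` that is dominant for `K` and vanishes exactly at
the simple roots of `I` has stabilizer `W_I`. Perturbed infinitesimally by `h`, each member of its
orbit falls into exactly one chamber, that is, determines one element of `W_K`; the elements so
obtained are those of `X_I^K`. Hence `x_I^K` is the sum of the chambers of an orbit, and every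
finite `W_K`-stable set of functionals gives an element of `Σ(W_K)` (`PositiveSystem.sum_stable`,
`PositiveSystem.sum_chamber_stable`). For pairs of functionals in lexicographic order this is
Solomon's theorem (`PositiveSystem.x_mul_x_mem`).

All the restriction maps are instances of one construction. If the positive roots of `W_K ≤ W_L` are
among those of `W_L`, each chamber of `W_L` lies in one chamber of `W_K`; this is the projection
`proj`, `ad ↦ a`. Splitting a `W_L`-orbit into `W_K`-orbits computes its linear extension: `x_I^L`
goes to a sum of terms `x^K` for `K ∩ d W_I d⁻¹` (`PositiveSystem.projLin_x`). For `K ⊆ L` this is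
the parabolic formula, by Kilmoyer's theorem; for type `D` inside type `B` only `d = 1` and `d = t`
can occur, and it is the formula for `Res_m`. So the restriction maps are well defined, (c) is
transitivity of projections (`PositiveSystem.proj_proj`), and (d) is the same splitting with fixed
points counted (`PositiveSystem.indTrivial_restrict`).

For (a), an element and its projection to type `D` differ on the right by `1` or `t`, which `1 + t`
absorbs; moreover the projection of a descent element commutes with `t`. For (b), left
multiplication by `1 + t` is injective on `Σ(W_n')`, so (a) forces multiplicativity. For (e), every
`x_J + t x_J t⁻¹` is a value of `Res_n`. For (f), restriction is triangular with respect to the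
length of the initial segment `t, s_1, …` contained in `J` (`x_mem_map_projLin_of_initial`).

Since the group is given by its Coxeter presentation, faithfulness of the reflection representation
has to be proved (`height_pos_of_length_lt`, `rep_injective`); it enters the general theory through
the field `conj_eq`, by which a simple reflection is known from its root. -/

noncomputable section

namespace DescentAlgebra

/-! ### Positive systems: exchange, ascents and dominant functionals -/

section PositiveSystems

/-- A finite reflection group with a positive system: `K` is a set of involutions of `G`, acting on
`V` through `ρ` as reflections with roots `α s`, and `Φ` is the set of positive roots, on which the
functional `h` is positive. -/
structure PositiveSystem {G V : Type*} [Group G] [AddCommGroup V] (ρ : G →* Module.End ℤ V)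
    (h : V →+ ℤ) (δ : V) (α : G → V) (Φ : Set V) (K : Set G) : Prop where
  mul_self : ∀ s ∈ K, s * s = 1
  root_mem : ∀ s ∈ K, α s ∈ Φ
  pos : ∀ β ∈ Φ, 0 < h β
  smul_mem : ∀ s ∈ K, ∀ β ∈ Φ, β ≠ α s → ρ s β ∈ Φ
  smul_root : ∀ s ∈ K, ρ s (α s) = -α s
  conj_eq : ∀ s ∈ K, ∀ s' ∈ K, ∀ g, ρ g (α s) = α s' → g * s * g⁻¹ = s'
  mem_closure : ∀ β ∈ Φ, β ∈ AddSubmonoid.closure (α '' K)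
  reflection : ∀ s ∈ K, ∃ c : V →+ ℤ, 0 < c δ ∧ ∀ v, ρ s v = v - c v • α s
  coweight : ∀ I ⊆ K, ∃ u : V →+ ℤ, (∀ s ∈ I, u (α s) = 0) ∧ ∀ s ∈ K \ I, 0 < u (α s)

variable {G V : Type*} [Group G] [AddCommGroup V] {ρ : G →* Module.End ℤ V}
    {h : V →+ ℤ} {δ : V} {α : G → V} {Φ : Set V} {K : Set G}

/-- The functional `v ↦ f (w v)`. -/
def pullback {A : Type*} [AddCommGroup A] (ρ : G →* Module.End ℤ V) (w : G) (f : V →+ A) :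
    V →+ A :=
  f.comp (ρ w).toAddMonoidHom

@[simp]
theorem pullback_apply {A : Type*} [AddCommGroup A] (w : G) (f : V →+ A) (v : V) :
    pullback ρ w f v = f (ρ w v) := rfl

theorem map_mul_apply (a b : G) (v : V) : ρ (a * b) v = ρ a (ρ b v) := by
  rw [map_mul, Module.End.mul_apply]

@[simp]
theorem map_inv_apply_self (a : G) (v : V) : ρ a⁻¹ (ρ a v) = v := by
  rw [← map_mul_apply, inv_mul_cancel, map_one, Module.End.one_apply]

@[simp]
theorem map_self_apply_inv (a : G) (v : V) : ρ a (ρ a⁻¹ v) = v := by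
  rw [← map_mul_apply, mul_inv_cancel, map_one, Module.End.one_apply]

theorem pullback_pullback {A : Type*} [AddCommGroup A] (a b : G) (f : V →+ A) :
    pullback ρ a (pullback ρ b f) = pullback ρ (b * a) f := by
  ext v; simp

@[simp]
theorem pullback_one {A : Type*} [AddCommGroup A] (f : V →+ A) : pullback ρ 1 f = f := by
  ext v; simp

/-- A word in elements of `I` which is as short as possible. -/
theorem exists_minimal_word {I : Set G} (hI : ∀ s ∈ I, s * s = 1) {w : G}
    (hw : w ∈ Subgroup.closure I) :
    ∃ l : List G, l.length = wordLength I w ∧ (∀ s ∈ l, s ∈ I) ∧ l.prod = w := by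
  have hne : {k : ℕ | ∃ l : List G, l.length = k ∧ (∀ s ∈ l, s ∈ I) ∧ l.prod = w}.Nonempty := by
    induction hw using Subgroup.closure_induction with
    | mem x hx => exact ⟨_, [x], rfl, by simpa using hx, by simp⟩
    | one => exact ⟨_, [], rfl, by simp, by simp⟩
    | mul a b _ _ ha hb =>
      obtain ⟨_, l, -, hl, rfl⟩ := ha
      obtain ⟨_, l', -, hl', rfl⟩ := hb
      refine ⟨_, l ++ l', rfl, ?_, by simp⟩
      intro s hs
      rcases List.mem_append.1 hs with h | h
      exacts [hl s h, hl' s h]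
    | inv a _ ha =>
      obtain ⟨_, l, -, hl, rfl⟩ := ha
      refine ⟨_, (l.map (fun x => x⁻¹)).reverse, rfl, ?_, (List.prod_inv_reverse l).symm⟩
      intro s hs
      obtain ⟨a, ha, rfl⟩ := List.mem_map.1 (List.mem_reverse.1 hs)
      rw [inv_eq_of_mul_eq_one_left (hI a (hl a ha))]
      exact hl a ha
  exact Nat.sInf_mem hne

theorem wordLength_le {I : Set G} {l : List G} (hl : ∀ s ∈ l, s ∈ I) :
    wordLength I l.prod ≤ l.length :=
  Nat.sInf_le ⟨l, rfl, hl, rfl⟩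

theorem list_prod_mem_closure {I : Set G} {l : List G} (hl : ∀ s ∈ l, s ∈ I) :
    l.prod ∈ Subgroup.closure I :=
  Subgroup.list_prod_mem _ fun s hs => Subgroup.subset_closure (hl s hs)

namespace PositiveSystem

variable (hP : PositiveSystem ρ h δ α Φ K)
include hP

theorem inv_eq {s : G} (hs : s ∈ K) : s⁻¹ = s :=
  inv_eq_of_mul_eq_one_left (hP.mul_self s hs)

theorem smul_mem_or {s : G} (hs : s ∈ K) {β : V} (hβ : β ∈ Φ) : ρ s β ∈ Φ ∨ -ρ s β ∈ Φ := by
  by_cases hb : β = α s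
  · right; rw [hb, hP.smul_root s hs, neg_neg]; exact hP.root_mem s hs
  · exact Or.inl (hP.smul_mem s hs β hβ hb)

theorem map_mem_or {w : G} (hw : w ∈ Subgroup.closure K) {β : V} (hβ : β ∈ Φ) :
    ρ w β ∈ Φ ∨ -ρ w β ∈ Φ := by
  induction hw using Subgroup.closure_induction generalizing β with
  | mem x hx => exact hP.smul_mem_or hx hβ
  | one => simpa using Or.inl hβ
  | mul a b _ _ ha hb =>
    rw [map_mul_apply]
    rcases hb hβ with hb | hb
    · exact ha hb
    · have := ha hb
      rw [map_neg, neg_neg] at this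
      exact this.symm
  | inv a hac ha =>
    -- The hypothesis for `a` gives nothing directly about `a⁻¹`, so `a` is written as a word in
    -- involutions and inverted letter by letter.
    obtain ⟨l, -, hl, rfl⟩ := exists_minimal_word hP.mul_self hac
    clear ha hac
    induction l generalizing β with
    | nil => simpa using Or.inl hβ
    | cons s l ih =>
      rw [List.prod_cons, mul_inv_rev, map_mul_apply, hP.inv_eq (hl s (by simp))]
      have hl' : ∀ a ∈ l, a ∈ K := fun a ha => hl a (by simp [ha])
      rcases hP.smul_mem_or (hl s (by simp)) hβ with hb | hb
      · exact ih hb hl'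
      · have := ih hb hl'
        rw [map_neg, neg_neg] at this
        exact this.symm

theorem mem_of_pos {w : G} (hw : w ∈ Subgroup.closure K) {β : V} (hβ : β ∈ Φ)
    (hp : 0 < h (ρ w β)) : ρ w β ∈ Φ := by
  rcases hP.map_mem_or hw hβ with hb | hb
  · exact hb
  · have := hP.pos _ hb
    rw [map_neg] at this; omega

theorem neg_mem_of_neg {w : G} (hw : w ∈ Subgroup.closure K) {β : V} (hβ : β ∈ Φ)
    (hp : h (ρ w β) < 0) : -ρ w β ∈ Φ := by
  rcases hP.map_mem_or hw hβ with hb | hb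
  · have := hP.pos _ hb; omega
  · exact hb

theorem height_ne_zero {w : G} (hw : w ∈ Subgroup.closure K) {β : V} (hβ : β ∈ Φ) :
    h (ρ w β) ≠ 0 := by
  rcases hP.map_mem_or hw hβ with hb | hb
  · exact (hP.pos _ hb).ne'
  · have := hP.pos _ hb
    rw [map_neg] at this; omega

theorem eq_root_of_neg {s : G} (hs : s ∈ K) {β : V} (hβ : β ∈ Φ) (hn : h (ρ s β) < 0) :
    β = α s := by
  by_contra hb
  have := hP.pos _ (hP.smul_mem s hs β hβ hb)
  omega

theorem map_mul_root {s : G} (hs : s ∈ K) (w : G) : ρ (w * s) (α s) = -ρ w (α s) := by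
  rw [map_mul_apply, hP.smul_root s hs, map_neg]

/-- Reading the word from the right, some letter `a` first makes the image of `α s` negative. The
image just before must be `α a`, so `conj_eq` shows that multiplying by `s` on the right deletes
this letter. The new word keeps its letters in `I`, although `s` need only lie in `K`. -/
theorem exchange {I : Set G} (hI : I ⊆ K) {l : List G} (hl : ∀ a ∈ l, a ∈ I) {s : G} (hs : s ∈ K)
    (hn : h (ρ l.prod (α s)) < 0) :
    ∃ l' : List G, (∀ a ∈ l', a ∈ I) ∧ l'.length + 1 = l.length ∧ l.prod * s = l'.prod := by
  induction l with
  | nil =>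
    have := hP.pos _ (hP.root_mem s hs)
    simp at hn; omega
  | cons a l ih =>
    have hl' : ∀ b ∈ l, b ∈ I := fun b hb => hl b (by simp [hb])
    have ha : a ∈ I := hl a (by simp)
    have hlK : l.prod ∈ Subgroup.closure K := list_prod_mem_closure fun b hb => hI (hl' b hb)
    rcases lt_or_gt_of_ne (hP.height_ne_zero hlK (hP.root_mem s hs)) with hlt | hgt
    · obtain ⟨l', h1, h2, h3⟩ := ih hl' hlt
      refine ⟨a :: l', ?_, by simp [h2], by simp [mul_assoc, h3]⟩
      intro b hb
      rcases List.mem_cons.1 hb with rfl | hb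
      exacts [ha, h1 b hb]
    · refine ⟨l, hl', by simp, ?_⟩
      rw [List.prod_cons, map_mul_apply] at hn
      have h1 := hP.eq_root_of_neg (hI ha) (hP.mem_of_pos hlK (hP.root_mem s hs) hgt) hn
      have h2 := hP.conj_eq s hs a (hI ha) _ h1
      rw [List.prod_cons, ← h2]
      have h3 := hP.mul_self s hs
      calc l.prod * s * l.prod⁻¹ * l.prod * s = l.prod * (s * s) := by group
        _ = l.prod := by rw [h3, mul_one]

theorem wordLength_mul_lt {w : G} (hw : w ∈ Subgroup.closure K) {s : G} (hs : s ∈ K)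
    (hn : h (ρ w (α s)) < 0) : wordLength K (w * s) < wordLength K w := by
  obtain ⟨l, h1, h2, rfl⟩ := exists_minimal_word hP.mul_self hw
  obtain ⟨l', h3, h4, h5⟩ := hP.exchange subset_rfl h2 hs hn
  rw [h5, ← h1]
  have := wordLength_le h3
  omega

/-- This turns the length condition defining `X_I^K` into signs of roots; from here on lengths serve
almost only as an induction parameter. -/
theorem wordLength_lt_iff {w : G} (hw : w ∈ Subgroup.closure K) {s : G} (hs : s ∈ K) :
    wordLength K w < wordLength K (w * s) ↔ 0 < h (ρ w (α s)) := by
  constructor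
  · intro hlt
    by_contra hn
    have hn' := lt_of_le_of_ne (not_lt.1 hn) (hP.height_ne_zero hw (hP.root_mem s hs))
    exact lt_asymm hlt (hP.wordLength_mul_lt hw hs hn')
  · intro hp
    have h1 := hP.wordLength_mul_lt (mul_mem hw (Subgroup.subset_closure hs)) hs (by
      rw [hP.map_mul_root hs, map_neg]; omega)
    rwa [mul_assoc, hP.mul_self s hs, mul_one] at h1

theorem mem_minReps_iff {I : Set G} (hI : I ⊆ K) {w : G} :
    w ∈ minReps K I ↔ w ∈ Subgroup.closure K ∧ ∀ s ∈ I, 0 < h (ρ w (α s)) := by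
  refine and_congr_right fun hw => forall₂_congr fun s hs => ?_
  exact hP.wordLength_lt_iff hw (hI hs)

/-- The last letter of a shortest word in `I` is a descent: otherwise the exchange property would
shorten the word inside `I`. -/
theorem exists_descent {I : Set G} (hI : I ⊆ K) {w : G} (hw : w ∈ Subgroup.closure I)
    (h1 : w ≠ 1) : ∃ s ∈ I, h (ρ w (α s)) < 0 := by
  obtain ⟨l, hlen, hl, rfl⟩ := exists_minimal_word (fun s hs => hP.mul_self s (hI hs)) hw
  have hwK : l.prod ∈ Subgroup.closure K := Subgroup.closure_mono hI hw
  rcases List.eq_nil_or_concat l with rfl | ⟨l₀, s, rfl⟩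
  · simp at h1
  have hs : s ∈ I := hl s (by simp)
  refine ⟨s, hs, ?_⟩
  have hl₀ : ∀ a ∈ l₀, a ∈ I := fun a ha => hl a (by simp [ha])
  by_contra hn
  have hp := lt_of_le_of_ne (not_lt.1 hn) (hP.height_ne_zero hwK (hP.root_mem s (hI hs))).symm
  rw [List.prod_concat, hP.map_mul_root (hI hs), map_neg] at hp
  obtain ⟨l', h3, h4, h5⟩ := hP.exchange hI hl₀ (hI hs) (by omega)
  have h6 := wordLength_le h3
  rw [← h5, ← List.prod_concat, ← hlen, List.length_concat] at h6
  omega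

theorem eq_one_of_pos {w : G} (hw : w ∈ Subgroup.closure K)
    (hp : ∀ s ∈ K, 0 < h (ρ w (α s))) : w = 1 := by
  by_contra h1
  obtain ⟨s, hs, hn⟩ := hP.exists_descent subset_rfl hw h1
  exact lt_asymm hn (hp s hs)

variable {A : Type*} [AddCommGroup A] [LinearOrder A] [IsOrderedAddMonoid A]

/-- Values are taken in an arbitrary ordered group so that lexicographic pairs, which model
infinitesimal perturbations, are covered. -/
theorem nonneg_of_dominant {f : V →+ A} (hf : ∀ s ∈ K, 0 ≤ f (α s)) {β : V} (hβ : β ∈ Φ) :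
    0 ≤ f β := by
  have hβ' := hP.mem_closure β hβ
  clear hβ
  induction hβ' using AddSubmonoid.closure_induction with
  | mem x hx => obtain ⟨s, hs, rfl⟩ := hx; exact hf s hs
  | zero => simp
  | add a b _ _ ha hb => rw [map_add]; exact add_nonneg ha hb

/-- A positive root on which a dominant functional vanishes is a combination of simple roots on
which it vanishes. -/
theorem mem_closure_of_eq_zero {f : V →+ A} (hf : ∀ s ∈ K, 0 ≤ f (α s)) {β : V} (hβ : β ∈ Φ)
    (h0 : f β = 0) : β ∈ AddSubmonoid.closure (α '' {s ∈ K | f (α s) = 0}) := by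
  have key : 0 ≤ f β ∧ (f β = 0 → β ∈ AddSubmonoid.closure (α '' {s ∈ K | f (α s) = 0})) := by
    have hβ' := hP.mem_closure β hβ
    clear hβ h0
    induction hβ' using AddSubmonoid.closure_induction with
    | mem x hx =>
      obtain ⟨s, hs, rfl⟩ := hx
      exact ⟨hf s hs, fun h0 => AddSubmonoid.subset_closure ⟨s, ⟨hs, h0⟩, rfl⟩⟩
    | zero => exact ⟨by simp, fun _ => zero_mem _⟩
    | add a b _ _ ha hb =>
      rw [map_add]
      refine ⟨add_nonneg ha.1 hb.1, fun h0 => ?_⟩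
      obtain ⟨h1, h2⟩ := (add_eq_zero_iff_of_nonneg ha.1 hb.1).1 h0
      exact add_mem (ha.2 h1) (hb.2 h2)
  exact key.2 h0

/-- If `f` is dominant, and `w` sends the simple roots annihilated by `f` to positive roots, then it
sends every positive root annihilated by `f` to a positive root. -/
theorem pos_of_dominant {f : V →+ A} (hf : ∀ s ∈ K, 0 ≤ f (α s)) {w : G}
    (hw : w ∈ Subgroup.closure K) (hp : ∀ s ∈ K, f (α s) = 0 → 0 < h (ρ w (α s)))
    {β : V} (hβ : β ∈ Φ) (h0 : f β = 0) : 0 < h (ρ w β) := by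
  refine lt_of_le_of_ne ?_ (hP.height_ne_zero hw hβ).symm
  have hβ' := hP.mem_closure_of_eq_zero hf hβ h0
  clear hβ h0
  induction hβ' using AddSubmonoid.closure_induction with
  | mem x hx => obtain ⟨s, hs, rfl⟩ := hx; exact (hp s hs.1 hs.2).le
  | zero => simp
  | add a b _ _ ha hb => rw [map_add, map_add]; exact add_nonneg ha hb

theorem pullback_eq_of_root_eq_zero {A : Type*} [AddCommGroup A] {s : G} (hs : s ∈ K) {f : V →+ A}
    (h0 : f (α s) = 0) :
    pullback ρ s f = f := by
  obtain ⟨c, -, hc⟩ := hP.reflection s hs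
  ext v
  rw [pullback_apply, hc, map_sub, map_zsmul, h0, smul_zero, sub_zero]

theorem root_eq_zero_of_pullback_eq {s : G} (hs : s ∈ K) {f : V →+ A} (h0 : pullback ρ s f = f) :
    f (α s) = 0 := by
  have h1 := DFunLike.congr_fun h0 (α s)
  rw [pullback_apply, hP.smul_root s hs, map_neg] at h1
  exact self_eq_neg.1 h1.symm

theorem pullback_eq_of_mem_closure {A : Type*} [AddCommGroup A] {f : V →+ A} {w : G}
    (hw : w ∈ Subgroup.closure {s ∈ K | f (α s) = 0}) : pullback ρ w f = f := by
  induction hw using Subgroup.closure_induction with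
  | mem x hx => exact hP.pullback_eq_of_root_eq_zero hx.1 hx.2
  | one => simp
  | mul a b _ _ ha hb => rw [← pullback_pullback, ha, hb]
  | inv a _ ha =>
    nth_rewrite 1 [← ha]
    rw [pullback_pullback, mul_inv_cancel, pullback_one]

/-- Two dominant functionals in the same orbit are equal, and the stabilizer of a dominant
functional is generated by simple reflections. -/
theorem dominant_orbit {f : V →+ A} (hf : ∀ s ∈ K, 0 ≤ f (α s)) {w : G}
    (hw : w ∈ Subgroup.closure K) (hfw : ∀ s ∈ K, 0 ≤ f (ρ w (α s))) :
    pullback ρ w f = f ∧ w ∈ Subgroup.closure {s ∈ K | f (α s) = 0} := by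
  induction hn : wordLength K w using Nat.strong_induction_on generalizing w with
  | _ n ih =>
    subst hn
    by_cases h1 : w = 1
    · subst h1; exact ⟨pullback_one f, one_mem _⟩
    obtain ⟨s, hs, hneg⟩ := hP.exists_descent subset_rfl hw h1
    -- At a descent `s` the root `-w (α s)` is positive, so dominance of `f` and of `pullback ρ w f`
    -- together force the value zero. Then `w * s` is shorter and pulls `f` back to the same
    -- functional.
    have hle := hP.nonneg_of_dominant hf (hP.neg_mem_of_neg hw (hP.root_mem s hs) hneg)
    rw [map_neg, Left.nonneg_neg_iff] at hle
    have h0 : (pullback ρ w f) (α s) = 0 := le_antisymm hle (hfw s hs)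
    have h2 : pullback ρ (w * s) f = pullback ρ w f := by
      rw [← pullback_pullback, hP.pullback_eq_of_root_eq_zero hs h0]
    obtain ⟨h3, h4⟩ := ih _ (hP.wordLength_mul_lt hw hs hneg)
      (mul_mem hw (Subgroup.subset_closure hs)) (fun s' hs' => by
        have := hfw s' hs'
        rw [← pullback_apply, ← h2, pullback_apply] at this; exact this) rfl
    rw [h2] at h3
    refine ⟨h3, ?_⟩
    rw [h3] at h0
    have h5 := mul_mem h4 (Subgroup.subset_closure (show s ∈ {s ∈ K | f (α s) = 0} from ⟨hs, h0⟩))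
    rwa [mul_assoc, hP.mul_self s hs, mul_one] at h5

theorem mem_closure_iff_pullback_eq {f : V →+ A} (hf : ∀ s ∈ K, 0 ≤ f (α s)) {w : G}
    (hw : w ∈ Subgroup.closure K) :
    w ∈ Subgroup.closure {s ∈ K | f (α s) = 0} ↔ pullback ρ w f = f := by
  refine ⟨hP.pullback_eq_of_mem_closure, fun h0 => (hP.dominant_orbit hf hw fun s hs => ?_).2⟩
  rw [← pullback_apply, h0]; exact hf s hs

/-- Choose `a` maximizing `f (a δ)`. Since the coroots are positive on `δ`, a negative value of `f`
at `a (α s)` would make `a * s` better. -/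
theorem exists_nonneg [Finite G] (f : V →+ A) :
    ∃ a ∈ Subgroup.closure K, ∀ s ∈ K, 0 ≤ f (ρ a (α s)) := by
  obtain ⟨a, ha, hmax⟩ := Set.exists_max_image (Subgroup.closure K : Set G) (fun a => f (ρ a δ))
    (Set.toFinite _) ⟨1, one_mem _⟩
  refine ⟨a, ha, fun s hs => ?_⟩
  have h1 := hmax (a * s) (mul_mem ha (Subgroup.subset_closure hs))
  obtain ⟨c, hc, hr⟩ := hP.reflection s hs
  rw [map_mul_apply, hr, map_sub, map_sub, map_zsmul, map_zsmul, sub_le_self_iff] at h1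
  by_contra hn
  exact absurd h1 (not_le.2 (smul_neg_of_pos_of_neg hc (not_le.1 hn)))

end PositiveSystem

/-! ### Chambers and lexicographic perturbation -/

section Chambers

variable {A : Type*} [AddCommGroup A] [LinearOrder A]

/-- `a` is the element of `W_K` that corresponds to the chamber containing the functional `f`,
infinitesimally perturbed by `h`. -/
def IsChamber (ρ : G →* Module.End ℤ V) (h : V →+ ℤ) (α : G → V) (K : Set G) (f : V →+ A)
    (a : G) : Prop :=
  a ∈ Subgroup.closure K ∧
    ∀ s ∈ K, 0 ≤ f (ρ a (α s)) ∧ (f (ρ a (α s)) = 0 → 0 < h (ρ a (α s)))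

/-- The element of `W_K` that corresponds to the chamber containing the functional `f`,
infinitesimally perturbed by `h`. -/
def chamber (ρ : G →* Module.End ℤ V) (h : V →+ ℤ) (α : G → V) (K : Set G) (f : V →+ A) : G :=
  Classical.epsilon (IsChamber ρ h α K f)

/-- The functional with values in the lexicographic product. -/
def lexHom {B C : Type*} [AddCommGroup B] [AddCommGroup C] (f : V →+ B) (g : V →+ C) :
    V →+ B ×ₗ C where
  toFun v := toLex (f v, g v)
  map_zero' := by simp
  map_add' v w := by rw [map_add, map_add]; rfl

theorem lexHom_eq_zero_iff {B C : Type*} [AddCommGroup B] [AddCommGroup C] {f : V →+ B}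
    {g : V →+ C} {v : V} : lexHom f g v = 0 ↔ f v = 0 ∧ g v = 0 :=
  Prod.mk_eq_zero

theorem lexHom_nonneg_iff {B C : Type*} [AddCommGroup B] [AddCommGroup C] [LinearOrder B]
    [LinearOrder C] {f : V →+ B} {g : V →+ C} {v : V} :
    0 ≤ lexHom f g v ↔ 0 ≤ f v ∧ (f v = 0 → 0 ≤ g v) := by
  change toLex ((0 : B), (0 : C)) ≤ toLex (f v, g v) ↔ _
  rw [Prod.Lex.toLex_le_toLex]
  constructor
  · rintro (h1 | ⟨h1, h2⟩)
    · exact ⟨h1.le, fun h3 => absurd h3 h1.ne'⟩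
    · exact ⟨h1.le, fun _ => h2⟩
  · rintro ⟨h1, h2⟩
    rcases h1.lt_or_eq with h1 | h1
    · exact Or.inl h1
    · exact Or.inr ⟨h1, h2 h1.symm⟩

theorem pullback_lexHom {B C : Type*} [AddCommGroup B] [AddCommGroup C] (f : V →+ B) (g : V →+ C)
    (w : G) : pullback ρ w (lexHom f g) = lexHom (pullback ρ w f) (pullback ρ w g) := rfl

namespace PositiveSystem

variable (hP : PositiveSystem ρ h δ α Φ K)
include hP

variable [IsOrderedAddMonoid A]

/-- Make the lexicographic pair `(f, h)` dominant; the inequality for `h` is strict because `h`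
vanishes on no root. -/
theorem exists_isChamber [Finite G] (f : V →+ A) : ∃ a, IsChamber ρ h α K f a := by
  obtain ⟨a, ha, hp⟩ := hP.exists_nonneg (lexHom f h)
  refine ⟨a, ha, fun s hs => ?_⟩
  obtain ⟨h1, h2⟩ := lexHom_nonneg_iff.1 (hp s hs)
  exact ⟨h1, fun h0 => lt_of_le_of_ne (h2 h0) (hP.height_ne_zero ha (hP.root_mem s hs)).symm⟩

theorem isChamber_pos {f : V →+ A} {a : G} (ha : IsChamber ρ h α K f a) {β : V} (hβ : β ∈ Φ) :
    0 ≤ f (ρ a β) ∧ (f (ρ a β) = 0 → 0 < h (ρ a β)) :=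
  ⟨hP.nonneg_of_dominant (f := pullback ρ a f) (fun s hs => (ha.2 s hs).1) hβ, fun h0 =>
    hP.pos_of_dominant (f := pullback ρ a f) (fun s hs => (ha.2 s hs).1) ha.1
      (fun s hs => (ha.2 s hs).2) hβ h0⟩

/-- A simple root on whose sign `a` and `b` disagree would have an image where `(f, h)` is both
nonnegative and nonpositive, whereas this pair is nonzero on every root. -/
theorem isChamber_unique {f : V →+ A} {a b : G} (ha : IsChamber ρ h α K f a)
    (hb : IsChamber ρ h α K f b) : a = b := by
  have hc : a⁻¹ * b ∈ Subgroup.closure K := mul_mem (inv_mem ha.1) hb.1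
  have h1 : a⁻¹ * b = 1 := by
    refine hP.eq_one_of_pos hc fun s hs => ?_
    by_contra hn
    have hn' := lt_of_le_of_ne (not_lt.1 hn) (hP.height_ne_zero hc (hP.root_mem s hs))
    obtain ⟨h1, h2⟩ := hP.isChamber_pos ha (hP.neg_mem_of_neg hc (hP.root_mem s hs) hn')
    obtain ⟨h3, h4⟩ := hb.2 s hs
    rw [map_mul_apply, map_neg, map_self_apply_inv, map_neg] at h1 h2
    have h5 : f (ρ b (α s)) = 0 := le_antisymm (by simpa using h1) h3
    have h6 := h2 (by rw [h5, neg_zero])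
    rw [map_neg] at h6
    have := h4 h5
    omega
  exact (inv_mul_eq_one.1 h1)

theorem chamber_spec [Finite G] (f : V →+ A) : IsChamber ρ h α K f (chamber ρ h α K f) :=
  Classical.epsilon_spec (hP.exists_isChamber f)

theorem chamber_eq [Finite G] {f : V →+ A} {a : G} (ha : IsChamber ρ h α K f a) :
    chamber ρ h α K f = a :=
  hP.isChamber_unique (hP.chamber_spec f) ha

end PositiveSystem

end Chambers

/-! ### Sums over stable sets of functionals -/

section Sums

/-- `X_I^K` as a finite set. -/
def minRepsFinset [Finite G] (K I : Set G) : Finset G := (Set.toFinite (minReps K I)).toFinset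

@[simp]
theorem mem_minRepsFinset [Finite G] {K I : Set G} {w : G} :
    w ∈ minRepsFinset K I ↔ w ∈ minReps K I := by simp [minRepsFinset]

theorem x_eq_sum [Finite G] (K I : Set G) :
    x K I = ∑ w ∈ minRepsFinset K I, MonoidAlgebra.single w 1 :=
  finsum_mem_eq_finite_toFinset_sum _ _

open Classical in
/-- A stable set of functionals is the disjoint union of the orbits of its dominant members, each of
which is parametrized by minimal coset representatives. -/
theorem PositiveSystem.sum_stable [Finite G] (hP : PositiveSystem ρ h δ α Φ K)
    {A : Type*} [AddCommGroup A] [LinearOrder A] [IsOrderedAddMonoid A] (F : Finset (V →+ A))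
    (hF : ∀ f ∈ F, ∀ w ∈ Subgroup.closure K, pullback ρ w f ∈ F) {M : Type*} [AddCommMonoid M]
    (φ : (V →+ A) → M) :
    ∑ f ∈ F, φ f = ∑ f ∈ F with ∀ s ∈ K, 0 ≤ f (α s),
      ∑ a ∈ minRepsFinset K {s ∈ K | f (α s) = 0}, φ (pullback ρ a⁻¹ f) := by
  rw [Finset.sum_sigma']
  -- A functional corresponds to its dominant conjugate together with its chamber; the latter is
  -- automatically a minimal representative for the stabilizer of the former.
  refine Finset.sum_bij' (fun f _ => (⟨pullback ρ (chamber ρ h α K f) f, chamber ρ h α K f⟩ :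
    Σ _ : V →+ A, G)) (fun p _ => pullback ρ p.2⁻¹ p.1) ?_ ?_ ?_ ?_ ?_
  · intro f hf
    obtain ⟨h1, h2⟩ := hP.chamber_spec f
    refine Finset.mem_sigma.2 ⟨Finset.mem_filter.2 ⟨hF f hf _ h1, fun s hs => (h2 s hs).1⟩, ?_⟩
    rw [mem_minRepsFinset, hP.mem_minReps_iff (Set.sep_subset _ _)]
    exact ⟨h1, fun s hs => (h2 s hs.1).2 hs.2⟩
  · rintro ⟨f, a⟩ hp
    obtain ⟨h1, h2⟩ := Finset.mem_sigma.1 hp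
    rw [mem_minRepsFinset, hP.mem_minReps_iff (Set.sep_subset _ _)] at h2
    exact hF f (Finset.mem_filter.1 h1).1 _ (inv_mem h2.1)
  · intro f hf
    simp [pullback_pullback]
  · rintro ⟨f, a⟩ hp
    obtain ⟨h1, h2⟩ := Finset.mem_sigma.1 hp
    rw [mem_minRepsFinset, hP.mem_minReps_iff (Set.sep_subset _ _)] at h2
    have h3 : chamber ρ h α K (pullback ρ a⁻¹ f) = a := by
      refine hP.chamber_eq ⟨h2.1, fun s hs => ?_⟩
      simp only [pullback_apply, map_inv_apply_self]
      exact ⟨(Finset.mem_filter.1 h1).2 s hs, fun h0 => h2.2 s ⟨hs, h0⟩⟩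
    simp only [h3, pullback_pullback]
    simp
  · intro f hf
    simp [pullback_pullback]

end Sums

end PositiveSystems

/-! ### Projections, orbit splitting and Solomon's theorem -/

section Projections

variable {G V : Type*} [Group G] [AddCommGroup V] {ρ : G →* Module.End ℤ V}
    {h : V →+ ℤ} {δ : V} {α : G → V} {Φ Ψ : Set V} {K L : Set G}

/-- The projection `W_L → W_K`, `w = a d ↦ a`, where `a ∈ W_K` and `d` has minimal length in
`W_K d`. -/
def proj (ρ : G →* Module.End ℤ V) (h : V →+ ℤ) (α : G → V) (K : Set G) (w : G) : G :=
  chamber ρ h α K (pullback ρ w⁻¹ h)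

/-- The linear extension of `proj` to the group algebra. -/
def projLin (ρ : G →* Module.End ℤ V) (h : V →+ ℤ) (α : G → V) (K : Set G) :
    MonoidAlgebra ℚ G →ₗ[ℚ] MonoidAlgebra ℚ G :=
  MonoidAlgebra.mapDomainLinearMap ℚ ℚ (proj ρ h α K)

@[simp]
theorem projLin_single (w : G) (c : ℚ) :
    projLin ρ h α K (MonoidAlgebra.single w c) = MonoidAlgebra.single (proj ρ h α K w) c := by
  simp [projLin]

theorem closure_le_of_subset (hKL : K ⊆ Subgroup.closure L) :
    Subgroup.closure K ≤ Subgroup.closure L :=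
  (Subgroup.closure_le _).2 hKL

namespace PositiveSystem

variable [Finite G]

/-- Every root of `K` is, up to sign, a positive root of `L`, so the sign that `f` and its
perturbation give it is already fixed by the `L`-chamber `w`. Hence the `K`-chamber depends on `w`
only. -/
theorem proj_eq_chamber (hK : PositiveSystem ρ h δ α Φ K) (hL : PositiveSystem ρ h δ α Ψ L)
    (hΦ : Φ ⊆ Ψ) (hKL : K ⊆ Subgroup.closure L) {A : Type*} [AddCommGroup A] [LinearOrder A]
    [IsOrderedAddMonoid A] {f : V →+ A} {w : G} (hw : IsChamber ρ h α L f w) :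
    proj ρ h α K w = chamber ρ h α K f := by
  have ha := hK.chamber_spec f
  set a := chamber ρ h α K f
  refine hK.chamber_eq ⟨ha.1, fun s hs => ?_⟩
  suffices hp : 0 < h (ρ w⁻¹ (ρ a (α s))) from ⟨hp.le, fun h0 => absurd h0 hp.ne'⟩
  have hmem : w⁻¹ * a ∈ Subgroup.closure L :=
    mul_mem (inv_mem hw.1) (closure_le_of_subset hKL ha.1)
  rw [← map_mul_apply]
  rcases hL.map_mem_or hmem (hΦ (hK.root_mem s hs)) with hb | hb
  · exact hL.pos _ hb
  · exfalso
    obtain ⟨h1, h2⟩ := hL.isChamber_pos hw hb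
    obtain ⟨h3, h4⟩ := ha.2 s hs
    rw [map_neg, map_mul_apply, map_self_apply_inv, map_neg] at h1 h2
    have h5 : f (ρ a (α s)) = 0 := le_antisymm (by simpa using h1) h3
    have h6 := h2 (by rw [h5, neg_zero])
    rw [map_neg] at h6
    have := h4 h5
    omega

theorem proj_mem (hK : PositiveSystem ρ h δ α Φ K) (w : G) :
    proj ρ h α K w ∈ Subgroup.closure K :=
  (hK.chamber_spec _).1

theorem isChamber_proj (hK : PositiveSystem ρ h δ α Φ K) (w : G) :
    IsChamber ρ h α K (pullback ρ w⁻¹ h) (proj ρ h α K w) :=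
  hK.chamber_spec _

/-- Apply the previous principle to the functional `h` transported by `w`: its `L`-chamber is `proj
ρ h α L w` and its `K`-chamber is `proj ρ h α K w`. -/
theorem proj_proj (hK : PositiveSystem ρ h δ α Φ K) (hL : PositiveSystem ρ h δ α Ψ L)
    (hΦ : Φ ⊆ Ψ) (hKL : K ⊆ Subgroup.closure L) (w : G) :
    proj ρ h α K (proj ρ h α L w) = proj ρ h α K w :=
  hK.proj_eq_chamber hL hΦ hKL (hL.isChamber_proj w)

/-- With `w = a d` and `a` the projection, `w⁻¹ * a` is `d⁻¹`; its positivity on the simple roots of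
`K` says that `d` is minimal in its coset. -/
theorem proj_pos (hK : PositiveSystem ρ h δ α Φ K) (hL : PositiveSystem ρ h δ α Ψ L)
    (hΦ : Φ ⊆ Ψ) (hKL : K ⊆ Subgroup.closure L) {w : G} (hw : w ∈ Subgroup.closure L)
    {s : G} (hs : s ∈ K) : 0 < h (ρ (w⁻¹ * proj ρ h α K w) (α s)) := by
  have hp := ((hK.isChamber_proj w).2 s hs).1
  rw [pullback_apply, ← map_mul_apply] at hp
  exact lt_of_le_of_ne hp (hL.height_ne_zero (mul_mem (inv_mem hw)
    (closure_le_of_subset hKL (hK.proj_mem w))) (hΦ (hK.root_mem s hs))).symm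

theorem proj_eq_of_pos (hK : PositiveSystem ρ h δ α Φ K) {w a : G} (ha : a ∈ Subgroup.closure K)
    (hp : ∀ s ∈ K, 0 < h (ρ (w⁻¹ * a) (α s))) : proj ρ h α K w = a := by
  refine hK.chamber_eq ⟨ha, fun s hs => ?_⟩
  have := hp s hs
  rw [map_mul_apply] at this
  exact ⟨this.le, fun h0 => absurd h0 this.ne'⟩

-- The chamber recovers the minimal representative from its point in the orbit of `f`; hence the map
-- from `X_I^K` to the orbit is injective.
omit [Finite G] in
theorem isChamber_pullback (hK : PositiveSystem ρ h δ α Φ K) {A : Type*} [AddCommGroup A]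
    [LinearOrder A] {f : V →+ A} (hf : ∀ s ∈ K, 0 ≤ f (α s)) {a : G}
    (ha : a ∈ minReps K {s ∈ K | f (α s) = 0}) :
    IsChamber ρ h α K (pullback ρ a⁻¹ f) a := by
  rw [hK.mem_minReps_iff (Set.sep_subset _ _)] at ha
  refine ⟨ha.1, fun s hs => ?_⟩
  simp only [pullback_apply, map_inv_apply_self]
  exact ⟨hf s hs, fun h0 => ha.2 s ⟨hs, h0⟩⟩

/-- Every functional in the orbit of a dominant one comes from a minimal coset representative. -/
theorem exists_minRep (hK : PositiveSystem ρ h δ α Φ K) {A : Type*} [AddCommGroup A]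
    [LinearOrder A] [IsOrderedAddMonoid A] {f : V →+ A} (hf : ∀ s ∈ K, 0 ≤ f (α s)) {w : G}
    (hw : w ∈ Subgroup.closure K) :
    ∃ a ∈ minReps K {s ∈ K | f (α s) = 0}, pullback ρ a⁻¹ f = pullback ρ w⁻¹ f := by
  obtain ⟨a, ha, hp⟩ := hK.exists_isChamber (pullback ρ w⁻¹ f)
  have h1 := (hK.dominant_orbit hf (w := w⁻¹ * a) (mul_mem (inv_mem hw) ha) fun s hs => by
    rw [map_mul_apply]; exact (hp s hs).1).1
  refine ⟨a, ?_, ?_⟩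
  · rw [hK.mem_minReps_iff (Set.sep_subset _ _)]
    refine ⟨ha, fun s hs => (hp s hs.1).2 ?_⟩
    rw [pullback_apply, ← map_mul_apply, ← pullback_apply, h1]
    exact hs.2
  · nth_rewrite 1 [← h1]
    rw [pullback_pullback, mul_assoc, mul_inv_cancel, mul_one]

omit [Finite G] in
/-- The simple reflections that fix a given member of an orbit. -/
theorem zeros_pullback (hK : PositiveSystem ρ h δ α Φ K) (hL : PositiveSystem ρ h δ α Ψ L)
    (hKL : K ⊆ Subgroup.closure L) {I : Set G} {A : Type*} [AddCommGroup A]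
    [LinearOrder A] [IsOrderedAddMonoid A] {f : V →+ A} (hf : ∀ s ∈ L, 0 ≤ f (α s))
    (hI : {s ∈ L | f (α s) = 0} = I) {d : G} (hd : d ∈ Subgroup.closure L) :
    {s ∈ K | (pullback ρ d⁻¹ f) (α s) = 0} =
      K ∩ MulAut.conj d '' (Subgroup.closure I : Set G) := by
  ext s
  refine and_congr_right fun hs => ?_
  have h1 : (pullback ρ d⁻¹ f) (α s) = 0 ↔ pullback ρ (d⁻¹ * s * d) f = f := by
    have h2 : pullback ρ (d⁻¹ * s * d) f = pullback ρ d (pullback ρ s (pullback ρ d⁻¹ f)) := by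
      rw [pullback_pullback, pullback_pullback, mul_assoc]
    rw [h2]
    constructor
    · intro h0
      rw [hK.pullback_eq_of_root_eq_zero hs h0, pullback_pullback]; simp
    · intro h0
      refine hK.root_eq_zero_of_pullback_eq hs ?_
      have h3 := congrArg (pullback ρ d⁻¹) h0
      rwa [pullback_pullback d⁻¹ d, mul_inv_cancel, pullback_one] at h3
  rw [h1, ← hL.mem_closure_iff_pullback_eq hf
    (mul_mem (mul_mem (inv_mem hd) (hKL hs)) hd), hI]
  constructor
  · intro h2
    exact ⟨_, h2, by simp [mul_assoc]⟩
  · rintro ⟨y, hy, hys⟩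
    rw [← hys]
    simpa [mul_assoc] using hy

-- Used to detect the points of a `W_L`-orbit that are dominant for `K`. If `d⁻¹ β` were negative
-- while `f` is nonnegative there, `f` would vanish on it, so minimality of `d` would make `-β`
-- positive.
omit [Finite G] in
theorem nonneg_iff_height_pos (hL : PositiveSystem ρ h δ α Ψ L) {I : Set G} {A : Type*}
    [AddCommGroup A] [LinearOrder A] [IsOrderedAddMonoid A] {f : V →+ A}
    (hf : ∀ s ∈ L, 0 ≤ f (α s)) (hI : {s ∈ L | f (α s) = 0} = I) {d : G} (hd : d ∈ minReps L I)
    {β : V} (hβ : β ∈ Ψ) : 0 ≤ f (ρ d⁻¹ β) ↔ 0 < h (ρ d⁻¹ β) := by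
  rw [← hI, hL.mem_minReps_iff (Set.sep_subset _ _)] at hd
  constructor
  · intro hp
    by_contra hn
    have hn' := lt_of_le_of_ne (not_lt.1 hn) (hL.height_ne_zero (inv_mem hd.1) hβ)
    have h1 := hL.neg_mem_of_neg (inv_mem hd.1) hβ hn'
    have h2 := hL.nonneg_of_dominant hf h1
    rw [map_neg, Left.nonneg_neg_iff] at h2
    have h3 := hL.pos_of_dominant hf hd.1 (fun s hs h0 => hd.2 s ⟨hs, h0⟩) h1
      (by rw [map_neg, le_antisymm h2 hp, neg_zero])
    rw [map_neg, map_self_apply_inv, map_neg] at h3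
    have := hL.pos _ hβ
    omega
  · intro hp
    exact hL.nonneg_of_dominant hf (hL.mem_of_pos (inv_mem hd.1) hβ hp)

open Classical in
/-- The sum over an orbit of `W_L`, split into orbits of `W_K`. -/
theorem sum_minReps_restrict (hK : PositiveSystem ρ h δ α Φ K) (hL : PositiveSystem ρ h δ α Ψ L)
    (hΦ : Φ ⊆ Ψ) (hKL : K ⊆ Subgroup.closure L) {I : Set G} {A : Type*} [AddCommGroup A]
    [LinearOrder A] [IsOrderedAddMonoid A] {f : V →+ A} (hf : ∀ s ∈ L, 0 ≤ f (α s))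
    (hI : {s ∈ L | f (α s) = 0} = I) {M : Type*} [AddCommMonoid M] (φ : (V →+ A) → M) :
    ∑ w ∈ minRepsFinset L I, φ (pullback ρ w⁻¹ f) =
      ∑ d ∈ minRepsFinset L I with ∀ s ∈ K, 0 < h (ρ d⁻¹ (α s)),
        ∑ a ∈ minRepsFinset K (K ∩ MulAut.conj d '' (Subgroup.closure I : Set G)),
          φ (pullback ρ a⁻¹ (pullback ρ d⁻¹ f)) := by
  have hIL : I ⊆ L := hI ▸ Set.sep_subset _ _
  have hinj : Set.InjOn (fun w => pullback ρ w⁻¹ f) (minRepsFinset L I) := by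
    intro a ha b hb hab
    simp only [Finset.mem_coe, mem_minRepsFinset, ← hI] at ha hb
    have h1 := hL.isChamber_pullback hf ha
    have hab' : pullback ρ a⁻¹ f = pullback ρ b⁻¹ f := hab
    rw [hab'] at h1
    exact hL.isChamber_unique h1 (hL.isChamber_pullback hf hb)
  set F : Finset (V →+ A) := (minRepsFinset L I).image fun w => pullback ρ w⁻¹ f with hFdef
  have hF : ∀ g ∈ F, ∀ w ∈ Subgroup.closure K, pullback ρ w g ∈ F := by
    intro g hg w hw
    obtain ⟨a, ha, rfl⟩ := Finset.mem_image.1 hg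
    rw [mem_minRepsFinset, hL.mem_minReps_iff hIL] at ha
    obtain ⟨b, hb, hb'⟩ := hL.exists_minRep hf
      (mul_mem (inv_mem (closure_le_of_subset hKL hw)) ha.1)
    refine Finset.mem_image.2 ⟨b, by rwa [mem_minRepsFinset, ← hI], ?_⟩
    rw [hb', pullback_pullback]; simp
  -- The `W_L`-orbit is regarded as a `W_K`-stable set; its dominant points are the ones indexed by
  -- those `d` whose inverse keeps the simple roots of `K` positive.
  rw [← Finset.sum_image (f := φ) hinj, hK.sum_stable F hF, hFdef, Finset.filter_image,
    Finset.sum_image (hinj.mono (Finset.coe_subset.2 (Finset.filter_subset _ _)))]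
  refine Finset.sum_congr ?_ fun d hd => ?_
  · ext d
    rw [Finset.mem_filter, Finset.mem_filter, mem_minRepsFinset, hL.mem_minReps_iff hIL]
    simp only [pullback_apply]
    refine and_congr_right fun hd => forall₂_congr fun s hs => ?_
    exact hL.nonneg_iff_height_pos hf hI ((hL.mem_minReps_iff hIL).2 hd) (hΦ (hK.root_mem s hs))
  · have hd' := (Finset.mem_filter.1 hd).1
    rw [mem_minRepsFinset, hL.mem_minReps_iff hIL] at hd'
    congr 2
    exact hK.zeros_pullback hL hKL hf hI hd'.1

omit [Finite G] in
theorem exists_coweight (hK : PositiveSystem ρ h δ α Φ K) {I : Set G} (hI : I ⊆ K) :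
    ∃ f : V →+ ℤ, (∀ s ∈ K, 0 ≤ f (α s)) ∧ {s ∈ K | f (α s) = 0} = I := by
  obtain ⟨f, h0, hp⟩ := hK.coweight I hI
  refine ⟨f, fun s hs => ?_, ?_⟩
  · by_cases hsI : s ∈ I
    · rw [h0 s hsI]
    · exact (hp s ⟨hs, hsI⟩).le
  · ext s
    refine ⟨fun hs => ?_, fun hs => ⟨hI hs, h0 s hs⟩⟩
    by_contra hsI
    exact (hp s ⟨hs.1, hsI⟩).ne' hs.2

-- On the sum of the `L`-chambers of an orbit the projection replaces each `L`-chamber by the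
-- `K`-chamber of the same functional, and each `W_K`-orbit inside contributes one element `x^K`.
open Classical in
theorem projLin_x (hK : PositiveSystem ρ h δ α Φ K) (hL : PositiveSystem ρ h δ α Ψ L)
    (hΦ : Φ ⊆ Ψ) (hKL : K ⊆ Subgroup.closure L) {I : Set G} (hI : I ⊆ L) :
    projLin ρ h α K (x L I) =
      ∑ d ∈ minRepsFinset L I with ∀ s ∈ K, 0 < h (ρ d⁻¹ (α s)),
        x K (K ∩ MulAut.conj d '' (Subgroup.closure I : Set G)) := by
  obtain ⟨f, hf, rfl⟩ := hL.exists_coweight hI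
  have h1 : projLin ρ h α K (x L {s ∈ L | f (α s) = 0}) =
      ∑ w ∈ minRepsFinset L {s ∈ L | f (α s) = 0},
        MonoidAlgebra.single (chamber ρ h α K (pullback ρ w⁻¹ f)) 1 := by
    rw [x_eq_sum, map_sum]
    refine Finset.sum_congr rfl fun w hw => ?_
    rw [projLin_single, hK.proj_eq_chamber hL hΦ hKL
      (hL.isChamber_pullback hf (mem_minRepsFinset.1 hw))]
  have hlow : ∀ d, d ∈ minRepsFinset L {s ∈ L | f (α s) = 0} →
      d ∈ Subgroup.closure L := fun d hd => (mem_minRepsFinset.1 hd).1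
  rw [h1, hK.sum_minReps_restrict hL hΦ hKL hf rfl
    fun g => MonoidAlgebra.single (chamber ρ h α K g) (1 : ℚ)]
  refine Finset.sum_congr rfl fun d hd => ?_
  rw [x_eq_sum]
  refine Finset.sum_congr rfl fun a ha => ?_
  have hd' := Finset.mem_filter.1 hd
  rw [mem_minRepsFinset, hK.mem_minReps_iff Set.inter_subset_left] at ha
  have hdom : ∀ s ∈ K, 0 ≤ f (ρ d⁻¹ (α s)) := fun s hs => hL.nonneg_of_dominant hf
    (hL.mem_of_pos (inv_mem (hlow d hd'.1)) (hΦ (hK.root_mem s hs)) (hd'.2 s hs))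
  congr 1
  refine hK.chamber_eq (hK.isChamber_pullback hdom ?_)
  have hT := hK.zeros_pullback hL hKL hf rfl (hlow d hd'.1)
  rwa [hT, hK.mem_minReps_iff Set.inter_subset_left]

open Classical in
theorem sum_chamber_stable (hP : PositiveSystem ρ h δ α Φ K) {A : Type*} [AddCommGroup A]
    [LinearOrder A] [IsOrderedAddMonoid A] (F : Finset (V →+ A))
    (hF : ∀ f ∈ F, ∀ w ∈ Subgroup.closure K, pullback ρ w f ∈ F) :
    ∑ f ∈ F, MonoidAlgebra.single (chamber ρ h α K f) (1 : ℚ) =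
      ∑ f ∈ F with ∀ s ∈ K, 0 ≤ f (α s), x K {s ∈ K | f (α s) = 0} := by
  rw [hP.sum_stable F hF]
  refine Finset.sum_congr rfl fun f hf => ?_
  rw [x_eq_sum]
  refine Finset.sum_congr rfl fun a ha => ?_
  rw [hP.chamber_eq (hP.isChamber_pullback (Finset.mem_filter.1 hf).2 (mem_minRepsFinset.1 ha))]

/-- Solomon's theorem: the descent space is closed under multiplication. -/
theorem x_mul_x_mem (hP : PositiveSystem ρ h δ α Φ K) {I J : Set G} (hI : I ⊆ K) (hJ : J ⊆ K) :
    x K J * x K I ∈ descentSpace K := by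
  classical
  obtain ⟨u, hu, rfl⟩ := hP.exists_coweight hI
  obtain ⟨v, hv, rfl⟩ := hP.exists_coweight hJ
  set I := {s ∈ K | u (α s) = 0}
  set J := {s ∈ K | v (α s) = 0}
  -- The product of `w ∈ X_J` and `w' ∈ X_I` is the chamber of this pair: `u` transported by `w *
  -- w'` decides first, and ties are broken by `v` transported by `w`. This is the product of faces
  -- in the Coxeter complex.
  let e : G × G → (V →+ ℤ ×ₗ ℤ) := fun p =>
    lexHom (pullback ρ (p.1 * p.2)⁻¹ u) (pullback ρ p.1⁻¹ v)
  have hch : ∀ p ∈ minRepsFinset K J ×ˢ minRepsFinset K I,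
      chamber ρ h α K (e p) = p.1 * p.2 := by
    rintro ⟨w, w'⟩ hp
    simp only [Finset.mem_product, mem_minRepsFinset, hP.mem_minReps_iff hI,
      hP.mem_minReps_iff hJ] at hp
    obtain ⟨⟨hw, hwJ⟩, hw', hwI⟩ := hp
    refine hP.chamber_eq ⟨mul_mem hw hw', fun s hs => ?_⟩
    have hval : ∀ β : V, pullback ρ w⁻¹ v (ρ (w * w') β) = v (ρ w' β) := by
      intro β; simp
    rw [lexHom_nonneg_iff, lexHom_eq_zero_iff, hval, pullback_apply, map_inv_apply_self]
    have hpos : u (α s) = 0 → ρ w' (α s) ∈ Φ := fun h0 =>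
      hP.mem_of_pos hw' (hP.root_mem s hs) (hwI s ⟨hs, h0⟩)
    refine ⟨⟨hu s hs, fun h0 => hP.nonneg_of_dominant hv (hpos h0)⟩, fun h0 => ?_⟩
    rw [map_mul_apply]
    exact hP.pos_of_dominant hv hw (fun s hs h0 => hwJ s ⟨hs, h0⟩) (hpos h0.1) h0.2
  have hinj : Set.InjOn e (minRepsFinset K J ×ˢ minRepsFinset K I : Finset (G × G)) := by
    intro p hp q hq hpq
    have h1 := hch p hp
    rw [hpq, hch q hq] at h1
    simp only [Finset.coe_product, Set.mem_prod, Finset.mem_coe, mem_minRepsFinset] at hp hq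
    -- The second component of the pair determines the first factor; the chamber is the product, so
    -- it then gives the second factor.
    have h2 : p.1 = q.1 := by
      have h3 : pullback ρ p.1⁻¹ v = pullback ρ q.1⁻¹ v := by
        ext β
        have := DFunLike.congr_fun hpq β
        exact congrArg (fun z => (ofLex z).2) this
      have h4 := hP.isChamber_pullback hv hp.1
      rw [h3] at h4
      exact hP.isChamber_unique h4 (hP.isChamber_pullback hv hq.1)
    rw [h2] at h1
    exact Prod.ext h2 (mul_left_cancel h1).symm
  set F := (minRepsFinset K J ×ˢ minRepsFinset K I).image e with hFdef
  have hF : ∀ f ∈ F, ∀ w ∈ Subgroup.closure K, pullback ρ w f ∈ F := by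
    intro f hf g hg
    obtain ⟨⟨w, w'⟩, hp, rfl⟩ := Finset.mem_image.1 hf
    simp only [Finset.mem_product, mem_minRepsFinset] at hp
    -- Transport by `g⁻¹` need not keep the factors minimal, so the first is replaced by a minimal
    -- representative `b` and the second is corrected by `b⁻¹`.
    obtain ⟨b, hb, hb'⟩ := hP.exists_minRep hv (mul_mem (inv_mem hg) hp.1.1)
    obtain ⟨b', hc, hc'⟩ := hP.exists_minRep hu (w := b⁻¹ * (g⁻¹ * (w * w')))
      (mul_mem (inv_mem hb.1) (mul_mem (inv_mem hg) (mul_mem hp.1.1 hp.2.1)))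
    refine Finset.mem_image.2 ⟨(b, b'), ?_, ?_⟩
    · simp only [Finset.mem_product, mem_minRepsFinset]
      exact ⟨hb, hc⟩
    · simp only [e, pullback_lexHom]
      rw [hb', mul_inv_rev b, ← pullback_pullback, hc', pullback_pullback, pullback_pullback,
        pullback_pullback]
      congr 2 <;> group
  have hsum : x K J * x K I =
      ∑ f ∈ F, MonoidAlgebra.single (chamber ρ h α K f) (1 : ℚ) := by
    rw [hFdef, Finset.sum_image hinj, x_eq_sum, x_eq_sum, Finset.sum_mul_sum,
      ← Finset.sum_product']
    refine Finset.sum_congr rfl fun p hp => ?_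
    rw [hch p hp, MonoidAlgebra.single_mul_single, one_mul]
  rw [hsum, hP.sum_chamber_stable F hF]
  exact sum_mem fun f _ => x_mem K (Set.sep_subset _ _)

theorem x_self (hP : PositiveSystem ρ h δ α Φ K) : x K K = 1 := by
  have h1 : minRepsFinset K K = {1} := by
    ext w
    rw [mem_minRepsFinset, hP.mem_minReps_iff subset_rfl, Finset.mem_singleton]
    refine ⟨fun hw => hP.eq_one_of_pos hw.1 hw.2, ?_⟩
    rintro rfl
    exact ⟨one_mem _, fun s hs => by simpa using hP.pos _ (hP.root_mem s hs)⟩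
  rw [x_eq_sum, h1, Finset.sum_singleton, MonoidAlgebra.one_def]

theorem mul_mem_descentSpace (hP : PositiveSystem ρ h δ α Φ K) {a b : MonoidAlgebra ℚ G}
    (ha : a ∈ descentSpace K) (hb : b ∈ descentSpace K) : a * b ∈ descentSpace K := by
  induction ha using Submodule.span_induction with
  | mem a ha =>
    obtain ⟨J, hJ, rfl⟩ := ha
    induction hb using Submodule.span_induction with
    | mem b hb => obtain ⟨I, hI, rfl⟩ := hb; exact hP.x_mul_x_mem hI hJ
    | zero => simp
    | add b c _ _ hb hc => rw [mul_add]; exact add_mem hb hc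
    | smul r b _ hb => rw [mul_smul_comm]; exact Submodule.smul_mem _ _ hb
  | zero => simp
  | add a c _ _ ha hc => rw [add_mul]; exact add_mem ha hc
  | smul r a _ ha => rw [smul_mul_assoc]; exact Submodule.smul_mem _ _ ha

/-- The descent algebra `Σ(W_K)`. -/
def descentAlgebra (hP : PositiveSystem ρ h δ α Φ K) : Subalgebra ℚ (MonoidAlgebra ℚ G) :=
  (descentSpace K).toSubalgebra (hP.x_self ▸ x_mem K subset_rfl)
    fun _ _ => hP.mul_mem_descentSpace

/-- Perturb a coweight vanishing exactly on `K \ D` by `-h` instead of `h`: the chamber found is the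
longest element of the parabolic subgroup generated by `K \ D`. -/
theorem exists_ascents_eq (hP : PositiveSystem ρ h δ α Φ K) {D : Set G} :
    ∃ a ∈ Subgroup.closure K, ∀ s ∈ K, 0 < h (ρ a (α s)) ↔ s ∈ D := by
  obtain ⟨u, hu, hT⟩ := hP.exists_coweight (Set.sdiff_subset : K \ D ⊆ K)
  obtain ⟨a, ha, hp⟩ := hP.exists_nonneg (lexHom u (-h))
  have h1 := (hP.dominant_orbit hu ha fun s hs => (lexHom_nonneg_iff.1 (hp s hs)).1).1
  refine ⟨a, ha, fun s hs => ?_⟩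
  have h2 : u (ρ a (α s)) = u (α s) := DFunLike.congr_fun h1 (α s)
  have h3 : u (α s) = 0 ↔ s ∉ D := by
    constructor
    · intro h0
      exact (hT ▸ (show s ∈ {s ∈ K | u (α s) = 0} from ⟨hs, h0⟩) : s ∈ K \ D).2
    · intro h0
      exact (hT ▸ (show s ∈ K \ D from ⟨hs, h0⟩) : s ∈ {s ∈ K | u (α s) = 0}).2
  constructor
  · intro hpos
    by_contra hsD
    have h4 := (lexHom_nonneg_iff.1 (hp s hs)).2 (h2.trans (h3.2 hsD))
    rw [AddMonoidHom.neg_apply] at h4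
    omega
  · intro hsD
    by_contra hn
    have hn' := lt_of_le_of_ne (not_lt.1 hn) (hP.height_ne_zero ha (hP.root_mem s hs))
    have h5 := hP.nonneg_of_dominant hu (hP.neg_mem_of_neg ha (hP.root_mem s hs) hn')
    rw [map_neg, h2] at h5
    have h6 := hu s hs
    exact h3.1 (by omega) hsD

/-- At an element with ascent set `D` the coefficient of `x_I` is `1` if `I ⊆ D` and `0` otherwise,
so the system is unitriangular for inclusion. -/
theorem linearIndependent_x (hP : PositiveSystem ρ h δ α Φ K) :
    LinearIndependent ℚ fun I : {I : Set G // I ⊆ K} => x K I.1 := by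
  classical
  have := Fintype.ofFinite {I : Set G // I ⊆ K}
  rw [Fintype.linearIndependent_iff]
  intro g hg
  have hcoeff : ∀ D : {I : Set G // I ⊆ K}, ∑ I with I.1 ⊆ D.1, g I = 0 := by
    intro D
    obtain ⟨a, ha, hD⟩ := hP.exists_ascents_eq (D := D.1)
    have h1 := congrArg (fun z => z.coeff a) hg
    simp only [MonoidAlgebra.coeff_sum, MonoidAlgebra.coeff_smul, Finsupp.coe_finsetSum,
      Finset.sum_apply, MonoidAlgebra.coeff_zero, Finsupp.coe_zero, Pi.zero_apply,
      Finsupp.coe_smul, Pi.smul_apply] at h1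
    refine Eq.trans ?_ h1
    rw [Finset.sum_filter]
    refine Finset.sum_congr rfl fun I _ => ?_
    have h2 : (x K I.1).coeff a = if I.1 ⊆ D.1 then 1 else 0 := by
      rw [x_eq_sum, MonoidAlgebra.coeff_sum, Finsupp.coe_finsetSum, Finset.sum_apply]
      simp only [MonoidAlgebra.coeff_single, Finsupp.single_apply]
      rw [Finset.sum_ite_eq']
      congr 1
      rw [mem_minRepsFinset, hP.mem_minReps_iff I.2]
      exact propext ⟨fun h3 s hs => (hD s (I.2 hs)).1 (h3.2 s hs),
        fun h3 => ⟨ha, fun s hs => (hD s (I.2 hs)).2 (h3 hs)⟩⟩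
    rw [h2, smul_eq_mul, mul_ite, mul_one, mul_zero]
  intro D
  induction hn : D.1.ncard using Nat.strong_induction_on generalizing D with
  | _ n ih =>
    subst hn
    have h1 := hcoeff D
    rw [Finset.sum_eq_single D] at h1
    · exact h1
    · intro I hI hID
      have hsub := (Finset.mem_filter.1 hI).2
      exact ih _ (Set.ncard_lt_ncard (lt_of_le_of_ne hsub fun h2 => hID (Subtype.ext h2))
        (Set.toFinite _)) I rfl
    · intro hD
      exact (hD (by simp)).elim

end PositiveSystem

end Projections

/-! ### Characters induced from the trivial representation -/

section Characters

theorem trace_lmapDomain {Q : Type*} [Fintype Q] [DecidableEq Q] (f : Q → Q) :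
    LinearMap.trace ℂ (Q →₀ ℂ) (Finsupp.lmapDomain ℂ ℂ f) =
      ((Finset.univ.filter fun q => f q = q).card : ℂ) := by
  rw [LinearMap.trace_eq_matrix_trace ℂ Finsupp.basisSingleOne, Matrix.trace, Finset.card_filter,
    Nat.cast_sum]
  refine Finset.sum_congr rfl fun q _ => ?_
  simp [LinearMap.toMatrix_apply, Finsupp.single_apply]

variable {H : Type*} [Group H]

/-- The representation induced from the trivial one is the permutation representation on cosets. -/
def indTrivialEquiv (N : Subgroup H) :
    Representation.IndV N.subtype (Representation.trivial ℂ N ℂ) ≃ₗ[ℂ]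
      (Quotient (QuotientGroup.rightRel N) →₀ ℂ) :=
  LinearEquiv.ofLinearMap
    (Representation.Coinvariants.lift _
      (Finsupp.lmapDomain ℂ ℂ (Quotient.mk (QuotientGroup.rightRel N)) ∘ₗ
        (MonoidAlgebra.coeffLinearEquiv ℂ).toLinearMap ∘ₗ
          (TensorProduct.rid ℂ (MonoidAlgebra ℂ H)).toLinearMap) (by
        intro n
        ext x
        have : Quotient.mk (QuotientGroup.rightRel N) ((n : H) * x) =
            Quotient.mk (QuotientGroup.rightRel N) x := by
          refine Quotient.sound ?_
          rw [← Quotient.eq_iff_equiv, Quotient.eq, QuotientGroup.rightRel_apply]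
          simp
        simp [this]))
    (Finsupp.linearCombination ℂ fun q => Representation.IndV.mk _ _ q.out 1)
    (by
      ext q : 2
      simp)
    (by
      ext x
      have h1 : ∀ y z : H, QuotientGroup.rightRel N y z →
          Representation.IndV.mk N.subtype (Representation.trivial ℂ N ℂ) y 1 =
            Representation.IndV.mk N.subtype (Representation.trivial ℂ N ℂ) z 1 := by
        intro y z hyz
        rw [QuotientGroup.rightRel_apply] at hyz
        have h2 := Representation.Coinvariants.mk_self_apply
          (Representation.tprod ((Representation.leftRegular ℂ H).comp N.subtype)
            (Representation.trivial ℂ N ℂ)) ⟨_, hyz⟩ (MonoidAlgebra.single y 1 ⊗ₜ[ℂ] (1 : ℂ))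
        simpa using h2.symm
      have h3 := h1 _ _ (Quotient.exact (Quotient.out_eq (Quotient.mk (QuotientGroup.rightRel N) x)))
      simpa using h3)

-- In the coset model `g` acts by right translation by `g⁻¹`, so its trace counts the fixed right
-- cosets of `N`.
open Classical in
theorem character_ind_trivial [Finite H] (N : Subgroup H)
    [Fintype (Quotient (QuotientGroup.rightRel N))] (g : H) :
    (Representation.ind N.subtype (Representation.trivial ℂ N ℂ)).character g =
      ((Finset.univ.filter fun q : Quotient (QuotientGroup.rightRel N) =>
        Quotient.mk _ (q.out * g⁻¹) = q).card : ℂ) := by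
  rw [← trace_lmapDomain (fun q : Quotient (QuotientGroup.rightRel N) =>
    Quotient.mk _ (q.out * g⁻¹)), Representation.character,
    ← LinearMap.trace_conj' _ (indTrivialEquiv N)]
  congr 1
  ext q : 2
  simp [LinearEquiv.conj_apply, indTrivialEquiv]

theorem finite_indV [Finite H] (N : Subgroup H) :
    Module.Finite ℂ (Representation.IndV N.subtype (Representation.trivial ℂ N ℂ)) :=
  Module.Finite.equiv (indTrivialEquiv N).symm

theorem character_mem_QIrr {V : Type*} [AddCommGroup V] [Module ℂ V] [Module.Finite ℂ V]
    (ρ : Representation ℂ H V) : ρ.character ∈ QIrr H := by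
  let e := (Module.finBasis ℂ V).equivFun
  refine Submodule.subset_span ⟨_, e.conjRingEquiv.toMonoidHom.comp ρ, ?_⟩
  ext g
  exact (LinearMap.trace_conj' (ρ g) e).symm

end Characters

/-! ### Induced characters in terms of minimal representatives -/

section Induced

variable {G V : Type*} [Group G] [Finite G] [AddCommGroup V] {ρ : G →* Module.End ℤ V}
    {h : V →+ ℤ} {δ : V} {α : G → V} {Φ Ψ : Set V} {K L : Set G}

theorem indTrivial_mem_QIrr (K I : Set G) : indTrivial K I ∈ QIrr (Subgroup.closure K) := by
  have := finite_indV ((Subgroup.closure I).subgroupOf (Subgroup.closure K))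
  exact character_mem_QIrr _

namespace PositiveSystem

-- The right cosets of `W_I` are the `W_I a⁻¹` with `a ∈ X_I^K`, and such a coset is fixed by `g`
-- exactly when `a⁻¹ g a ∈ W_I`. Replacing cosets by representatives makes the orbit sums applicable
-- to characters.
open Classical in
theorem indTrivial_apply (hP : PositiveSystem ρ h δ α Φ K) {I : Set G} (hI : I ⊆ K)
    (g : Subgroup.closure K) :
    indTrivial K I g =
      (((minRepsFinset K I).filter fun a =>
        a⁻¹ * (g : G) * a ∈ Subgroup.closure I).card : ℂ) := by
  have := Fintype.ofFinite (Quotient (QuotientGroup.rightRel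
    ((Subgroup.closure I).subgroupOf (Subgroup.closure K))))
  rw [indTrivial, character_ind_trivial]
  obtain ⟨f, hf, hfI⟩ := hP.exists_coweight hI
  have hmem : ∀ {w : G}, w ∈ Subgroup.closure K →
      (w ∈ Subgroup.closure I ↔ pullback ρ w f = f) := fun hw => by
    rw [← hfI]; exact hP.mem_closure_iff_pullback_eq hf hw
  congr 1
  symm
  have hK : ∀ a ∈ minRepsFinset K I, a ∈ Subgroup.closure K := fun a ha =>
    (mem_minRepsFinset.1 ha).1
  have hrel : ∀ y z : Subgroup.closure K, (Quotient.mk (QuotientGroup.rightRel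
      ((Subgroup.closure I).subgroupOf (Subgroup.closure K))) y = Quotient.mk _ z) ↔
      (z * y⁻¹ : G) ∈ Subgroup.closure I := by
    intro y z
    rw [Quotient.eq, QuotientGroup.rightRel_apply, Subgroup.mem_subgroupOf]; rfl
  refine Finset.card_bij (fun a ha => Quotient.mk _
    ⟨a⁻¹, inv_mem (hK a (Finset.mem_filter.1 ha).1)⟩) ?_ ?_ ?_
  · intro a ha
    obtain ⟨ha, hag⟩ := Finset.mem_filter.1 ha
    refine Finset.mem_filter.2 ⟨Finset.mem_univ _, ?_⟩
    set q := Quotient.mk (QuotientGroup.rightRel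
      ((Subgroup.closure I).subgroupOf (Subgroup.closure K))) ⟨a⁻¹, inv_mem (hK a ha)⟩ with hq
    have h1 := (hrel q.out ⟨a⁻¹, inv_mem (hK a ha)⟩).1 (Quotient.out_eq q)
    refine (hrel _ _).2 ?_
    have h2 := mul_mem hag h1
    simp only [Subgroup.coe_mul, InvMemClass.coe_inv, mul_inv_rev, inv_inv] at h1 h2 ⊢
    convert h2 using 1
    group
  · intro a ha b hb hab
    have ha' := (Finset.mem_filter.1 ha).1
    have hb' := (Finset.mem_filter.1 hb).1
    rw [hrel] at hab
    simp only [InvMemClass.coe_inv, inv_inv] at hab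
    rw [hmem (mul_mem (inv_mem (hK b hb')) (hK a ha')), ← pullback_pullback] at hab
    have h1 := congrArg (pullback ρ a⁻¹) hab
    rw [pullback_pullback, mul_inv_cancel, pullback_one] at h1
    rw [mem_minRepsFinset, ← hfI] at ha' hb'
    have h2 := hP.isChamber_pullback hf ha'
    rw [← h1] at h2
    exact hP.isChamber_unique h2 (hP.isChamber_pullback hf hb')
  · intro q hq
    obtain ⟨y, rfl⟩ := Quotient.exists_rep q
    obtain ⟨a, ha, hay⟩ := hP.exists_minRep hf (inv_mem y.2)
    have ha' : a ∈ Subgroup.closure K := ha.1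
    rw [hfI] at ha
    have h1 : (y * a : G) ∈ Subgroup.closure I := by
      rw [hmem (mul_mem y.2 ha.1)]
      have h1 := congrArg (pullback ρ a) hay
      rw [pullback_pullback, pullback_pullback, inv_inv, inv_mul_cancel, pullback_one] at h1
      exact h1.symm
    have h2 : Quotient.mk (QuotientGroup.rightRel
      ((Subgroup.closure I).subgroupOf (Subgroup.closure K))) ⟨a⁻¹, inv_mem ha'⟩ =
        Quotient.mk _ y := by
      rw [hrel]; simpa using h1
    refine ⟨a, Finset.mem_filter.2 ⟨mem_minRepsFinset.2 ha, ?_⟩, h2⟩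
    have h3 := (Finset.mem_filter.1 hq).2
    set q := Quotient.mk (QuotientGroup.rightRel
      ((Subgroup.closure I).subgroupOf (Subgroup.closure K))) y with hq
    have h4 := (hrel q.out y).1 (Quotient.out_eq q)
    have h5 := (hrel _ _).1 h3
    simp only [Subgroup.coe_mul, InvMemClass.coe_inv, mul_inv_rev, inv_inv] at h4 h5
    have h6 := mul_mem (mul_mem (inv_mem h1) (mul_mem h5 (inv_mem h4))) h1
    convert h6 using 1
    group

open Classical in
/-- The Mackey formula for the characters induced from the trivial ones. -/
theorem indTrivial_restrict (hK : PositiveSystem ρ h δ α Φ K) (hL : PositiveSystem ρ h δ α Ψ L)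
    (hΦ : Φ ⊆ Ψ) (hKL : K ⊆ Subgroup.closure L) {I : Set G} (hI : I ⊆ L)
    (g : Subgroup.closure K) :
    indTrivial L I (Subgroup.inclusion (closure_le_of_subset hKL) g) =
      ∑ d ∈ minRepsFinset L I with ∀ s ∈ K, 0 < h (ρ d⁻¹ (α s)),
        indTrivial K (K ∩ MulAut.conj d '' (Subgroup.closure I : Set G)) g := by
  obtain ⟨f, hf, hfI⟩ := hL.exists_coweight hI
  have hgL : (g : G) ∈ Subgroup.closure L := closure_le_of_subset hKL g.2
  have hmem : ∀ {w : G}, w ∈ Subgroup.closure L →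
      (w ∈ Subgroup.closure I ↔ pullback ρ w f = f) := fun hw => by
    rw [← hfI]; exact hL.mem_closure_iff_pullback_eq hf hw
  have hfix : ∀ (a : G) (f : V →+ ℤ), pullback ρ (a⁻¹ * g * a) f = f ↔
      pullback ρ (g : G) (pullback ρ a⁻¹ f) = pullback ρ a⁻¹ f := by
    intro a f
    rw [pullback_pullback, ← pullback_pullback]
    constructor
    · intro h1
      have h2 := congrArg (pullback ρ a⁻¹) h1
      rwa [pullback_pullback a⁻¹ a, mul_inv_cancel, pullback_one] at h2
    · intro h1
      rw [h1, pullback_pullback, inv_mul_cancel, pullback_one]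
  -- Both sides count points of one orbit fixed by `g`, so the orbit splitting is applied to the
  -- indicator function of the fixed functionals.
  have key := hK.sum_minReps_restrict hL hΦ hKL hf hfI
    (fun f' => if pullback ρ (g : G) f' = f' then (1 : ℂ) else 0)
  rw [hL.indTrivial_apply hI, Finset.card_filter, Nat.cast_sum]
  refine Eq.trans (Finset.sum_congr rfl fun a ha => ?_) (key.trans
    (Finset.sum_congr rfl fun d hd => ?_))
  · have haL := (mem_minRepsFinset.1 ha).1
    rw [Subgroup.coe_inclusion, hmem (mul_mem (mul_mem (inv_mem haL) hgL) haL), hfix]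
    simp
  · obtain ⟨hd1, hd2⟩ := Finset.mem_filter.1 hd
    have hdL := (mem_minRepsFinset.1 hd1).1
    rw [hK.indTrivial_apply Set.inter_subset_left, Finset.card_filter, Nat.cast_sum]
    have hdom : ∀ s ∈ K, 0 ≤ f (ρ d⁻¹ (α s)) := fun s hs => hL.nonneg_of_dominant hf
      (hL.mem_of_pos (inv_mem hdL) (hΦ (hK.root_mem s hs)) (hd2 s hs))
    have hT : {s ∈ K | (pullback ρ d⁻¹ f) (α s) = 0} =
        K ∩ MulAut.conj d '' (Subgroup.closure I : Set G) := hK.zeros_pullback hL hKL hf hfI hdL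
    refine Finset.sum_congr rfl fun a ha => ?_
    have haK := (mem_minRepsFinset.1 ha).1
    rw [← hT, hK.mem_closure_iff_pullback_eq hdom (mul_mem (mul_mem (inv_mem haK) g.2) haK), hfix]
    simp

end PositiveSystem

end Induced

/-! ### Roots and reflections of types `B` and `D` -/

section RootsB

/-- The coordinate vector `e_k`. -/
def stdVec (k : ℕ) : ℕ → ℤ := Pi.single k 1

theorem stdVec_apply (k i : ℕ) : stdVec k i = if i = k then 1 else 0 := by
  simp [stdVec, Pi.single_apply]

/-- The simple roots of type `B`. -/
def simpleRoot : ℕ → ℕ → ℤ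
  | 0 => stdVec 0
  | k + 1 => stdVec (k + 1) - stdVec k

/-- The simple coroots of type `B`. -/
def simpleCoroot : ℕ → ((ℕ → ℤ) →ₗ[ℤ] ℤ)
  | 0 => (2 : ℤ) • LinearMap.proj (R := ℤ) (φ := fun _ : ℕ => ℤ) 0
  | k + 1 => LinearMap.proj (R := ℤ) (φ := fun _ : ℕ => ℤ) (k + 1) - LinearMap.proj k

/-- The simple reflections of type `B`. -/
def reflect (k : ℕ) : Module.End ℤ (ℕ → ℤ) :=
  LinearMap.id - (simpleCoroot k).smulRight (simpleRoot k)

theorem reflect_apply (k : ℕ) (v : ℕ → ℤ) :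
    reflect k v = v - simpleCoroot k v • simpleRoot k := by
  simp [reflect]

theorem simpleCoroot_zero (v : ℕ → ℤ) : simpleCoroot 0 v = 2 * v 0 := by
  simp [simpleCoroot]

theorem simpleCoroot_succ (k : ℕ) (v : ℕ → ℤ) : simpleCoroot (k + 1) v = v (k + 1) - v k := by
  simp [simpleCoroot]

theorem simpleRoot_succ_apply (k i : ℕ) :
    simpleRoot (k + 1) i = (if i = k + 1 then 1 else 0) - if i = k then 1 else 0 := by
  simp [simpleRoot, stdVec_apply]

theorem simpleRoot_zero_apply (i : ℕ) : simpleRoot 0 i = if i = 0 then 1 else 0 := by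
  simp [simpleRoot, stdVec_apply]

theorem simpleCoroot_self (k : ℕ) : simpleCoroot k (simpleRoot k) = 2 := by
  cases k <;> simp [simpleCoroot_zero, simpleCoroot_succ, simpleRoot_zero_apply,
    simpleRoot_succ_apply]

theorem simpleCoroot_of_far {k l : ℕ} (h : k + 1 < l ∨ l + 1 < k) :
    simpleCoroot k (simpleRoot l) = 0 := by
  rcases k with _ | k <;> rcases l with _ | l <;>
    simp only [simpleCoroot_zero, simpleCoroot_succ, simpleRoot_zero_apply,
      simpleRoot_succ_apply] <;> grind

theorem simpleCoroot_succ_simpleRoot (k : ℕ) : simpleCoroot (k + 1) (simpleRoot k) = -1 := by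
  cases k <;> simp [simpleCoroot_succ, simpleRoot_zero_apply, simpleRoot_succ_apply]; omega

theorem simpleCoroot_zero_simpleRoot_one : simpleCoroot 0 (simpleRoot 1) = -2 := by
  simp [simpleCoroot_zero, simpleRoot_succ_apply]

theorem simpleCoroot_simpleRoot_succ (k : ℕ) :
    simpleCoroot (k + 1) (simpleRoot (k + 2)) = -1 := by
  simp [simpleCoroot_succ, simpleRoot_succ_apply]; omega

theorem simpleCoroot_nonpos {k l : ℕ} (h : k ≠ l) : simpleCoroot k (simpleRoot l) ≤ 0 := by
  rcases k with _ | k <;> rcases l with _ | l <;>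
    simp only [simpleCoroot_zero, simpleCoroot_succ, simpleRoot_zero_apply,
      simpleRoot_succ_apply] <;> grind

theorem reflect_mul_self (k : ℕ) : reflect k * reflect k = 1 := by
  refine LinearMap.ext fun v => ?_
  simp only [Module.End.mul_apply, Module.End.one_apply, reflect_apply, map_sub, map_smul,
    simpleCoroot_self]
  module

/-- The entries of the Coxeter matrix of type `B`. -/
def coxeterEntry (k l : ℕ) : ℕ :=
  if k = l then 1 else if k + l = 1 then 4 else if k + 1 = l ∨ l + 1 = k then 3 else 2

/-- Reversing the numbering puts the bond of order `4` between `0` and `1`, where the reflection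
with root `e_0` is. -/
theorem coxeterMatrix_B_rev {n : ℕ} (k l : Fin n) :
    CoxeterMatrix.B n k.rev l.rev = coxeterEntry k l := by
  have hk := k.2
  have hl := l.2
  simp only [CoxeterMatrix.B, Matrix.of_apply, coxeterEntry, Fin.ext_iff,
    Fin.val_rev]
  split_ifs <;> omega

theorem reflect_mul_pow (k l : ℕ) : (reflect k * reflect l) ^ coxeterEntry k l = 1 := by
  unfold coxeterEntry
  split_ifs with h1 h2 h3
  · subst h1; rw [pow_one, reflect_mul_self]
  · have h : k = 0 ∧ l = 1 ∨ k = 1 ∧ l = 0 := by omega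
    rcases h with ⟨rfl, rfl⟩ | ⟨rfl, rfl⟩ <;>
    · refine LinearMap.ext fun v => ?_
      simp only [pow_succ, pow_zero, one_mul, Module.End.mul_apply, Module.End.one_apply,
        reflect_apply, map_sub, map_smul, simpleCoroot_self, simpleCoroot_zero_simpleRoot_one,
        simpleCoroot_succ_simpleRoot 0]
      module
  · have h : (∃ j, k = j + 1 ∧ l = j + 2) ∨ ∃ j, k = j + 2 ∧ l = j + 1 := by
      rcases h3 with h3 | h3
      · exact Or.inl ⟨k - 1, by omega, by omega⟩
      · exact Or.inr ⟨l - 1, by omega, by omega⟩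
    rcases h with ⟨j, rfl, rfl⟩ | ⟨j, rfl, rfl⟩ <;>
    · refine LinearMap.ext fun v => ?_
      simp only [pow_succ, pow_zero, one_mul, Module.End.mul_apply, Module.End.one_apply,
        reflect_apply, map_sub, map_smul, simpleCoroot_self, simpleCoroot_simpleRoot_succ,
        simpleCoroot_succ_simpleRoot (j + 1)]
      module
  · have h4 := simpleCoroot_of_far (k := k) (l := l) (by omega)
    have h5 := simpleCoroot_of_far (k := l) (l := k) (by omega)
    refine LinearMap.ext fun v => ?_
    simp only [pow_succ, pow_zero, one_mul, Module.End.mul_apply, Module.End.one_apply,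
      reflect_apply, map_sub, map_smul, simpleCoroot_self, h4, h5]
    module

theorem reflect_zero_stdVec (i : ℕ) :
    reflect 0 (stdVec i) = if i = 0 then -stdVec i else stdVec i := by
  rw [reflect_apply, simpleCoroot_zero, stdVec_apply]
  by_cases h : i = 0
  · subst h; simp [simpleRoot, two_smul]
  · rw [if_neg h, if_neg (Ne.symm h)]; simp

theorem reflect_succ_stdVec (k i : ℕ) :
    reflect (k + 1) (stdVec i) = stdVec (Equiv.swap k (k + 1) i) := by
  rw [reflect_apply, simpleCoroot_succ, stdVec_apply, stdVec_apply]
  by_cases h : i = k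
  · subst h; simp [simpleRoot]
  by_cases h' : i = k + 1
  · subst h'; simp [simpleRoot]
  · rw [if_neg (Ne.symm h), if_neg (Ne.symm h'), Equiv.swap_apply_of_ne_of_ne h h']; simp

/-- The positive roots `e_j ± e_i`, `i < j < m`, of type `D_m`. -/
def rootsD (m : ℕ) : Set (ℕ → ℤ) :=
  {β | ∃ i j, i < j ∧ j < m ∧ (β = stdVec j - stdVec i ∨ β = stdVec j + stdVec i)}

/-- The positive roots of type `B_m`. -/
def rootsB (m : ℕ) : Set (ℕ → ℤ) := rootsD m ∪ {β | ∃ i < m, β = stdVec i}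

theorem rootsD_subset_rootsB (m : ℕ) : rootsD m ⊆ rootsB m := Set.subset_union_left

theorem rootsD_mono {m n : ℕ} (h : m ≤ n) : rootsD m ⊆ rootsD n := by
  rintro β ⟨i, j, h1, h2, h3⟩
  exact ⟨i, j, h1, by omega, h3⟩

theorem rootsB_mono {m n : ℕ} (h : m ≤ n) : rootsB m ⊆ rootsB n := by
  rintro β (hβ | ⟨i, hi, rfl⟩)
  · exact Or.inl (rootsD_mono h hβ)
  · exact Or.inr ⟨i, by omega, rfl⟩

theorem simpleRoot_mem_rootsB {k m : ℕ} (h : k < m) : simpleRoot k ∈ rootsB m := by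
  cases k with
  | zero => exact Or.inr ⟨0, h, rfl⟩
  | succ k => exact Or.inl ⟨k, k + 1, by omega, h, Or.inl rfl⟩

theorem reflect_zero_mem_rootsD {m : ℕ} {β : ℕ → ℤ} (hβ : β ∈ rootsD m) :
    reflect 0 β ∈ rootsD m := by
  obtain ⟨i, j, hij, hj, rfl | rfl⟩ := hβ
  · by_cases hi : i = 0
    · exact ⟨i, j, hij, hj, Or.inr (by
        rw [map_sub, reflect_zero_stdVec, reflect_zero_stdVec, if_pos hi, if_neg (by omega),
          sub_neg_eq_add])⟩
    · exact ⟨i, j, hij, hj, Or.inl (by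
        rw [map_sub, reflect_zero_stdVec, reflect_zero_stdVec, if_neg hi, if_neg (by omega)])⟩
  · by_cases hi : i = 0
    · exact ⟨i, j, hij, hj, Or.inl (by
        rw [map_add, reflect_zero_stdVec, reflect_zero_stdVec, if_pos hi, if_neg (by omega),
          sub_eq_add_neg])⟩
    · exact ⟨i, j, hij, hj, Or.inr (by
        rw [map_add, reflect_zero_stdVec, reflect_zero_stdVec, if_neg hi, if_neg (by omega)])⟩

theorem swap_lt {k i m : ℕ} (hk : k + 1 < m) (hi : i < m) : Equiv.swap k (k + 1) i < m := by
  rw [Equiv.swap_apply_def]; split_ifs <;> omega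

theorem reflect_succ_mem_rootsD {k m : ℕ} (hk : k + 1 < m) {β : ℕ → ℤ} (hβ : β ∈ rootsD m)
    (hne : β ≠ simpleRoot (k + 1)) : reflect (k + 1) β ∈ rootsD m := by
  obtain ⟨i, j, hij, hj, hβ⟩ := hβ
  have hi' := swap_lt hk (hij.trans hj)
  have hj' := swap_lt hk hj
  by_cases h : Equiv.swap k (k + 1) i < Equiv.swap k (k + 1) j
  · refine ⟨_, _, h, hj', ?_⟩
    rcases hβ with rfl | rfl
    · left; rw [map_sub, reflect_succ_stdVec, reflect_succ_stdVec]
    · right; rw [map_add, reflect_succ_stdVec, reflect_succ_stdVec]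
  -- An adjacent transposition reverses only the pair `(k, k + 1)`; there the difference is the
  -- excluded simple root and the sum is fixed.
  · have h1 : i = k ∧ j = k + 1 := by
      rw [Equiv.swap_apply_def, Equiv.swap_apply_def] at h
      split_ifs at h <;> omega
    obtain ⟨rfl, rfl⟩ := h1
    rcases hβ with rfl | rfl
    · exact absurd rfl hne
    · refine ⟨i, i + 1, hij, hj, Or.inr ?_⟩
      rw [map_add, reflect_succ_stdVec, reflect_succ_stdVec, Equiv.swap_apply_left,
        Equiv.swap_apply_right, add_comm]

theorem reflect_mem_rootsB {k m : ℕ} (hk : k < m) {β : ℕ → ℤ} (hβ : β ∈ rootsB m)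
    (hne : β ≠ simpleRoot k) : reflect k β ∈ rootsB m := by
  rcases hβ with hβ | ⟨i, hi, rfl⟩
  · cases k with
    | zero => exact Or.inl (reflect_zero_mem_rootsD hβ)
    | succ k => exact Or.inl (reflect_succ_mem_rootsD hk hβ hne)
  · refine Or.inr ?_
    cases k with
    | zero =>
      have h0 : i ≠ 0 := by rintro rfl; exact hne rfl
      exact ⟨i, hi, by rw [reflect_zero_stdVec, if_neg h0]⟩
    | succ k => exact ⟨_, swap_lt hk hi, reflect_succ_stdVec k i⟩

/-- The root of `t s₁ t`. -/
def forkRoot : ℕ → ℤ := stdVec 1 + stdVec 0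

theorem reflect_zero_simpleRoot_one : reflect 0 (simpleRoot 1) = forkRoot := by
  simp [simpleRoot, forkRoot, reflect_zero_stdVec]

theorem stdVec_sub_mem_closure {S : AddSubmonoid (ℕ → ℤ)} {m : ℕ}
    (hS : ∀ k, k + 1 < m → simpleRoot (k + 1) ∈ S) {i j : ℕ} (hij : i ≤ j) (hj : j < m) :
    stdVec j - stdVec i ∈ S := by
  induction j, hij using Nat.le_induction with
  | base => simp
  | succ j _ ih =>
    have := add_mem (hS j hj) (ih (by omega))
    simpa [simpleRoot] using this

theorem rootsB_subset_closure {S : AddSubmonoid (ℕ → ℤ)} {m : ℕ}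
    (hS : ∀ k < m, simpleRoot k ∈ S) {β : ℕ → ℤ} (hβ : β ∈ rootsB m) : β ∈ S := by
  have h1 : ∀ {i j}, i ≤ j → j < m → stdVec j - stdVec i ∈ S :=
    stdVec_sub_mem_closure fun k => hS (k + 1)
  have h2 : ∀ i < m, stdVec i ∈ S := fun i hi => by
    have := add_mem (h1 (Nat.zero_le i) hi) (hS 0 (by omega))
    simpa [simpleRoot] using this
  rcases hβ with ⟨i, j, hij, hj, rfl | rfl⟩ | ⟨i, hi, rfl⟩
  · exact h1 hij.le hj
  · exact add_mem (h2 j hj) (h2 i (by omega))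
  · exact h2 i hi

theorem rootsD_subset_closure {S : AddSubmonoid (ℕ → ℤ)} {m : ℕ}
    (hS : ∀ k, k + 1 < m → simpleRoot (k + 1) ∈ S) (hf : 1 < m → forkRoot ∈ S)
    {β : ℕ → ℤ} (hβ : β ∈ rootsD m) : β ∈ S := by
  have h1 : ∀ {i j}, i ≤ j → j < m → stdVec j - stdVec i ∈ S := stdVec_sub_mem_closure hS
  obtain ⟨i, j, hij, hj, rfl | rfl⟩ := hβ
  · exact h1 hij.le hj
  -- `e_j + e_i = (e_j - e_1) + (e_i - e_0) + (e_1 + e_0)`, where `j ≥ 1` because `i < j`.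
  · have h2 := add_mem (add_mem (h1 (show 1 ≤ j by omega) hj)
      (h1 (Nat.zero_le i) (by omega))) (hf (by omega))
    convert h2 using 1
    simp only [forkRoot]; abel

/-- The functional that is positive on positive roots. -/
def height (n : ℕ) : (ℕ → ℤ) →+ ℤ where
  toFun v := ∑ i ∈ Finset.range n, (i + 1 : ℤ) * v i
  map_zero' := by simp
  map_add' v w := by simp [mul_add, Finset.sum_add_distrib]

theorem height_stdVec {n i : ℕ} (hi : i < n) : height n (stdVec i) = i + 1 := by
  simp [height, stdVec_apply, hi]

theorem height_pos {n : ℕ} {β : ℕ → ℤ} (hβ : β ∈ rootsB n) : 0 < height n β := by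
  rcases hβ with ⟨i, j, hij, hj, rfl | rfl⟩ | ⟨i, hi, rfl⟩
  · rw [map_sub, height_stdVec hj, height_stdVec (hij.trans hj)]; omega
  · rw [map_add, height_stdVec hj, height_stdVec (hij.trans hj)]; omega
  · rw [height_stdVec hi]; omega

/-- The standard inner product. -/
def dot (n : ℕ) : (ℕ → ℤ) →ₗ[ℤ] (ℕ → ℤ) →ₗ[ℤ] ℤ :=
  LinearMap.mk₂ ℤ (fun v w => ∑ i ∈ Finset.range n, v i * w i)
    (by intros; simp [add_mul, Finset.sum_add_distrib])
    (by intros; simp [Finset.mul_sum, mul_assoc])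
    (by intros; simp [mul_add, Finset.sum_add_distrib])
    (by intros; simp [Finset.mul_sum, mul_left_comm])

theorem dot_apply (n : ℕ) (v w : ℕ → ℤ) : dot n v w = ∑ i ∈ Finset.range n, v i * w i := rfl

theorem dot_comm (n : ℕ) (v w : ℕ → ℤ) : dot n v w = dot n w v := by
  simp [dot_apply, mul_comm]

theorem dot_stdVec {n i : ℕ} (hi : i < n) (v : ℕ → ℤ) : dot n v (stdVec i) = v i := by
  simp [dot_apply, stdVec_apply, hi]

theorem dot_simpleRoot {n k : ℕ} (hk : k < n) (v : ℕ → ℤ) :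
    2 * dot n v (simpleRoot k) = simpleCoroot k v * dot n (simpleRoot k) (simpleRoot k) := by
  cases k with
  | zero => simp [simpleRoot, dot_stdVec hk, simpleCoroot_zero, stdVec_apply]
  | succ k =>
    have h1 : ∀ v, dot n v (simpleRoot (k + 1)) = v (k + 1) - v k := fun v => by
      rw [simpleRoot, map_sub, dot_stdVec hk, dot_stdVec (show k < n by omega)]
    rw [h1, h1, simpleCoroot_succ]
    simp [simpleRoot_succ_apply]; ring

theorem dot_reflect {n k : ℕ} (hk : k < n) (v w : ℕ → ℤ) :
    dot n (reflect k v) (reflect k w) = dot n v w := by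
  have h1 := dot_simpleRoot hk v
  have h2 := dot_simpleRoot hk w
  rw [reflect_apply, reflect_apply]
  simp only [map_sub, map_smul, LinearMap.sub_apply, LinearMap.smul_apply, smul_eq_mul]
  rw [dot_comm n (simpleRoot k) w]
  refine mul_left_cancel₀ (two_ne_zero (α := ℤ)) ?_
  linear_combination -simpleCoroot k w * h1 - simpleCoroot k v * h2

theorem dot_self_of_mem_rootsB {n : ℕ} {β : ℕ → ℤ} (hβ : β ∈ rootsB n) :
    dot n β β = 1 ∨ dot n β β = 2 := by
  rcases hβ with ⟨i, j, hij, hj, rfl | rfl⟩ | ⟨i, hi, rfl⟩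
  · right
    rw [map_sub, dot_stdVec hj, dot_stdVec (hij.trans hj)]
    simp [stdVec_apply, hij.ne, hij.ne']
  · right
    rw [map_add, dot_stdVec hj, dot_stdVec (hij.trans hj)]
    simp [stdVec_apply, hij.ne, hij.ne']
  · left
    rw [dot_stdVec hi]; simp [stdVec_apply]

end RootsB

/-! ### Faithfulness of the reflection representation; roots of reflections -/

section Faithful

variable {n : ℕ} {W : Type*} [Group W] (cs : CoxeterSystem (CoxeterMatrix.B n) W)

theorem isLiftable_reflect (n : ℕ) :
    (CoxeterMatrix.B n).IsLiftable fun i => reflect i.rev := fun i j => by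
  have h := reflect_mul_pow i.rev j.rev
  rwa [← coxeterMatrix_B_rev, Fin.rev_rev, Fin.rev_rev] at h

/-- The reflection representation of the Coxeter group of type `B_n`. -/
def rep : W →* Module.End ℤ (ℕ → ℤ) :=
  cs.lift ⟨fun i => reflect i.rev, isLiftable_reflect n⟩

/-- The simple reflections, indexed by natural numbers. -/
def sgen (k : ℕ) : W := if h : k < n then gen cs ⟨k, h⟩ else 1

theorem sgen_eq {k : ℕ} (h : k < n) : sgen cs k = cs.simple (Fin.rev ⟨k, h⟩) := by
  rw [sgen, dif_pos h, gen]

theorem gen_eq_sgen (i : Fin n) : gen cs i = sgen cs i := by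
  rw [sgen, dif_pos i.2]

theorem rep_sgen {k : ℕ} (h : k < n) : rep cs (sgen cs k) = reflect k := by
  rw [sgen_eq cs h, rep, CoxeterSystem.lift_apply_simple]
  simp

theorem sgen_mul_self (k : ℕ) : sgen cs k * sgen cs k = 1 := by
  by_cases h : k < n
  · rw [sgen_eq cs h, cs.simple_mul_simple_self]
  · rw [sgen, dif_neg h, one_mul]

theorem sgen_mul_pow {k l : ℕ} (hk : k < n) (hl : l < n) :
    (sgen cs k * sgen cs l) ^ coxeterEntry k l = 1 := by
  have h := cs.simple_mul_simple_pow (Fin.rev ⟨k, hk⟩) (Fin.rev ⟨l, hl⟩)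
  rwa [coxeterMatrix_B_rev, ← sgen_eq, ← sgen_eq] at h

theorem exists_eq_sgen (i : Fin n) : ∃ k, ∃ h : k < n, i = Fin.rev ⟨k, h⟩ :=
  ⟨i.rev, i.rev.2, (Fin.rev_rev i).symm⟩

theorem height_simpleRoot {k : ℕ} (h : k < n) : height n (simpleRoot k) = 1 := by
  cases k with
  | zero => rw [simpleRoot, height_stdVec h]; simp
  | succ k =>
    rw [simpleRoot, map_sub, height_stdVec h, height_stdVec (show k < n by omega)]
    push_cast; ring

theorem length_lt_or (w : W) {k : ℕ} (hk : k < n) :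
    cs.length w + 1 = cs.length (w * sgen cs k) ∨
      cs.length (w * sgen cs k) + 1 = cs.length w := by
  rw [sgen_eq cs hk]
  exact (cs.length_mul_simple w _).imp Eq.symm id

theorem length_sgen_le (k : ℕ) : cs.length (sgen cs k) ≤ 1 := by
  by_cases h : k < n
  · rw [sgen_eq cs h, cs.length_simple]
  · rw [sgen, dif_neg h, cs.length_one]; omega

/-- Ascents of `w` correspond to simple roots that `w` sends to positive roots. -/
theorem height_pos_of_length_lt {w : W} {k : ℕ} (hk : k < n)
    (hw : cs.length w < cs.length (w * sgen cs k)) :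
    0 < height n (rep cs w (simpleRoot k)) := by
  induction hN : cs.length w using Nat.strong_induction_on generalizing w k with
  | _ N ih =>
  subst hN
  have ih' : ∀ {v : W} {l : ℕ}, l < n → cs.length v < cs.length w →
      cs.length v + 1 = cs.length (v * sgen cs l) → 0 < height n (rep cs v (simpleRoot l)) :=
    fun hl hv hlt => ih _ hv hl (by omega) rfl
  have hcancel : ∀ (v : W) (l : ℕ), v * sgen cs l * sgen cs l = v := fun v l => by
    rw [mul_assoc, sgen_mul_self, mul_one]
  have hmul : ∀ (v u : W), cs.length (v * u) ≤ cs.length v + cs.length u := cs.length_mul_le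
  have happ : ∀ {v : W} {l : ℕ} (_ : l < n) (β : ℕ → ℤ),
      rep cs (v * sgen cs l) β = rep cs v (β - simpleCoroot l β • simpleRoot l) := by
    intro v l hl β
    rw [map_mul, Module.End.mul_apply, rep_sgen cs hl, reflect_apply]
  by_cases h1 : w = 1
  · subst h1
    rw [map_one, Module.End.one_apply, height_simpleRoot hk]; exact one_pos
  -- Starting from a descent `l`, letters `l` and `k` are stripped alternately from the right of `w`
  -- until the next one is an ascent. Then both are ascents of what remains, and `w (α_k)` is the
  -- image under it of a nonzero combination of `α_k` and `α_l` with nonnegative coefficients.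
  obtain ⟨i, hi⟩ := cs.exists_rightDescent_of_ne_one h1
  obtain ⟨l, hl, rfl⟩ := exists_eq_sgen i
  rw [CoxeterSystem.IsRightDescent, ← sgen_eq] at hi
  have hkl : k ≠ l := by rintro rfl; omega
  set w₁ := w * sgen cs l with hw₁
  have e₁ : w = w₁ * sgen cs l := (hcancel w l).symm
  have l₁ : cs.length w₁ + 1 = cs.length w := by
    have := length_lt_or cs w hl
    rw [← hw₁] at this
    omega
  have p₁ := ih' (v := w₁) hl (by omega) (by rw [← e₁, l₁])
  set p := simpleCoroot l (simpleRoot k) with hp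
  set q := simpleCoroot k (simpleRoot l) with hq
  have hp0 : p ≤ 0 := simpleCoroot_nonpos hkl.symm
  rcases length_lt_or cs w₁ hk with h | h
  · have p₂ := ih' hk (by omega) h
    rw [e₁, happ hl, map_sub, map_sub, map_smul, map_zsmul, smul_eq_mul, ← hp]
    nlinarith
  set w₂ := w₁ * sgen cs k with hw₂
  have e₂ : w₁ = w₂ * sgen cs k := (hcancel w₁ k).symm
  have p₂ := ih' (v := w₂) hk (by omega) (by rw [← e₂, h])
  have hpow := sgen_mul_pow cs hk hl
  have hk1 := length_sgen_le cs k
  have hl1 := length_sgen_le cs l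
  have hkk := sgen_mul_self cs k
  have hll := sgen_mul_self cs l
  have m₂ := hmul w₂ (sgen cs l)
  -- Stripping cannot exhaust the dihedral group: otherwise the braid relation would rewrite `w *
  -- sgen cs k` with fewer letters than the ascent `k` allows. This excludes a second stripping for
  -- order `2`, a third for order `3` and a fourth for order `4`.
  by_cases hfar : coxeterEntry k l = 2
  · exfalso
    rw [hfar, pow_two] at hpow
    have e : w * sgen cs k = w₂ * sgen cs l := by
      rw [e₁, e₂]
      calc w₂ * sgen cs k * sgen cs l * sgen cs k
          = w₂ * (sgen cs k * sgen cs l * (sgen cs k * sgen cs l)) * (sgen cs l)⁻¹ := by group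
        _ = w₂ * sgen cs l := by rw [hpow, mul_one, inv_eq_of_mul_eq_one_left hll]
    rw [e] at hw
    omega
  have hpq : coxeterEntry k l = 3 ∧ p = -1 ∧ q = -1 ∨ coxeterEntry k l = 4 ∧ p < 0 ∧ p * q = 2 := by
    unfold coxeterEntry at hfar ⊢
    rw [if_neg hkl] at hfar ⊢
    split_ifs at hfar ⊢ with h3 h4
    · right
      have : k = 0 ∧ l = 1 ∨ k = 1 ∧ l = 0 := by omega
      rcases this with ⟨rfl, rfl⟩ | ⟨rfl, rfl⟩
      · rw [hp, hq, simpleCoroot_succ_simpleRoot 0, simpleCoroot_zero_simpleRoot_one]; simp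
      · rw [hp, hq, simpleCoroot_succ_simpleRoot 0, simpleCoroot_zero_simpleRoot_one]; simp
    · left
      rcases h4 with h4 | h4
      · obtain ⟨j, rfl⟩ : ∃ j, k = j + 1 := ⟨k - 1, by omega⟩
        subst h4
        exact ⟨rfl, simpleCoroot_succ_simpleRoot _, simpleCoroot_simpleRoot_succ _⟩
      · obtain ⟨j, rfl⟩ : ∃ j, l = j + 1 := ⟨l - 1, by omega⟩
        subst h4
        exact ⟨rfl, simpleCoroot_simpleRoot_succ _, simpleCoroot_succ_simpleRoot _⟩
    · exact absurd rfl hfar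
  rcases length_lt_or cs w₂ hl with h' | h'
  · have p₃ := ih' hl (by omega) h'
    have e : rep cs w (simpleRoot k) =
        rep cs w₂ ((p * q - 1) • simpleRoot k + (-p) • simpleRoot l) := by
      rw [e₁, happ hl, e₂, happ hk]
      congr 1
      simp only [map_sub, map_smul, ← hp, ← hq, simpleCoroot_self, smul_eq_mul]
      module
    rw [e, map_add, map_smul, map_smul, map_add, map_zsmul, map_zsmul, smul_eq_mul, smul_eq_mul]
    rcases hpq with ⟨-, h5, h6⟩ | ⟨-, h5, h6⟩
    · rw [h5, h6]; simpa using p₃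
    · rw [h6]; nlinarith
  set w₃ := w₂ * sgen cs l with hw₃
  have e₃ : w₂ = w₃ * sgen cs l := (hcancel w₂ l).symm
  have ki := inv_eq_of_mul_eq_one_left hkk
  have li := inv_eq_of_mul_eq_one_left hll
  rcases hpq with ⟨h5, -, -⟩ | ⟨h5, -, h6⟩
  · exfalso
    rw [h5] at hpow
    have e : w * sgen cs k = w₃ * (sgen cs k * sgen cs l) := by
      rw [e₁, e₂, e₃]
      calc w₃ * sgen cs l * sgen cs k * sgen cs l * sgen cs k
          = w₃ * (sgen cs k)⁻¹ * (sgen cs k * sgen cs l) ^ 3 * (sgen cs l)⁻¹ := by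
            simp only [pow_succ, pow_zero, one_mul]; group
        _ = _ := by rw [hpow, mul_one, ki, li, mul_assoc]
    have m₃ := hmul w₃ (sgen cs k * sgen cs l)
    have m₄ := hmul (sgen cs k) (sgen cs l)
    rw [e] at hw
    omega
  rcases length_lt_or cs w₃ hk with h'' | h''
  · have p₃ := ih' hk (by omega) h''
    have e : rep cs w (simpleRoot k) =
        rep cs w₃ ((p * q - 1) • simpleRoot k + (p * (2 - p * q)) • simpleRoot l) := by
      rw [e₁, happ hl, e₂, happ hk, e₃, happ hl]
      congr 1
      simp only [map_sub, map_smul, ← hp, ← hq, simpleCoroot_self, smul_eq_mul]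
      module
    rw [e, h6]
    simpa using p₃
  · exfalso
    set w₄ := w₃ * sgen cs k with hw₄
    have e₄ : w₃ = w₄ * sgen cs k := (hcancel w₃ k).symm
    rw [h5] at hpow
    have e : w * sgen cs k = w₄ * (sgen cs l * sgen cs k * sgen cs l) := by
      rw [e₁, e₂, e₃, e₄]
      calc w₄ * sgen cs k * sgen cs l * sgen cs k * sgen cs l * sgen cs k
          = w₄ * (sgen cs k * sgen cs l) ^ 4 * (sgen cs l)⁻¹ * (sgen cs k)⁻¹ * (sgen cs l)⁻¹ := by
            simp only [pow_succ, pow_zero, one_mul]; group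
        _ = _ := by rw [hpow, mul_one, ki, li]; simp only [mul_assoc]
    have m₃ := hmul w₄ (sgen cs l * sgen cs k * sgen cs l)
    have m₄ := hmul (sgen cs l * sgen cs k) (sgen cs l)
    have m₅ := hmul (sgen cs l) (sgen cs k)
    rw [e] at hw
    omega

/-- If `w ≠ 1` acted trivially and `k` were a descent of it, then `w * sgen cs k` would have `k` as
an ascent and yet send `α_k` to `-α_k`. -/
theorem rep_injective : Function.Injective (rep cs) := by
  rw [injective_iff_map_eq_one]
  intro w hw
  by_contra h1
  obtain ⟨i, hi⟩ := cs.exists_rightDescent_of_ne_one h1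
  obtain ⟨k, hk, rfl⟩ := exists_eq_sgen i
  rw [CoxeterSystem.IsRightDescent, ← sgen_eq] at hi
  have h2 := height_pos_of_length_lt cs (w := w * sgen cs k) hk
    (by rwa [mul_assoc, sgen_mul_self, mul_one])
  rw [map_mul, hw, one_mul, rep_sgen cs hk, reflect_apply, simpleCoroot_self, map_sub, map_zsmul,
    height_simpleRoot hk] at h2
  norm_num at h2

theorem dot_rep (w : W) (u v : ℕ → ℤ) : dot n (rep cs w u) (rep cs w v) = dot n u v := by
  induction w using cs.simple_induction_left with
  | one => simp
  | mul_simple_left w i ih =>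
    obtain ⟨k, hk, rfl⟩ := exists_eq_sgen i
    rw [← sgen_eq, map_mul, Module.End.mul_apply, Module.End.mul_apply, rep_sgen cs hk,
      dot_reflect hk, ih]

/-- `g` acts as the reflection with root `β`. -/
def IsReflectionIn (g : W) (β : ℕ → ℤ) : Prop :=
  ∀ v, dot n β β • rep cs g v = dot n β β • v - (2 * dot n v β) • β

theorem isReflectionIn_sgen {k : ℕ} (hk : k < n) :
    IsReflectionIn cs (sgen cs k) (simpleRoot k) := by
  intro v
  rw [rep_sgen cs hk, dot_simpleRoot hk, reflect_apply, smul_sub, smul_smul, mul_comm]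

variable {cs}

theorem IsReflectionIn.conj {g : W} {β : ℕ → ℤ} (hg : IsReflectionIn cs g β) (w : W) :
    IsReflectionIn cs (w * g * w⁻¹) (rep cs w β) := by
  intro v
  rw [dot_rep, map_mul, map_mul, Module.End.mul_apply, Module.End.mul_apply, ← map_smul, hg,
    map_sub, map_smul, map_smul, map_self_apply_inv]
  congr 3
  nth_rewrite 2 [← map_self_apply_inv (ρ := rep cs) w v]
  rw [dot_rep]

/-- The action of a reflection is determined by its root, and faithfulness carries this over to the
abstract group. -/
theorem IsReflectionIn.eq {g g' : W} {β : ℕ → ℤ} (hβ : dot n β β ≠ 0)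
    (hg : IsReflectionIn cs g β) (hg' : IsReflectionIn cs g' β) : g = g' := by
  refine rep_injective cs (LinearMap.ext fun v => ?_)
  exact smul_right_injective _ hβ ((hg v).trans (hg' v).symm)

theorem IsReflectionIn.root_unique {g : W} {β β' : ℕ → ℤ} (hβ : β ∈ rootsB n)
    (hβ' : β' ∈ rootsB n) (hg : IsReflectionIn cs g β) (hg' : IsReflectionIn cs g β') :
    β = β' := by
  have d := dot_self_of_mem_rootsB hβ
  have d' := dot_self_of_mem_rootsB hβ'
  have hne : dot n β β ≠ 0 := by omega
  have hne' : dot n β' β' ≠ 0 := by omega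
  have h1 : rep cs g β' = -β' := by
    refine smul_right_injective _ hne' ?_
    simp only [hg' β']
    module
  have h2 := hg β'
  rw [h1] at h2
  have h3 : dot n β β • β' = dot n β' β • β := by
    refine smul_right_injective _ (two_ne_zero (α := ℤ)) ?_
    simp only
    have h4 : (2 * dot n β' β) • β = dot n β β • β' - dot n β β • -β' := by rw [h2]; abel
    rw [smul_smul, smul_smul, h4]
    module
  have h4 := congrArg (dot n β') h3
  have h5 := congrArg (height n) h3
  rw [map_smul, map_smul, smul_eq_mul, smul_eq_mul] at h4
  rw [map_zsmul, map_zsmul, smul_eq_mul, smul_eq_mul] at h5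
  have p := height_pos hβ
  have p' := height_pos hβ'
  have hc : 0 < dot n β' β := by
    by_contra hn
    rcases d with d | d <;> rw [d] at h5 <;> nlinarith
  have h6 : dot n β' β = dot n β β := by
    set c := dot n β' β
    rcases d with d | d <;> rcases d' with d' | d' <;> rw [d, d'] at h4 <;> rw [d]
    · nlinarith
    · exfalso
      have : c < 2 := by nlinarith
      have : c = 1 := by omega
      rw [this] at h4; omega
    · exfalso
      have : c < 2 := by nlinarith
      have : c = 1 := by omega
      rw [this] at h4; omega
    · nlinarith
  rw [h6] at h3
  exact (smul_right_injective _ hne h3).symm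

variable (cs)

open Classical in
/-- The positive root of a reflection. -/
def root (g : W) : ℕ → ℤ :=
  if h : ∃ β ∈ rootsB n, IsReflectionIn cs g β then h.choose else 0

variable {cs}

theorem IsReflectionIn.root_eq {g : W} {β : ℕ → ℤ} (hβ : β ∈ rootsB n)
    (hg : IsReflectionIn cs g β) : root cs g = β := by
  have h : ∃ β ∈ rootsB n, IsReflectionIn cs g β := ⟨β, hβ, hg⟩
  rw [root, dif_pos h]
  exact IsReflectionIn.root_unique h.choose_spec.1 hβ h.choose_spec.2 hg

end Faithful

/-! ### The positive systems of types `B_m` and `D_m` -/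

section Systems

/-- Sum the fundamental coweights belonging to `K \ I`. They need only be positive, not `1`, on
their own root, because integral coweights of type `D` can take the value `2` there. -/
theorem exists_coweight_of_dual {G V : Type*} [AddCommGroup V] {α : G → V} {K : Set G}
    (hK : K.Finite) (hω : ∀ s ∈ K, ∃ ω : V →+ ℤ, (∀ s' ∈ K, s' ≠ s → ω (α s') = 0) ∧ 0 < ω (α s))
    (I : Set G) (hI : I ⊆ K) :
    ∃ u : V →+ ℤ, (∀ s ∈ I, u (α s) = 0) ∧ ∀ s ∈ K \ I, 0 < u (α s) := by
  choose! ω h0 hp using hω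
  have hfin : (K \ I).Finite := hK.subset Set.sdiff_subset
  refine ⟨∑ s ∈ hfin.toFinset, ω s, fun s hs => ?_, fun s hs => ?_⟩
  · rw [AddMonoidHom.finsetSum_apply]
    refine Finset.sum_eq_zero fun s' hs' => ?_
    rw [Set.Finite.mem_toFinset] at hs'
    exact h0 s' hs'.1 s (hI hs) fun h => hs'.2 (h ▸ hs)
  · rw [AddMonoidHom.finsetSum_apply, Finset.sum_eq_single s]
    · exact hp s hs.1
    · intro s' hs' hne
      rw [Set.Finite.mem_toFinset] at hs'
      exact h0 s' hs'.1 s hs.1 hne.symm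
    · intro h
      exact absurd ((Set.Finite.mem_toFinset _).2 hs) h

/-- The sum of the coordinates with index in `[a, m)`. -/
def tailSum (a m : ℕ) : (ℕ → ℤ) →+ ℤ where
  toFun v := ∑ i ∈ Finset.Ico a m, v i
  map_zero' := by simp
  map_add' v w := by simp [Finset.sum_add_distrib]

theorem tailSum_stdVec (a m i : ℕ) :
    tailSum a m (stdVec i) = if a ≤ i ∧ i < m then 1 else 0 := by
  simp [tailSum, stdVec_apply]

theorem tailSum_simpleRoot {a m l : ℕ} (hl : l < m) :
    tailSum a m (simpleRoot l) = if l = a then 1 else 0 := by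
  cases l with
  | zero => rw [simpleRoot, tailSum_stdVec]; split_ifs <;> omega
  | succ l => rw [simpleRoot, map_sub, tailSum_stdVec, tailSum_stdVec]; split_ifs <;> omega

variable {n : ℕ} {W : Type*} [Group W] (cs : CoxeterSystem (CoxeterMatrix.B n) W)

/-- The reflection `t s₁ t`. -/
def fork : W := sgen cs 0 * sgen cs 1 * sgen cs 0

theorem mem_SB {m : ℕ} (hm : m ≤ n) {s : W} : s ∈ SB cs m ↔ ∃ k < m, s = sgen cs k := by
  constructor
  · rintro ⟨i, hi, rfl⟩
    exact ⟨i, hi, gen_eq_sgen cs i⟩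
  · rintro ⟨k, hk, rfl⟩
    exact ⟨⟨k, by omega⟩, hk, (gen_eq_sgen cs ⟨k, by omega⟩).symm⟩

theorem gen_zero [NeZero n] : gen cs 0 = sgen cs 0 := by
  rw [gen_eq_sgen]; simp

theorem mem_SD [NeZero n] {m : ℕ} (hm : m ≤ n) {s : W} :
    s ∈ SD cs m ↔ (∃ k, k + 1 < m ∧ s = sgen cs (k + 1)) ∨ (1 < m ∧ s = fork cs) := by
  refine or_congr ?_ ?_
  · constructor
    · rintro ⟨i, h1, hi, rfl⟩
      exact ⟨i - 1, by omega, by rw [gen_eq_sgen, Nat.sub_add_cancel h1]⟩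
    · rintro ⟨k, hk, rfl⟩
      exact ⟨⟨k + 1, by omega⟩, by simp, hk, (gen_eq_sgen cs ⟨k + 1, by omega⟩).symm⟩
  · constructor
    · rintro ⟨i, h1, hi, rfl⟩
      exact ⟨by omega, by rw [gen_zero, gen_eq_sgen, h1, fork]⟩
    · rintro ⟨h1, rfl⟩
      exact ⟨⟨1, by omega⟩, rfl, h1, by rw [gen_zero, gen_eq_sgen, fork]⟩

theorem sgen_inv (k : ℕ) : (sgen cs k)⁻¹ = sgen cs k :=
  inv_eq_of_mul_eq_one_left (sgen_mul_self cs k)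

theorem forkRoot_mem {m : ℕ} (hm : 1 < m) : forkRoot ∈ rootsD m :=
  ⟨0, 1, one_pos, hm, Or.inr rfl⟩

theorem isReflectionIn_fork (hn : 1 < n) : IsReflectionIn cs (fork cs) forkRoot := by
  have h := (isReflectionIn_sgen cs hn).conj (sgen cs 0)
  rwa [rep_sgen cs (by omega), reflect_zero_simpleRoot_one, sgen_inv] at h

theorem root_sgen {k : ℕ} (hk : k < n) : root cs (sgen cs k) = simpleRoot k :=
  (isReflectionIn_sgen cs hk).root_eq (simpleRoot_mem_rootsB hk)

theorem root_fork (hn : 1 < n) : root cs (fork cs) = forkRoot :=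
  (isReflectionIn_fork cs hn).root_eq (rootsD_subset_rootsB n (forkRoot_mem hn))

theorem rep_fork (hn : 1 < n) (v : ℕ → ℤ) :
    rep cs (fork cs) v = reflect 0 (reflect 1 (reflect 0 v)) := by
  rw [fork, map_mul_apply, map_mul_apply, rep_sgen cs hn, rep_sgen cs (by omega)]

theorem reflect_reflect (k : ℕ) (v : ℕ → ℤ) : reflect k (reflect k v) = v := by
  rw [← Module.End.mul_apply, reflect_mul_self, Module.End.one_apply]

theorem fork_mul_self : fork cs * fork cs = 1 := by
  have h0 := sgen_mul_self cs 0
  have h1 := sgen_mul_self cs 1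
  calc fork cs * fork cs
      = sgen cs 0 * sgen cs 1 * (sgen cs 0 * sgen cs 0) * sgen cs 1 * sgen cs 0 := by
        simp only [fork, mul_assoc]
    _ = sgen cs 0 * (sgen cs 1 * sgen cs 1) * sgen cs 0 := by rw [h0]; simp only [mul_assoc, one_mul]
    _ = 1 := by rw [h1, mul_one, h0]

/-- The dominant regular vector. -/
def regularVec : ℕ → ℤ := fun i => i + 1

theorem simpleCoroot_regularVec (k : ℕ) : 0 < simpleCoroot k regularVec := by
  cases k with
  | zero => rw [simpleCoroot_zero]; simp [regularVec]
  | succ k => rw [simpleCoroot_succ]; simp [regularVec]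

theorem simpleRoot_injective : Function.Injective simpleRoot := by
  intro k l hkl
  have h1 := congrFun hkl k
  have h2 := congrFun hkl l
  cases k <;> cases l <;> simp only [simpleRoot_zero_apply, simpleRoot_succ_apply] at h1 h2 <;>
    grind

theorem conj_eq_of_root {s s' : W} {β β' : ℕ → ℤ} (hs : IsReflectionIn cs s β)
    (hs' : IsReflectionIn cs s' β') (hβ' : β' ∈ rootsB n) {g : W} (h : rep cs g β = β') :
    g * s * g⁻¹ = s' := by
  subst h
  have := dot_self_of_mem_rootsB hβ'
  exact (hs.conj g).eq (by omega) hs'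

/-- The positive system of type `B_m`. -/
theorem positiveSystemB {m : ℕ} (hm : m ≤ n) :
    PositiveSystem (rep cs) (height n) regularVec (root cs) (rootsB m) (SB cs m) where
  mul_self s hs := by
    obtain ⟨k, hk, rfl⟩ := (mem_SB cs hm).1 hs
    exact sgen_mul_self cs k
  root_mem s hs := by
    obtain ⟨k, hk, rfl⟩ := (mem_SB cs hm).1 hs
    rw [root_sgen cs (by omega)]; exact simpleRoot_mem_rootsB hk
  pos β hβ := height_pos (rootsB_mono hm hβ)
  smul_mem s hs β hβ hne := by
    obtain ⟨k, hk, rfl⟩ := (mem_SB cs hm).1 hs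
    rw [root_sgen cs (by omega)] at hne
    rw [rep_sgen cs (by omega)]
    exact reflect_mem_rootsB hk hβ hne
  smul_root s hs := by
    obtain ⟨k, hk, rfl⟩ := (mem_SB cs hm).1 hs
    rw [root_sgen cs (by omega), rep_sgen cs (by omega), reflect_apply, simpleCoroot_self]
    module
  conj_eq s hs s' hs' g h := by
    obtain ⟨k, hk, rfl⟩ := (mem_SB cs hm).1 hs
    obtain ⟨l, hl, rfl⟩ := (mem_SB cs hm).1 hs'
    rw [root_sgen cs (by omega), root_sgen cs (by omega)] at h
    exact conj_eq_of_root cs (isReflectionIn_sgen cs (by omega)) (isReflectionIn_sgen cs (by omega))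
      (simpleRoot_mem_rootsB (by omega)) h
  mem_closure β hβ := rootsB_subset_closure
    (S := AddSubmonoid.closure (root cs '' SB cs m)) (fun k hk => AddSubmonoid.subset_closure
      ⟨sgen cs k, (mem_SB cs hm).2 ⟨k, hk, rfl⟩, root_sgen cs (by omega)⟩) hβ
  reflection s hs := by
    obtain ⟨k, hk, rfl⟩ := (mem_SB cs hm).1 hs
    refine ⟨(simpleCoroot k).toAddMonoidHom, simpleCoroot_regularVec k, fun v => ?_⟩
    rw [rep_sgen cs (by omega), root_sgen cs (by omega), reflect_apply]
    rfl
  coweight := by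
    have hfin : (SB cs m).Finite := ((Set.finite_Iio m).image (sgen cs)).subset fun s hs => by
      obtain ⟨k, hk, rfl⟩ := (mem_SB cs hm).1 hs
      exact ⟨k, hk, rfl⟩
    refine exists_coweight_of_dual hfin fun s hs => ?_
    obtain ⟨k, hk, rfl⟩ := (mem_SB cs hm).1 hs
    refine ⟨tailSum k m, fun s' hs' hne => ?_, ?_⟩
    · obtain ⟨l, hl, rfl⟩ := (mem_SB cs hm).1 hs'
      rw [root_sgen cs (by omega), tailSum_simpleRoot hl, if_neg]
      rintro rfl; exact hne rfl
    · rw [root_sgen cs (by omega), tailSum_simpleRoot hk, if_pos rfl]; exact one_pos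

theorem exists_reflection_of_mem_SD [NeZero n] {m : ℕ} (hm : m ≤ n) {s : W} (hs : s ∈ SD cs m) :
    root cs s ∈ rootsD m ∧ IsReflectionIn cs s (root cs s) := by
  rcases (mem_SD cs hm).1 hs with ⟨k, hk, rfl⟩ | ⟨h1, rfl⟩
  · rw [root_sgen cs (by omega)]
    exact ⟨⟨k, k + 1, by omega, hk, Or.inl rfl⟩, isReflectionIn_sgen cs (by omega)⟩
  · rw [root_fork cs (by omega)]
    exact ⟨forkRoot_mem h1, isReflectionIn_fork cs (by omega)⟩

/-- The positive system of type `D_m`. -/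
theorem positiveSystemD [NeZero n] {m : ℕ} (hm : m ≤ n) :
    PositiveSystem (rep cs) (height n) regularVec (root cs) (rootsD m) (SD cs m) where
  mul_self s hs := by
    rcases (mem_SD cs hm).1 hs with ⟨k, hk, rfl⟩ | ⟨h1, rfl⟩
    · exact sgen_mul_self cs _
    · exact fork_mul_self cs
  root_mem s hs := (exists_reflection_of_mem_SD cs hm hs).1
  pos β hβ := height_pos (rootsD_subset_rootsB n (rootsD_mono hm hβ))
  smul_mem s hs β hβ hne := by
    rcases (mem_SD cs hm).1 hs with ⟨k, hk, rfl⟩ | ⟨h1, rfl⟩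
    · rw [root_sgen cs (by omega)] at hne
      rw [rep_sgen cs (by omega)]
      exact reflect_succ_mem_rootsD hk hβ hne
    · rw [root_fork cs (by omega)] at hne
      rw [rep_fork cs (by omega)]
      refine reflect_zero_mem_rootsD (reflect_succ_mem_rootsD h1 (reflect_zero_mem_rootsD hβ) ?_)
      intro h
      have h2 := congrArg (reflect 0) h
      rw [reflect_reflect, reflect_zero_simpleRoot_one] at h2
      exact hne h2
  smul_root s hs := by
    rcases (mem_SD cs hm).1 hs with ⟨k, hk, rfl⟩ | ⟨h1, rfl⟩
    · rw [root_sgen cs (by omega), rep_sgen cs (by omega), reflect_apply, simpleCoroot_self]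
      module
    · rw [root_fork cs (by omega), rep_fork cs (by omega), ← reflect_zero_simpleRoot_one,
        reflect_reflect, reflect_apply 1, simpleCoroot_self, ← map_neg]
      congr 1
      module
  conj_eq s hs s' hs' g h := by
    have h1 := exists_reflection_of_mem_SD cs hm hs
    have h2 := exists_reflection_of_mem_SD cs hm hs'
    exact conj_eq_of_root cs h1.2 h2.2 (rootsD_subset_rootsB n (rootsD_mono hm h2.1)) h
  mem_closure β hβ := rootsD_subset_closure
    (S := AddSubmonoid.closure (root cs '' SD cs m)) (fun k hk => AddSubmonoid.subset_closure
      ⟨sgen cs (k + 1), (mem_SD cs hm).2 (Or.inl ⟨k, hk, rfl⟩), root_sgen cs (by omega)⟩)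
    (fun h1 => AddSubmonoid.subset_closure
      ⟨fork cs, (mem_SD cs hm).2 (Or.inr ⟨h1, rfl⟩), root_fork cs (by omega)⟩) hβ
  reflection s hs := by
    rcases (mem_SD cs hm).1 hs with ⟨k, hk, rfl⟩ | ⟨h1, rfl⟩
    · refine ⟨(simpleCoroot (k + 1)).toAddMonoidHom, simpleCoroot_regularVec (k + 1), fun v => ?_⟩
      rw [rep_sgen cs (by omega), root_sgen cs (by omega), reflect_apply]
      rfl
    · refine ⟨(simpleCoroot 1 ∘ₗ reflect 0).toAddMonoidHom, ?_, fun v => ?_⟩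
      · simp [simpleCoroot_succ, reflect_apply, simpleCoroot_zero, simpleRoot_zero_apply,
          regularVec]
      · rw [root_fork cs (by omega), rep_fork cs (by omega), reflect_apply 1, map_sub,
          reflect_reflect, map_smul, reflect_zero_simpleRoot_one]
        rfl
  coweight := by
    have hfin : (SD cs m).Finite :=
      (((Set.finite_Iio m).image (sgen cs)).union (Set.finite_singleton (fork cs))).subset
        fun s hs => by
          rcases (mem_SD cs hm).1 hs with ⟨k, hk, rfl⟩ | ⟨h1, rfl⟩
          · exact Or.inl ⟨k + 1, hk, rfl⟩
          · exact Or.inr rfl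
    have key : ∀ (s : W) (hs : s ∈ SD cs m) (ω : (ℕ → ℤ) →+ ℤ), 0 < ω (root cs s) →
        (∀ k, k + 1 < m → s ≠ sgen cs (k + 1) → ω (simpleRoot (k + 1)) = 0) →
        (1 < m → s ≠ fork cs → ω forkRoot = 0) →
        ∃ ω : (ℕ → ℤ) →+ ℤ, (∀ s' ∈ SD cs m, s' ≠ s → ω (root cs s') = 0) ∧
          0 < ω (root cs s) := by
      intro s hs ω hpos h1 h2
      refine ⟨ω, fun s' hs' hne => ?_, hpos⟩
      rcases (mem_SD cs hm).1 hs' with ⟨k, hk, rfl⟩ | ⟨h1m, rfl⟩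
      · rw [root_sgen cs (by omega)]; exact h1 k hk hne.symm
      · rw [root_fork cs (by omega)]; exact h2 h1m hne.symm
    refine exists_coweight_of_dual hfin fun s hs => ?_
    rcases (mem_SD cs hm).1 hs with ⟨k, hk, rfl⟩ | ⟨h1, rfl⟩
    · rcases Nat.eq_zero_or_pos k with rfl | hk0
      -- This is the coweight dual to `s_1`: flipping the sign of coordinate `0` makes it vanish on
      -- `e_1 + e_0` and equal `2` on `e_1 - e_0`. Without the flip it is dual to `t s_1 t`.
      · refine key _ hs (tailSum 1 m - Pi.evalAddMonoidHom (fun _ : ℕ => ℤ) 0) ?_ ?_ ?_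
        · rw [root_sgen cs (by omega), AddMonoidHom.sub_apply, tailSum_simpleRoot hk]
          simp [simpleRoot_succ_apply]
        · intro l hl hne
          have : l ≠ 0 := by rintro rfl; exact hne rfl
          rw [AddMonoidHom.sub_apply, tailSum_simpleRoot hl]
          simp [simpleRoot_succ_apply, this, this.symm]
        · intro h1 _
          rw [AddMonoidHom.sub_apply, forkRoot, map_add, tailSum_stdVec, tailSum_stdVec]
          simp [stdVec_apply, h1]
      · refine key _ hs (tailSum (k + 1) m) ?_ ?_ ?_
        · rw [root_sgen cs (by omega), tailSum_simpleRoot hk]; simp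
        · intro l hl hne
          rw [tailSum_simpleRoot hl, if_neg]
          intro h; exact hne (by rw [h])
        · intro h1 _
          rw [forkRoot, map_add, tailSum_stdVec, tailSum_stdVec, if_neg (by omega),
            if_neg (by omega), add_zero]
    · refine key _ hs (tailSum 0 m) ?_ ?_ ?_
      · rw [root_fork cs (by omega), forkRoot, map_add, tailSum_stdVec, tailSum_stdVec,
          if_pos (by omega), if_pos (by omega)]
        norm_num
      · intro l hl _
        rw [tailSum_simpleRoot hl, if_neg (by omega)]
      · intro _ hne
        exact absurd rfl hne

end Systems

/-! ### Restriction morphisms as projections -/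

section Restriction

variable {G V : Type*} [Group G] [AddCommGroup V] {ρ : G →* Module.End ℤ V}
    {h : V →+ ℤ} {δ : V} {α : G → V} {Φ Ψ : Set V} {K L : Set G}

theorem descentSpace_induction {p : descentSpace K → Prop}
    (basis : ∀ (I : Set G) (hI : I ⊆ K), p (basisElt K I hI)) (zero : p 0)
    (add : ∀ a b, p a → p b → p (a + b)) (smul : ∀ (c : ℚ) a, p a → p (c • a))
    (a : descentSpace K) : p a := by
  obtain ⟨a, ha⟩ := a
  induction ha using Submodule.span_induction with
  | mem a ha => obtain ⟨I, hI, rfl⟩ := ha; exact basis I hI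
  | zero => exact zero
  | add a b ha hb iha ihb => exact add ⟨a, ha⟩ ⟨b, hb⟩ iha ihb
  | smul c a ha iha => exact smul c ⟨a, ha⟩ iha

theorem descentSpace_hom_ext {M : Type*} [AddCommGroup M] [Module ℚ M]
    {R R' : descentSpace K →ₗ[ℚ] M}
    (hR : ∀ (I : Set G) (hI : I ⊆ K), R (basisElt K I hI) = R' (basisElt K I hI)) : R = R' := by
  refine LinearMap.ext fun a => ?_
  induction a using descentSpace_induction with
  | basis I hI => exact hR I hI
  | zero => rw [map_zero, map_zero]
  | add a b ha hb => rw [map_add, map_add, ha, hb]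
  | smul c a ha => rw [map_smul, map_smul, ha]

/-- The restriction of the linear extension of `proj` to the descent algebras. -/
def restrictProj (ρ : G →* Module.End ℤ V) (h : V →+ ℤ) (α : G → V)
    (H : ∀ I ⊆ L, projLin ρ h α K (x L I) ∈ descentSpace K) :
    descentSpace L →ₗ[ℚ] descentSpace K :=
  (projLin ρ h α K).restrict fun a ha => by
    induction ha using Submodule.span_induction with
    | mem a ha => obtain ⟨I, hI, rfl⟩ := ha; exact H I hI
    | zero => rw [map_zero]; exact zero_mem _
    | add a b _ _ ha hb => rw [map_add]; exact add_mem ha hb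
    | smul c a _ ha => rw [map_smul]; exact Submodule.smul_mem _ _ ha

theorem projLin_projLin (H : ∀ w, proj ρ h α K (proj ρ h α L w) = proj ρ h α K w)
    (a : MonoidAlgebra ℚ G) : projLin ρ h α K (projLin ρ h α L a) = projLin ρ h α K a := by
  rw [projLin, projLin, ← LinearMap.comp_apply, ← MonoidAlgebra.mapDomainLinearMap_comp]
  congr 2
  exact funext H

namespace PositiveSystem

variable [Finite G]

theorem projLin_x_mem (hK : PositiveSystem ρ h δ α Φ K) (hL : PositiveSystem ρ h δ α Ψ L)
    (hΦ : Φ ⊆ Ψ) (hKL : K ⊆ Subgroup.closure L) {I : Set G} (hI : I ⊆ L) :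
    projLin ρ h α K (x L I) ∈ descentSpace K := by
  classical
  rw [hK.projLin_x hL hΦ hKL hI]
  exact sum_mem fun d _ => x_mem K Set.inter_subset_left

omit [Finite G] in
theorem ne_one (hK : PositiveSystem ρ h δ α Φ K) {s : G} (hs : s ∈ K) : s ≠ 1 := by
  rintro rfl
  have h1 := hK.smul_root 1 hs
  rw [map_one, Module.End.one_apply] at h1
  have h2 := hK.pos _ (hK.root_mem 1 hs)
  have h3 := congrArg h h1
  rw [map_neg] at h3
  omega

omit [Finite G] in
/-- Kilmoyer's theorem on intersections of parabolic subgroups, for simple reflections. -/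
theorem inter_conj_closure (hL : PositiveSystem ρ h δ α Ψ L) (hKL : K ⊆ L) {I : Set G}
    (hI : I ⊆ L) {d : G} (hd : d ∈ minReps L I) :
    K ∩ MulAut.conj d '' (Subgroup.closure I : Set G) = K ∩ MulAut.conj d '' I := by
  refine subset_antisymm ?_ (Set.inter_subset_inter_right _
    (Set.image_mono Subgroup.subset_closure))
  rintro s ⟨hs, r, hr, hrs⟩
  refine ⟨hs, ?_⟩
  rw [hL.mem_minReps_iff hI] at hd
  have hsL := hKL hs
  have hr' : r ∈ Subgroup.closure I := hr
  have hrs' : d * r * d⁻¹ = s := hrs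
  have hr1 : r ≠ 1 := by
    rintro rfl
    exact hL.ne_one hsL (by rw [← hrs']; group)
  -- If `r` makes `α i` negative, minimality of `d` makes `s (d (α i))` negative too, since `s * d =
  -- d * r`. As `d (α i)` is positive it must be `α s`, and so `s` is the conjugate of `i`.
  obtain ⟨i, hi, hneg⟩ := hL.exists_descent hI hr' hr1
  obtain ⟨f, hf, hfI⟩ := hL.exists_coweight hI
  have hrL : r ∈ Subgroup.closure L := Subgroup.closure_mono hI hr'
  have h0 : f (ρ r (α i)) = 0 := by
    rw [← hfI] at hr' hi
    exact (DFunLike.congr_fun (hL.pullback_eq_of_mem_closure hr') (α i)).trans hi.2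
  have h1 := hL.neg_mem_of_neg hrL (hL.root_mem i (hI hi)) hneg
  have h2 := hL.pos_of_dominant hf hd.1 (fun s hs h0 => hd.2 s (hfI ▸ ⟨hs, h0⟩)) h1
    (by rw [map_neg, h0, neg_zero])
  have h3 := hL.mem_of_pos hd.1 (hL.root_mem i (hI hi)) (hd.2 i hi)
  have h4 : h (ρ s (ρ d (α i))) < 0 := by
    rw [map_neg, map_neg, ← map_mul_apply] at h2
    rw [← map_mul_apply, ← hrs', inv_mul_cancel_right]
    omega
  exact ⟨i, hi, hL.conj_eq i (hI hi) s hsL d (hL.eq_root_of_neg hsL h3 h4)⟩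

theorem sum_parabolic (hK : PositiveSystem ρ h δ α Φ K) (hL : PositiveSystem ρ h δ α Ψ L)
    (hΦ : Φ ⊆ Ψ) (hKL : K ⊆ L) {I : Set G} (hI : I ⊆ L) :
    ((∑ᶠ d ∈ (minReps L K)⁻¹ ∩ minReps L I,
      basisElt K (K ∩ MulAut.conj d '' I) Set.inter_subset_left : descentSpace K) :
        MonoidAlgebra ℚ G) = projLin ρ h α K (x L I) := by
  classical
  rw [hK.projLin_x hL hΦ (hKL.trans Subgroup.subset_closure) hI,
    finsum_mem_eq_finite_toFinset_sum _ (Set.toFinite _), Submodule.coe_sum]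
  refine Finset.sum_congr ?_ fun d hd => ?_
  · ext d
    rw [Set.Finite.mem_toFinset, Set.mem_inter_iff, Set.mem_inv, Finset.mem_filter,
      mem_minRepsFinset, hL.mem_minReps_iff hKL, and_comm]
    exact and_congr_right fun hd => and_iff_right (inv_mem hd.1)
  · have h1 := (Finset.mem_filter.1 hd).1
    rw [mem_minRepsFinset] at h1
    rw [hL.inter_conj_closure hKL hI h1]
    rfl

/-- The prescribed formula is realized by a linear map of the whole group algebra, so existence
needs no linear independence, and uniqueness needs only that the `x_I^L` span. -/
theorem isParabolicRestriction_iff (hK : PositiveSystem ρ h δ α Φ K)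
    (hL : PositiveSystem ρ h δ α Ψ L) (hΦ : Φ ⊆ Ψ) (hKL : K ⊆ L)
    {R : descentSpace L →ₗ[ℚ] descentSpace K} :
    IsParabolicRestriction L K R ↔
      R = restrictProj ρ h α fun _ => hK.projLin_x_mem hL hΦ
        (hKL.trans Subgroup.subset_closure) := by
  constructor
  · intro hR
    refine descentSpace_hom_ext fun I hI => Subtype.ext ?_
    rw [hR I hI, hK.sum_parabolic hL hΦ hKL hI]
    rfl
  · rintro rfl I hI
    exact Subtype.ext (hK.sum_parabolic hL hΦ hKL hI).symm

/-- The basis `x_I^K`, `I ⊆ K`, of the descent algebra. -/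
def basis (hK : PositiveSystem ρ h δ α Φ K) :
    Module.Basis {I : Set G // I ⊆ K} ℚ (descentSpace K) :=
  Module.Basis.mk (v := fun I : {I : Set G // I ⊆ K} => basisElt K I.1 I.2)
    (LinearIndependent.of_comp (descentSpace K).subtype hK.linearIndependent_x)
    (by
      intro a _
      induction a using descentSpace_induction with
      | basis I hI => exact Submodule.subset_span ⟨⟨I, hI⟩, rfl⟩
      | zero => exact zero_mem _
      | add a b ha hb => exact add_mem (ha trivial) (hb trivial)
      | smul c a ha => exact Submodule.smul_mem _ _ (ha trivial))

/-- No linear map is at hand that realizes `θ`, so here the linear independence of the `x_I^K` is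
used. -/
theorem existsUnique_isTheta (hK : PositiveSystem ρ h δ α Φ K) : ∃! θ, IsTheta K θ := by
  refine ⟨hK.basis.constr ℚ fun I => ⟨indTrivial K I.1, indTrivial_mem_QIrr K I.1⟩, ?_, ?_⟩
  · intro I hI
    have h1 : basisElt K I hI = hK.basis ⟨I, hI⟩ := by rw [basis, Module.Basis.mk_apply]
    rw [h1, Module.Basis.constr_basis]
  · intro θ hθ
    refine descentSpace_hom_ext fun I hI => Subtype.ext ?_
    have h1 : basisElt K I hI = hK.basis ⟨I, hI⟩ := by rw [basis, Module.Basis.mk_apply]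
    rw [hθ I hI, h1, Module.Basis.constr_basis]

/-- The projection of `x_I^L` and the Mackey decomposition of the restricted induced character are
indexed by the same `d`, with the same subsets of `K`. -/
theorem theta_comp_restrictProj (hK : PositiveSystem ρ h δ α Φ K)
    (hL : PositiveSystem ρ h δ α Ψ L) (hΦ : Φ ⊆ Ψ) (hKL : K ⊆ Subgroup.closure L)
    {θ : descentSpace L →ₗ[ℚ] QIrr (Subgroup.closure L)} (hθ : IsTheta L θ)
    {θ' : descentSpace K →ₗ[ℚ] QIrr (Subgroup.closure K)} (hθ' : IsTheta K θ') :
    θ' ∘ₗ (restrictProj ρ h α fun _ => hK.projLin_x_mem hL hΦ hKL) =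
      resChar (Subgroup.inclusion (closure_le_of_subset hKL)) ∘ₗ θ := by
  classical
  refine descentSpace_hom_ext fun I hI => Subtype.ext (funext fun g => ?_)
  have h1 : restrictProj ρ h α (fun _ => hK.projLin_x_mem hL hΦ hKL) (basisElt L I hI) =
      ∑ d ∈ minRepsFinset L I with ∀ s ∈ K, 0 < h (ρ d⁻¹ (α s)),
        basisElt K (K ∩ MulAut.conj d '' (Subgroup.closure I : Set G)) Set.inter_subset_left := by
    refine Subtype.ext ?_
    rw [Submodule.coe_sum]
    exact hK.projLin_x hL hΦ hKL hI
  rw [LinearMap.comp_apply, LinearMap.comp_apply, h1, map_sum, Submodule.coe_sum,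
    Finset.sum_apply]
  have h2 : ((resChar (Subgroup.inclusion (closure_le_of_subset hKL)) (θ (basisElt L I hI)) :
      QIrr (Subgroup.closure K)) : Subgroup.closure K → ℂ) g =
      (θ (basisElt L I hI) : Subgroup.closure L → ℂ)
        (Subgroup.inclusion (closure_le_of_subset hKL) g) := rfl
  rw [h2, hθ I hI, hK.indTrivial_restrict hL hΦ hKL hI]
  exact Finset.sum_congr rfl fun d _ => by rw [hθ']

/-- From `z R(a) = a z` one gets `z R(a) R(b) = a z R(b) = a b z = z R(a b)`, and `z` can be
cancelled on the left inside `Σ(W_K)`; the unit is treated in the same way. -/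
theorem isAlgebraHom_of (hK : PositiveSystem ρ h δ α Φ K) (hL : PositiveSystem ρ h δ α Ψ L)
    {R : descentSpace L →ₗ[ℚ] descentSpace K} (z : MonoidAlgebra ℚ G)
    (hz : ∀ a ∈ descentSpace K, z * a = 0 → a = 0)
    (hR : ∀ a, z * (R a : MonoidAlgebra ℚ G) = a * z) : IsAlgebraHom L K R := by
  have hinj : ∀ a ∈ descentSpace K, ∀ b ∈ descentSpace K, z * a = z * b → a = b := by
    intro a ha b hb hab
    exact sub_eq_zero.1 (hz _ (sub_mem ha hb) (by rw [mul_sub, hab, sub_self]))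
  let φ : hL.descentAlgebra → hK.descentAlgebra := fun a => ⟨(R ⟨a.1, a.2⟩).1, (R ⟨a.1, a.2⟩).2⟩
  have hφ : ∀ a, z * (φ a : MonoidAlgebra ℚ G) = a * z := fun a => hR ⟨a.1, a.2⟩
  have hext : ∀ a b : hK.descentAlgebra, z * (a : MonoidAlgebra ℚ G) = z * b → a = b :=
    fun a b hab => Subtype.ext (hinj a.1 a.2 b.1 b.2 hab)
  refine ⟨hL.descentAlgebra, hK.descentAlgebra,
    { toFun := φ
      map_one' := hext _ _ (by rw [hφ]; simp)
      map_zero' := hext _ _ (by rw [hφ]; simp)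
      map_add' := fun a b => hext _ _ (by
        rw [hφ, Subalgebra.coe_add, Subalgebra.coe_add, mul_add, hφ, hφ, add_mul])
      map_mul' := fun a b => hext _ _ (by
        rw [hφ, Subalgebra.coe_mul, Subalgebra.coe_mul, ← mul_assoc, hφ, mul_assoc, mul_assoc, hφ])
      commutes' := fun r => hext _ _ (by
        rw [hφ, Subalgebra.coe_algebraMap, Subalgebra.coe_algebraMap, Algebra.commutes]) },
    ?_, ?_, ?_⟩
  · exact Submodule.toSubalgebra_toSubmodule _ _ _
  · exact Submodule.toSubalgebra_toSubmodule _ _ _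
  · intro a y hay
    have h1 : (⟨a.1, a.2⟩ : descentSpace L) = y := Subtype.ext hay
    change (R ⟨a.1, a.2⟩ : MonoidAlgebra ℚ G) = R y
    rw [h1]

end PositiveSystem

theorem coeff_eq_zero_of_mem_descentSpace [Finite G] {a : MonoidAlgebra ℚ G}
    (ha : a ∈ descentSpace K) {w : G} (hw : w ∉ Subgroup.closure K) : a.coeff w = 0 := by
  classical
  induction ha using Submodule.span_induction with
  | mem a ha =>
    obtain ⟨I, -, rfl⟩ := ha
    rw [x_eq_sum, MonoidAlgebra.coeff_sum, Finsupp.finsetSum_apply]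
    refine Finset.sum_eq_zero fun v hv => ?_
    rw [MonoidAlgebra.coeff_single, Finsupp.single_apply, if_neg]
    rintro rfl
    exact hw (mem_minRepsFinset.1 hv).1
  | zero => simp
  | add a b _ _ ha hb => rw [MonoidAlgebra.coeff_add, Finsupp.add_apply, ha, hb, add_zero]
  | smul c a _ ha => rw [MonoidAlgebra.coeff_smul, Finsupp.smul_apply, ha, smul_zero]

/-- The supports of `a` and `t a` lie in the disjoint cosets `W_K` and `t W_K`, so nothing cancels.
-/
theorem eq_zero_of_one_add_mul [Finite G] {t : G} (ht : t ∉ Subgroup.closure K)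
    {a : MonoidAlgebra ℚ G} (ha : a ∈ descentSpace K)
    (h0 : (1 + MonoidAlgebra.single t 1) * a = 0) : a = 0 := by
  ext w
  by_cases hw : w ∈ Subgroup.closure K
  · have h1 := congrArg (fun z => z.coeff w) h0
    have h2 : a.coeff (t⁻¹ * w) = 0 := coeff_eq_zero_of_mem_descentSpace ha fun h3 =>
      ht (by simpa using mul_mem hw (inv_mem h3))
    simp only [add_mul, one_mul, MonoidAlgebra.coeff_add, Finsupp.add_apply,
      MonoidAlgebra.coeff_single_mul_apply, h2] at h1
    simpa using h1
  · simpa using coeff_eq_zero_of_mem_descentSpace ha hw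

end Restriction

/-! ### Type `D` inside type `B`: the twist by `t` -/

section Twist

variable {n : ℕ} [NeZero n] {W : Type*} [Group W] (cs : CoxeterSystem (CoxeterMatrix.B n) W) {m : ℕ}

theorem rep_sgen_zero : rep cs (sgen cs 0) = reflect 0 := rep_sgen cs (NeZero.pos n)

omit [NeZero n] in
theorem conj_sgen_zero_fork : MulAut.conj (sgen cs 0) (fork cs) = sgen cs 1 := by
  have h0 := sgen_mul_self cs 0
  rw [MulAut.conj_apply, sgen_inv, fork, mul_assoc, mul_assoc, mul_assoc, h0, mul_one, ← mul_assoc,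
    h0, one_mul]

omit [NeZero n] in
theorem conj_sgen_zero_sgen_one : MulAut.conj (sgen cs 0) (sgen cs 1) = fork cs := by
  rw [MulAut.conj_apply, sgen_inv, fork]

omit [NeZero n] in
theorem conj_sgen_zero_conj (g : W) :
    MulAut.conj (sgen cs 0) (MulAut.conj (sgen cs 0) g) = g := by
  rw [← MulAut.mul_apply, ← map_mul, sgen_mul_self, map_one, MulAut.one_apply]

omit [NeZero n] in
theorem conj_sgen_zero_sgen {k : ℕ} (hk : k + 2 < n) :
    MulAut.conj (sgen cs 0) (sgen cs (k + 2)) = sgen cs (k + 2) := by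
  have h := sgen_mul_pow cs (k := 0) (l := k + 2) (by omega) hk
  have h1 : coxeterEntry 0 (k + 2) = 2 := by simp [coxeterEntry]
  rw [h1, pow_two, ← mul_assoc] at h
  rw [MulAut.conj_apply, sgen_inv, eq_inv_of_mul_eq_one_left h, sgen_inv]

theorem conj_mem_SD (hm : m ≤ n) {s : W} (hs : s ∈ SD cs m) :
    MulAut.conj (sgen cs 0) s ∈ SD cs m := by
  rw [mem_SD cs hm] at hs ⊢
  rcases hs with ⟨_ | k, hk, rfl⟩ | ⟨h1, rfl⟩
  · exact Or.inr ⟨hk, conj_sgen_zero_sgen_one cs⟩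
  · exact Or.inl ⟨k + 1, hk, conj_sgen_zero_sgen cs (by omega)⟩
  · exact Or.inl ⟨0, h1, conj_sgen_zero_fork cs⟩

theorem conj_image_SD (hm : m ≤ n) : MulAut.conj (sgen cs 0) '' SD cs m = SD cs m := by
  refine subset_antisymm (Set.image_subset_iff.2 fun s hs => conj_mem_SD cs hm hs) fun s hs =>
    ⟨_, conj_mem_SD cs hm hs, conj_sgen_zero_conj cs s⟩

theorem conj_mem_closure_SD (hm : m ≤ n) {w : W} (hw : w ∈ Subgroup.closure (SD cs m)) :
    MulAut.conj (sgen cs 0) w ∈ Subgroup.closure (SD cs m) := by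
  have h1 := Subgroup.mem_map_of_mem (MulAut.conj (sgen cs 0)).toMonoidHom hw
  rw [MonoidHom.map_closure] at h1
  change _ ∈ Subgroup.closure (MulAut.conj (sgen cs 0) '' SD cs m) at h1
  rwa [conj_image_SD cs hm] at h1

theorem root_conj (hm : m ≤ n) {s : W} (hs : s ∈ SD cs m) :
    root cs (MulAut.conj (sgen cs 0) s) = reflect 0 (root cs s) := by
  obtain ⟨h1, h2⟩ := exists_reflection_of_mem_SD cs hm hs
  have h3 := h2.conj (sgen cs 0)
  rw [rep_sgen_zero] at h3
  exact h3.root_eq (rootsD_subset_rootsB n (rootsD_mono hm (reflect_zero_mem_rootsD h1)))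

omit [NeZero n] in
theorem sgen_zero_mem (hm : m ≤ n) (h1 : 1 ≤ m) : sgen cs 0 ∈ SB cs m :=
  (mem_SB cs hm).2 ⟨0, h1, rfl⟩

theorem SD_subset_closure (m : ℕ) : SD cs m ⊆ Subgroup.closure (SB cs m) :=
  fun _ hs => closure_SD_le cs m (Subgroup.subset_closure hs)

theorem height_reflect_zero_pos (hm : m ≤ n) {s : W} (hs : s ∈ SD cs m) :
    0 < height n (reflect 0 (root cs s)) :=
  height_pos (rootsD_subset_rootsB n (rootsD_mono hm
    (reflect_zero_mem_rootsD (exists_reflection_of_mem_SD cs hm hs).1)))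

/-- The elements of minimal length in the cosets of `W_m'` in `W_m` are `1` and `t`. -/
theorem eq_one_or_eq_of_pos (hm : m ≤ n) (h1 : 1 ≤ m) {b : W}
    (hb : b ∈ Subgroup.closure (SB cs m))
    (hp : ∀ s ∈ SD cs m, 0 < height n (rep cs b (root cs s))) : b = 1 ∨ b = sgen cs 0 := by
  have key : ∀ c ∈ Subgroup.closure (SB cs m),
      (∀ s ∈ SD cs m, 0 < height n (rep cs c (root cs s))) →
      0 < height n (rep cs c (simpleRoot 0)) → c = 1 := by
    intro c hc hpc h0
    refine (positiveSystemB cs hm).eq_one_of_pos hc fun s hs => ?_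
    obtain ⟨_ | k, hk, rfl⟩ := (mem_SB cs hm).1 hs
    · rwa [root_sgen cs (by omega)]
    · exact hpc _ ((mem_SD cs hm).2 (Or.inl ⟨k, hk, rfl⟩))
  -- Among the simple roots of type `B` only `e_0` is not one of type `D`, so its sign under `b`
  -- decides; if negative, `b * t` takes the place of `b`, since `t` permutes the positive roots of
  -- type `D`.
  rcases lt_or_gt_of_ne ((positiveSystemB cs hm).height_ne_zero hb
    (simpleRoot_mem_rootsB (show 0 < m by omega))) with hneg | hpos
  · right
    have h2 := key (b * sgen cs 0)
      (mul_mem hb (Subgroup.subset_closure (sgen_zero_mem cs hm h1))) (fun s hs => ?_) ?_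
    · rw [eq_inv_of_mul_eq_one_left h2, sgen_inv]
    · rw [map_mul_apply, rep_sgen_zero, ← root_conj cs hm hs]
      exact hp _ (conj_mem_SD cs hm hs)
    · have h3 := (positiveSystemB cs hm).map_mul_root (sgen_zero_mem cs hm h1) b
      rw [root_sgen cs (by omega)] at h3
      rw [h3, map_neg]
      omega
  · exact Or.inl (key b hb hp hpos)

theorem pos_iff_eq_one_or_eq (hm : m ≤ n) (h1 : 1 ≤ m) {d : W}
    (hd : d ∈ Subgroup.closure (SB cs m)) :
    (∀ s ∈ SD cs m, 0 < height n (rep cs d⁻¹ (root cs s))) ↔ d = 1 ∨ d = sgen cs 0 := by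
  constructor
  · intro hp
    rcases eq_one_or_eq_of_pos cs hm h1 (inv_mem hd) hp with h | h
    · exact Or.inl (inv_eq_one.1 h)
    · exact Or.inr (by rw [← inv_inv d, h, sgen_inv])
  · rintro (rfl | rfl) s hs
    · rw [inv_one, map_one, Module.End.one_apply]
      exact height_pos (rootsD_subset_rootsB n (rootsD_mono hm
        (exists_reflection_of_mem_SD cs hm hs).1))
    · rw [sgen_inv, rep_sgen_zero]
      exact height_reflect_zero_pos cs hm hs

/-- `t` keeps all positive roots of type `D` positive, so inside `W_m'` it would have to be `1`. -/
theorem sgen_zero_notMem_closure_SD (hm : m ≤ n) (h1 : 1 ≤ m) :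
    sgen cs 0 ∉ Subgroup.closure (SD cs m) := by
  intro h
  have h2 := (positiveSystemD cs hm).eq_one_of_pos h fun s hs => by
    rw [rep_sgen_zero]; exact height_reflect_zero_pos cs hm hs
  exact (positiveSystemB cs hm).ne_one (sgen_zero_mem cs hm h1) h2

omit [NeZero n] in
theorem sgen_zero_mem_minReps_iff (hm : m ≤ n) (h1 : 1 ≤ m) {I : Set W} (hI : I ⊆ SB cs m) :
    sgen cs 0 ∈ minReps (SB cs m) I ↔ sgen cs 0 ∉ I := by
  have hB := positiveSystemB cs hm
  have ht := sgen_zero_mem cs hm h1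
  rw [hB.mem_minReps_iff hI]
  constructor
  · rintro ⟨-, hp⟩ h
    have h2 := hp _ h
    rw [hB.smul_root _ ht, map_neg] at h2
    have := hB.pos _ (hB.root_mem _ ht)
    omega
  · intro h
    refine ⟨Subgroup.subset_closure ht, fun s hs => ?_⟩
    by_contra hn
    have h2 := hB.eq_root_of_neg ht (hB.root_mem s (hI hs)) (lt_of_le_of_ne (not_lt.1 hn)
      (hB.height_ne_zero (Subgroup.subset_closure ht) (hB.root_mem s (hI hs))))
    have h3 := hB.conj_eq s (hI hs) _ ht 1 (by rw [map_one, Module.End.one_apply, h2])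
    rw [one_mul, inv_one, mul_one] at h3
    exact h (h3 ▸ hs)

theorem one_mem_minReps {G V : Type*} [Group G] [AddCommGroup V] {ρ : G →* Module.End ℤ V}
    {h : V →+ ℤ} {δ : V} {α : G → V} {Φ : Set V} {K : Set G} (hK : PositiveSystem ρ h δ α Φ K)
    {I : Set G} (hI : I ⊆ K) : 1 ∈ minReps K I := by
  rw [hK.mem_minReps_iff hI]
  refine ⟨one_mem _, fun s hs => ?_⟩
  rw [map_one, Module.End.one_apply]
  exact hK.pos _ (hK.root_mem s (hI hs))

omit [NeZero n] in
theorem conj_conj (a : MonoidAlgebra ℚ W) : conj (sgen cs 0) (conj (sgen cs 0) a) = a := by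
  rw [conj, conj, ← mul_assoc, ← mul_assoc, mul_assoc, MonoidAlgebra.single_mul_single,
    MonoidAlgebra.single_mul_single, sgen_inv, sgen_mul_self, one_mul, ← MonoidAlgebra.one_def,
    one_mul, mul_one]

theorem conj_add {G : Type*} [Group G] (g : G) (a b : MonoidAlgebra ℚ G) :
    conj g (a + b) = conj g a + conj g b := by
  rw [conj, mul_add, add_mul]; rfl

theorem conj_smul {G : Type*} [Group G] (g : G) (c : ℚ) (a : MonoidAlgebra ℚ G) :
    conj g (c • a) = c • conj g a := by
  rw [conj, mul_smul_comm, smul_mul_assoc]; rfl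

/-- Conjugation by `t` is a diagram automorphism, and `t` preserves the positive roots of type `D`,
so the sign conditions are carried over. -/
theorem minReps_conj (hm : m ≤ n) {J : Set W} (hJ : J ⊆ SD cs m) {w : W}
    (hw : w ∈ minReps (SD cs m) J) :
    MulAut.conj (sgen cs 0) w ∈ minReps (SD cs m) (MulAut.conj (sgen cs 0) '' J) := by
  have hD := positiveSystemD cs hm
  have hJ' : MulAut.conj (sgen cs 0) '' J ⊆ SD cs m :=
    (Set.image_mono hJ).trans (conj_image_SD cs hm).subset
  rw [hD.mem_minReps_iff hJ] at hw
  rw [hD.mem_minReps_iff hJ']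
  refine ⟨conj_mem_closure_SD cs hm hw.1, ?_⟩
  rintro _ ⟨s, hs, rfl⟩
  rw [root_conj cs hm (hJ hs), MulAut.conj_apply, map_mul_apply, map_mul_apply, sgen_inv,
    rep_sgen_zero, reflect_reflect]
  exact height_pos (rootsD_subset_rootsB n (rootsD_mono hm (reflect_zero_mem_rootsD
    (hD.mem_of_pos hw.1 (hD.root_mem s (hJ hs)) (hw.2 s hs)))))

omit [NeZero n] in
theorem conj_image_image (J : Set W) :
    MulAut.conj (sgen cs 0) '' (MulAut.conj (sgen cs 0) '' J) = J := by
  rw [Set.image_image]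
  simp only [conj_sgen_zero_conj, Set.image_id']

theorem conj_x [Finite W] (hm : m ≤ n) {J : Set W} (hJ : J ⊆ SD cs m) :
    conj (sgen cs 0) (x (SD cs m) J) = x (SD cs m) (MulAut.conj (sgen cs 0) '' J) := by
  have hJ' : MulAut.conj (sgen cs 0) '' J ⊆ SD cs m :=
    (Set.image_mono hJ).trans (conj_image_SD cs hm).subset
  rw [x_eq_sum, x_eq_sum, conj, Finset.mul_sum, Finset.sum_mul]
  refine Finset.sum_bij' (fun w _ => MulAut.conj (sgen cs 0) w)
    (fun w _ => MulAut.conj (sgen cs 0) w) ?_ ?_ ?_ ?_ ?_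
  · intro w hw
    exact mem_minRepsFinset.2 (minReps_conj cs hm hJ (mem_minRepsFinset.1 hw))
  · intro w hw
    have := minReps_conj cs hm hJ' (mem_minRepsFinset.1 hw)
    rw [conj_image_image] at this
    exact mem_minRepsFinset.2 this
  · intro w _; exact conj_sgen_zero_conj cs w
  · intro w _; exact conj_sgen_zero_conj cs w
  · intro w _
    rw [MonoidAlgebra.single_mul_single, MonoidAlgebra.single_mul_single, mul_one, mul_one,
      MulAut.conj_apply]

theorem SD_inter_conj_image (hm : m ≤ n) (C : Set W) :
    SD cs m ∩ MulAut.conj (sgen cs 0) '' C = MulAut.conj (sgen cs 0) '' (SD cs m ∩ C) := by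
  rw [Set.image_inter (MulAut.conj (sgen cs 0)).injective, conj_image_SD cs hm]

variable [Finite W]

open Classical in
theorem filter_minReps (hm : m ≤ n) (h1 : 1 ≤ m) (I : Set W) :
    {d ∈ minRepsFinset (SB cs m) I | ∀ s ∈ SD cs m, 0 < height n (rep cs d⁻¹ (root cs s))} =
      {d ∈ minRepsFinset (SB cs m) I | d = 1 ∨ d = sgen cs 0} := by
  refine Finset.filter_congr fun d hd => pos_iff_eq_one_or_eq cs hm h1 ?_
  exact (mem_minRepsFinset.1 hd).1

/-- The representative `t` contributes exactly when `t` is minimal in its coset of `W_I`, that is,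
when `t ∉ I`; here only `d = 1` remains. -/
theorem projLin_x_of_mem (hm : m ≤ n) (h1 : 1 ≤ m) {I : Set W} (hI : I ⊆ SB cs m)
    (ht : sgen cs 0 ∈ I) :
    projLin (rep cs) (height n) (root cs) (SD cs m) (x (SB cs m) I) =
      x (SD cs m) (SD cs m ∩ Subgroup.closure I) := by
  classical
  rw [(positiveSystemD cs hm).projLin_x (positiveSystemB cs hm) (rootsD_subset_rootsB m)
    (SD_subset_closure cs m) hI, filter_minReps cs hm h1]
  have h2 : {d ∈ minRepsFinset (SB cs m) I | d = 1 ∨ d = sgen cs 0} = {1} := by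
    ext d
    rw [Finset.mem_filter, mem_minRepsFinset, Finset.mem_singleton]
    constructor
    · rintro ⟨hd, rfl | rfl⟩
      · rfl
      · exact absurd ht ((sgen_zero_mem_minReps_iff cs hm h1 hI).1 hd)
    · rintro rfl
      exact ⟨one_mem_minReps (positiveSystemB cs hm) hI, Or.inl rfl⟩
  rw [h2, Finset.sum_singleton, map_one]
  simp

theorem projLin_x_of_notMem (hm : m ≤ n) (h1 : 1 ≤ m) {I : Set W} (hI : I ⊆ SB cs m)
    (ht : sgen cs 0 ∉ I) :
    projLin (rep cs) (height n) (root cs) (SD cs m) (x (SB cs m) I) =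
      x (SD cs m) (SD cs m ∩ Subgroup.closure I) +
        conj (sgen cs 0) (x (SD cs m) (SD cs m ∩ Subgroup.closure I)) := by
  classical
  rw [(positiveSystemD cs hm).projLin_x (positiveSystemB cs hm) (rootsD_subset_rootsB m)
    (SD_subset_closure cs m) hI, filter_minReps cs hm h1]
  have h2 : {d ∈ minRepsFinset (SB cs m) I | d = 1 ∨ d = sgen cs 0} = {1, sgen cs 0} := by
    ext d
    rw [Finset.mem_filter, mem_minRepsFinset, Finset.mem_insert, Finset.mem_singleton]
    refine and_iff_right_of_imp ?_
    rintro (rfl | rfl)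
    · exact one_mem_minReps (positiveSystemB cs hm) hI
    · exact (sgen_zero_mem_minReps_iff cs hm h1 hI).2 ht
  rw [h2, Finset.sum_pair ((positiveSystemB cs hm).ne_one (sgen_zero_mem cs hm h1)).symm,
    conj_x cs hm Set.inter_subset_left, SD_inter_conj_image cs hm, map_one]
  simp

/-- If `t ∈ I`, conjugation by `t` preserves both `W_I` and `S_m'`; if `t ∉ I`, it exchanges the two
summands. -/
theorem conj_projLin (hm : m ≤ n) (h1 : 1 ≤ m) {a : MonoidAlgebra ℚ W}
    (ha : a ∈ descentSpace (SB cs m)) :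
    conj (sgen cs 0) (projLin (rep cs) (height n) (root cs) (SD cs m) a) =
      projLin (rep cs) (height n) (root cs) (SD cs m) a := by
  induction ha using Submodule.span_induction with
  | mem a ha =>
    obtain ⟨I, hI, rfl⟩ := ha
    by_cases ht : sgen cs 0 ∈ I
    · rw [projLin_x_of_mem cs hm h1 hI ht, conj_x cs hm Set.inter_subset_left,
        ← SD_inter_conj_image cs hm]
      congr 2
      refine subset_antisymm ?_ fun w hw => ⟨MulAut.conj (sgen cs 0) w, ?_,
        conj_sgen_zero_conj cs w⟩
      · rintro _ ⟨w, hw, rfl⟩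
        exact mul_mem (mul_mem (Subgroup.subset_closure ht) hw)
          (inv_mem (Subgroup.subset_closure ht))
      · exact mul_mem (mul_mem (Subgroup.subset_closure ht) hw)
          (inv_mem (Subgroup.subset_closure ht))
    · rw [projLin_x_of_notMem cs hm h1 hI ht, conj_add, conj_conj, add_comm]
  | zero => rw [map_zero, conj, mul_zero, zero_mul]
  | add a b _ _ ha hb => rw [map_add, conj_add, ha, hb]
  | smul c a _ ha => rw [map_smul, conj_smul, ha]

/-- An element and its projection differ on the right by `1` or `t`, and both are absorbed by `1 +
t`. -/
theorem projLin_mul_one_add (hm : m ≤ n) (h1 : 1 ≤ m) {a : MonoidAlgebra ℚ W}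
    (ha : a ∈ descentSpace (SB cs m)) :
    projLin (rep cs) (height n) (root cs) (SD cs m) a * (1 + MonoidAlgebra.single (sgen cs 0) 1) =
      a * (1 + MonoidAlgebra.single (sgen cs 0) 1) := by
  induction ha using Submodule.span_induction with
  | mem a ha =>
    obtain ⟨I, hI, rfl⟩ := ha
    rw [x_eq_sum, map_sum, Finset.sum_mul, Finset.sum_mul]
    refine Finset.sum_congr rfl fun w hw => ?_
    have hwL := (mem_minRepsFinset.1 hw).1
    rw [projLin_single]
    have hD := positiveSystemD cs hm
    have h2 := eq_one_or_eq_of_pos cs hm h1 (b := w⁻¹ * proj (rep cs) (height n) (root cs) (SD cs m) w)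
      (mul_mem (inv_mem hwL) (closure_SD_le cs m (hD.proj_mem w)))
      fun s hs => hD.proj_pos (positiveSystemB cs hm) (rootsD_subset_rootsB m)
        (SD_subset_closure cs m) hwL hs
    rcases h2 with h2 | h2
    · rw [← eq_of_inv_mul_eq_one h2]
    · rw [inv_mul_eq_iff_eq_mul.1 h2]
      simp only [mul_add, mul_one, MonoidAlgebra.single_mul_single, mul_assoc, sgen_mul_self]
      exact add_comm _ _
  | zero => rw [map_zero]
  | add a b _ _ ha hb => rw [map_add, add_mul, add_mul, ha, hb]
  | smul c a _ ha => rw [map_smul, smul_mul_assoc, smul_mul_assoc, ha]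

/-- The projection intertwines left and right multiplication by `1 + t`. -/
theorem one_add_mul_projLin (hm : m ≤ n) (h1 : 1 ≤ m) {a : MonoidAlgebra ℚ W}
    (ha : a ∈ descentSpace (SB cs m)) :
    (1 + MonoidAlgebra.single (sgen cs 0) 1) *
      projLin (rep cs) (height n) (root cs) (SD cs m) a =
        a * (1 + MonoidAlgebra.single (sgen cs 0) 1) := by
  rw [← projLin_mul_one_add cs hm h1 ha, mul_add, add_mul, mul_one, one_mul]
  congr 1
  nth_rewrite 2 [← conj_projLin cs hm h1 ha]
  rw [conj, mul_assoc, MonoidAlgebra.single_mul_single, inv_mul_cancel, mul_one,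
    ← MonoidAlgebra.one_def, mul_one]

theorem sum_restrictionBD (hm : m ≤ n) (h1 : 1 ≤ m) {I : Set W} (hI : I ⊆ SB cs m) :
    ((∑ᶠ d ∈ ({1, sgen cs 0} : Set W) ∩ (minReps (SB cs m) I)⁻¹,
      basisElt (SD cs m) ((MulAut.conj d⁻¹ '' (Subgroup.closure I : Set W)) ∩ SD cs m)
        Set.inter_subset_right : descentSpace (SD cs m)) : MonoidAlgebra ℚ W) =
      projLin (rep cs) (height n) (root cs) (SD cs m) (x (SB cs m) I) := by
  classical
  rw [(positiveSystemD cs hm).projLin_x (positiveSystemB cs hm) (rootsD_subset_rootsB m)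
    (SD_subset_closure cs m) hI, filter_minReps cs hm h1,
    finsum_mem_eq_finite_toFinset_sum _ (Set.toFinite _), Submodule.coe_sum]
  -- Both candidates are involutions, so the inverses in the defining formula for `Res_m` make no
  -- difference.
  have hinv : ∀ d : W, d = 1 ∨ d = sgen cs 0 → d⁻¹ = d := by
    rintro d (rfl | rfl)
    · exact inv_one
    · exact sgen_inv cs 0
  refine Finset.sum_congr ?_ fun d hd => ?_
  · ext d
    rw [Set.Finite.mem_toFinset, Set.mem_inter_iff, Set.mem_inv, Finset.mem_filter,
      mem_minRepsFinset, and_comm, Set.mem_insert_iff, Set.mem_singleton_iff]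
    exact and_congr_left fun hd => by rw [hinv d hd]
  · rw [hinv d (Finset.mem_filter.1 hd).2, Set.inter_comm (SD cs m)]
    rfl

/-- The restriction `Res_m`. -/
def restrictionBD (hm : m ≤ n) : descentSpace (SB cs m) →ₗ[ℚ] descentSpace (SD cs m) :=
  restrictProj (rep cs) (height n) (root cs) fun _ =>
    (positiveSystemD cs hm).projLin_x_mem (positiveSystemB cs hm) (rootsD_subset_rootsB m)
      (SD_subset_closure cs m)

theorem coe_restrictionBD (hm : m ≤ n) (a : descentSpace (SB cs m)) :
    (restrictionBD cs hm a : MonoidAlgebra ℚ W) =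
      projLin (rep cs) (height n) (root cs) (SD cs m) a := rfl

theorem isRestrictionBD_iff (hm : m ≤ n) (h1 : 1 ≤ m)
    {R : descentSpace (SB cs m) →ₗ[ℚ] descentSpace (SD cs m)} :
    IsRestrictionBD (sgen cs 0) (SB cs m) (SD cs m) R ↔ R = restrictionBD cs hm := by
  constructor
  · intro hR
    refine descentSpace_hom_ext fun I hI => Subtype.ext ?_
    rw [hR I hI, sum_restrictionBD cs hm h1 hI]
    rfl
  · rintro rfl I hI
    exact Subtype.ext (sum_restrictionBD cs hm h1 hI).symm

/-- A reflection lies in the stabilizer of a dominant `f` exactly when `f` vanishes at its root;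
this makes `W_I ∩ S_m'` computable. -/
theorem mem_closure_iff_root_eq_zero {G V : Type*} [Group G] [AddCommGroup V]
    {ρ : G →* Module.End ℤ V} {h : V →+ ℤ} {δ : V} {α : G → V} {Φ Ψ : Set V} {K L : Set G}
    (hK : PositiveSystem ρ h δ α Φ K) (hL : PositiveSystem ρ h δ α Ψ L)
    (hKL : K ⊆ Subgroup.closure L) {f : V →+ ℤ} (hf : ∀ s ∈ L, 0 ≤ f (α s)) {s : G} (hs : s ∈ K) :
    s ∈ Subgroup.closure {s ∈ L | f (α s) = 0} ↔ f (α s) = 0 := by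
  rw [hL.mem_closure_iff_pullback_eq hf (hKL hs)]
  exact ⟨hK.root_eq_zero_of_pullback_eq hs, hK.pullback_eq_of_root_eq_zero hs⟩

omit [Finite W] in
theorem fork_mem_closure_iff (hm : m ≤ n) (h1 : 1 < m) {I : Set W} (hI : I ⊆ SB cs m) :
    fork cs ∈ Subgroup.closure I ↔ sgen cs 0 ∈ I ∧ sgen cs 1 ∈ I := by
  obtain ⟨f, hf, rfl⟩ := (positiveSystemB cs hm).exists_coweight hI
  have m0 := sgen_zero_mem cs hm h1.le
  have m1 : sgen cs 1 ∈ SB cs m := (mem_SB cs hm).2 ⟨1, h1, rfl⟩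
  rw [mem_closure_iff_root_eq_zero (positiveSystemD cs hm) (positiveSystemB cs hm)
    (SD_subset_closure cs m) hf ((mem_SD cs hm).2 (Or.inr ⟨h1, rfl⟩))]
  have h2 : forkRoot = root cs (sgen cs 0) + root cs (sgen cs 0) + root cs (sgen cs 1) := by
    rw [root_sgen cs (by omega), root_sgen cs (by omega), forkRoot, simpleRoot, simpleRoot]
    abel
  have h3 := hf _ m0
  have h4 := hf _ m1
  rw [root_fork cs (by omega), h2, map_add, map_add, Set.mem_sep_iff, Set.mem_sep_iff]
  constructor
  · intro h; exact ⟨⟨m0, by omega⟩, m1, by omega⟩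
  · rintro ⟨⟨-, h5⟩, -, h6⟩; omega

omit [NeZero n] [Finite W] in
theorem sgen_mem_closure_iff (hm : m ≤ n) {k : ℕ} (hk : k < m) {I : Set W} (hI : I ⊆ SB cs m) :
    sgen cs k ∈ Subgroup.closure I ↔ sgen cs k ∈ I := by
  obtain ⟨f, hf, rfl⟩ := (positiveSystemB cs hm).exists_coweight hI
  have m0 : sgen cs k ∈ SB cs m := (mem_SB cs hm).2 ⟨k, hk, rfl⟩
  rw [mem_closure_iff_root_eq_zero (positiveSystemB cs hm) (positiveSystemB cs hm)
    Subgroup.subset_closure hf m0]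
  exact (and_iff_right m0).symm

omit [NeZero n] [Finite W] in
theorem sgen_inj {k l : ℕ} (hk : k < n) (hl : l < n) (h : sgen cs k = sgen cs l) : k = l :=
  simpleRoot_injective (by rw [← root_sgen cs hk, ← root_sgen cs hl, h])

/-- The twisted sums `x_J + t x_J t⁻¹` lie in the image of `Res_m`. -/
theorem exists_restrictionBD_eq_add_conj (hm : m ≤ n) (h1 : 1 ≤ m) {b : MonoidAlgebra ℚ W}
    (hb : b ∈ descentSpace (SD cs m)) :
    ∃ a, (restrictionBD cs hm a : MonoidAlgebra ℚ W) = b + conj (sgen cs 0) b := by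
  induction hb using Submodule.span_induction with
  | mem b hb =>
    obtain ⟨J, hJ, rfl⟩ := hb
    -- If `J` contains `s_1` but not `t s_1 t`, it is itself a subset of `S_m` avoiding `t`, and the
    -- parabolic subgroup it generates meets `S_m'` in `J` alone; so `x_J` in type `B` is a
    -- preimage.
    have key : ∀ J ⊆ SD cs m, (sgen cs 1 ∈ J ∧ fork cs ∉ J) →
        ∃ a, (restrictionBD cs hm a : MonoidAlgebra ℚ W) =
          x (SD cs m) J + conj (sgen cs 0) (x (SD cs m) J) := by
      intro J hJ hc
      have hI : SB cs m ∩ J ⊆ SB cs m := Set.inter_subset_left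
      have ht : sgen cs 0 ∉ SB cs m ∩ J := fun h =>
        sgen_zero_notMem_closure_SD cs hm h1 (Subgroup.subset_closure (hJ h.2))
      have h2 : SD cs m ∩ Subgroup.closure (SB cs m ∩ J) = J := by
        ext s
        by_cases hs : s ∈ SD cs m
        swap
        · exact iff_of_false (fun h => hs h.1) fun h => hs (hJ h)
        rw [Set.mem_inter_iff, and_iff_right hs, SetLike.mem_coe]
        rcases (mem_SD cs hm).1 hs with ⟨k, hk, rfl⟩ | ⟨h3, rfl⟩
        · rw [sgen_mem_closure_iff cs hm hk hI]
          exact and_iff_right ((mem_SB cs hm).2 ⟨_, hk, rfl⟩)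
        · rw [fork_mem_closure_iff cs hm h3 hI]
          exact iff_of_false (fun h => ht h.1) hc.2
      refine ⟨basisElt _ _ hI, ?_⟩
      rw [coe_restrictionBD]
      refine (projLin_x_of_notMem cs hm h1 hI ht).trans ?_
      rw [h2]
    -- If `J` contains both or neither of the two end nodes, adjoin `t` to `J ∩ S_m`. The image is
    -- then `x_J` itself, which commutes with `t`, so the sum with its twist is twice that image.
    by_cases hc : fork cs ∈ J ↔ sgen cs 1 ∈ J
    · have hI : {s ∈ SB cs m | s = sgen cs 0 ∨ s ∈ J} ⊆ SB cs m := Set.sep_subset _ _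
      have ht : sgen cs 0 ∈ {s ∈ SB cs m | s = sgen cs 0 ∨ s ∈ J} :=
        ⟨sgen_zero_mem cs hm h1, Or.inl rfl⟩
      have h4 : ∀ k, k + 1 < m →
          (sgen cs (k + 1) ∈ {s ∈ SB cs m | s = sgen cs 0 ∨ s ∈ J} ↔ sgen cs (k + 1) ∈ J) := by
        intro k hk
        rw [Set.mem_sep_iff, and_iff_right ((mem_SB cs hm).2 ⟨_, hk, rfl⟩)]
        exact or_iff_right fun h => by
          have := sgen_inj cs (by omega) (by omega) h
          omega
      have h2 : SD cs m ∩ Subgroup.closure {s ∈ SB cs m | s = sgen cs 0 ∨ s ∈ J} = J := by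
        ext s
        by_cases hs : s ∈ SD cs m
        swap
        · exact iff_of_false (fun h => hs h.1) fun h => hs (hJ h)
        rw [Set.mem_inter_iff, and_iff_right hs, SetLike.mem_coe]
        rcases (mem_SD cs hm).1 hs with ⟨k, hk, rfl⟩ | ⟨h3, rfl⟩
        · rw [sgen_mem_closure_iff cs hm hk hI, h4 k hk]
        · rw [fork_mem_closure_iff cs hm h3 hI, and_iff_right ht, h4 0 h3, hc]
      have h5 := projLin_x_of_mem cs hm h1 hI ht
      rw [h2] at h5
      have h6 := conj_projLin cs hm h1 (x_mem (SB cs m) hI)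
      rw [h5] at h6
      refine ⟨(2 : ℚ) • basisElt _ _ hI, ?_⟩
      rw [h6, map_smul, Submodule.coe_smul, coe_restrictionBD, two_smul]
      exact congrArg₂ _ h5 h5
    · by_cases h2 : sgen cs 1 ∈ J
      · exact key J hJ ⟨h2, fun h3 => hc (iff_of_true h3 h2)⟩
      · have h3 : fork cs ∈ J := by
          by_contra h3
          exact hc (iff_of_false h3 h2)
        -- The remaining case is the first one for the twisted set, and the symmetrized sum is the
        -- same for both.
        obtain ⟨a, ha⟩ := key (MulAut.conj (sgen cs 0) '' J)
          ((Set.image_mono hJ).trans (conj_image_SD cs hm).subset)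
          ⟨⟨_, h3, conj_sgen_zero_fork cs⟩, by
            rintro ⟨s, hs, hst⟩
            rw [← conj_sgen_zero_sgen_one] at hst
            exact h2 ((MulAut.conj (sgen cs 0)).injective hst ▸ hs)⟩
        rw [← conj_x cs hm hJ, conj_conj] at ha
        exact ⟨a, ha.trans (add_comm _ _)⟩
  | zero => exact ⟨0, by simp [conj]⟩
  | add b b' _ _ hb hb' =>
    obtain ⟨a, ha⟩ := hb
    obtain ⟨a', ha'⟩ := hb'
    refine ⟨a + a', ?_⟩
    rw [map_add, Submodule.coe_add, ha, ha', conj_add]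
    abel
  | smul c b _ hb =>
    obtain ⟨a, ha⟩ := hb
    exact ⟨c • a, by rw [map_smul, Submodule.coe_smul, ha, conj_smul, smul_add]⟩

theorem mem_range_restrictionBD_iff (hm : m ≤ n) (h1 : 1 ≤ m) (b : descentSpace (SD cs m)) :
    b ∈ LinearMap.range (restrictionBD cs hm) ↔
      conj (sgen cs 0) (b : MonoidAlgebra ℚ W) = b := by
  constructor
  · rintro ⟨a, rfl⟩
    exact conj_projLin cs hm h1 a.2
  · intro hb
    -- A fixed element is half the sum of itself and its conjugate.
    obtain ⟨a, ha⟩ := exists_restrictionBD_eq_add_conj cs hm h1 b.2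
    refine ⟨(1 / 2 : ℚ) • a, Subtype.ext ?_⟩
    rw [map_smul, Submodule.coe_smul, ha, hb, ← two_smul ℚ, smul_smul]
    norm_num

end Twist

/-! ### Surjectivity of parabolic restriction in type `B` -/

section Surjective

variable {n : ℕ} {W : Type*} [Group W] (cs : CoxeterSystem (CoxeterMatrix.B n) W) {m : ℕ}

theorem exists_signed_perm (hm : m ≤ n) {w : W} (hw : w ∈ Subgroup.closure (SB cs m)) :
    ∃ σ : Equiv.Perm ℕ, (∀ i, σ i < m ↔ i < m) ∧
      ∀ i, rep cs w (stdVec i) = stdVec (σ i) ∨ rep cs w (stdVec i) = -stdVec (σ i) := by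
  induction hw using Subgroup.closure_induction with
  | mem s hs =>
    obtain ⟨_ | k, hk, rfl⟩ := (mem_SB cs hm).1 hs
    · refine ⟨1, fun i => Iff.rfl, fun i => ?_⟩
      rw [rep_sgen cs (by omega), reflect_zero_stdVec, Equiv.Perm.one_apply]
      split_ifs
      · exact Or.inr rfl
      · exact Or.inl rfl
    · refine ⟨Equiv.swap k (k + 1), fun i => ⟨fun hi => ?_, swap_lt hk⟩, fun i => Or.inl ?_⟩
      · have := swap_lt hk hi
        rwa [Equiv.swap_apply_self] at this
      · rw [rep_sgen cs (by omega), reflect_succ_stdVec]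
  | one => exact ⟨1, fun i => Iff.rfl, fun i => Or.inl (by simp)⟩
  | mul a b _ _ ha hb =>
    obtain ⟨σ, h1, h2⟩ := ha
    obtain ⟨τ, h3, h4⟩ := hb
    refine ⟨σ * τ, fun i => (h1 _).trans (h3 i), fun i => ?_⟩
    rw [map_mul_apply, Equiv.Perm.mul_apply]
    rcases h4 i with h5 | h5 <;> rcases h2 (τ i) with h6 | h6 <;> rw [h5]
    · exact Or.inl h6
    · exact Or.inr h6
    · right; rw [map_neg, h6]
    · left; rw [map_neg, h6, neg_neg]
  | inv a _ ha =>
    obtain ⟨σ, h1, h2⟩ := ha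
    refine ⟨σ.symm, fun i => ?_, fun i => ?_⟩
    · rw [← h1, Equiv.apply_symm_apply]
    · have h3 := h2 (σ.symm i)
      rw [Equiv.apply_symm_apply] at h3
      rcases h3 with h3 | h3
      · left; rw [← h3, map_inv_apply_self]
      · right; rw [← neg_eq_iff_eq_neg, ← map_neg, ← h3, map_inv_apply_self]

/-- The cyclic permutation of the first `m + 1` coordinates. -/
theorem exists_cycle (hm : m < n) :
    ∃ g ∈ Subgroup.closure (SB cs (m + 1)), rep cs g (stdVec 0) = stdVec m ∧
      (∀ i < m, rep cs g (stdVec (i + 1)) = stdVec i) ∧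
      ∀ i, m < i → rep cs g (stdVec i) = stdVec i := by
  induction m with
  | zero => exact ⟨1, one_mem _, by simp, by simp, by simp⟩
  | succ m ih =>
    obtain ⟨g, h1, h2, h3, h4⟩ := ih (by omega)
    refine ⟨sgen cs (m + 1) * g, mul_mem (Subgroup.subset_closure ((mem_SB cs hm).2
      ⟨m + 1, by omega, rfl⟩)) (Subgroup.closure_mono ?_ h1), ?_, ?_, ?_⟩
    · rintro s ⟨i, hi, rfl⟩
      exact ⟨i, by omega, rfl⟩
    · rw [map_mul_apply, h2, rep_sgen cs hm, reflect_succ_stdVec, Equiv.swap_apply_left]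
    · intro i hi
      rw [map_mul_apply]
      rcases Nat.lt_succ_iff_lt_or_eq.1 hi with h | rfl
      · rw [h3 i h, rep_sgen cs hm, reflect_succ_stdVec,
          Equiv.swap_apply_of_ne_of_ne (by omega) (by omega)]
      · rw [h4 _ (by omega), rep_sgen cs hm, reflect_succ_stdVec, Equiv.swap_apply_right]
    · intro i hi
      rw [map_mul_apply, h4 _ (by omega), rep_sgen cs hm, reflect_succ_stdVec,
        Equiv.swap_apply_of_ne_of_ne (by omega) (by omega)]

theorem SB_mono {k l : ℕ} (h : k ≤ l) : SB cs k ⊆ SB cs l := by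
  rintro s ⟨i, hi, rfl⟩
  exact ⟨i, by omega, rfl⟩

theorem SD_mono [NeZero n] {k l : ℕ} (h : k ≤ l) : SD cs k ⊆ SD cs l := by
  rintro s (⟨i, h1, hi, rfl⟩ | ⟨i, h1, hi, rfl⟩)
  · exact Or.inl ⟨i, h1, by omega, rfl⟩
  · exact Or.inr ⟨i, h1, by omega, rfl⟩

/-- If a dominant functional vanishes on the first `z + 1` coordinate vectors, so does each
functional in its orbit that is dominant for the parabolic subgroup `W_m` and nonzero on the last
coordinate vector. -/
theorem apply_stdVec_eq_zero (hm : m < n) {f : (ℕ → ℤ) →+ ℤ} {z : ℕ} (hz : z < m)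
    (h0 : ∀ i ≤ z, f (stdVec i) = 0) {w : W} (hw : w ∈ Subgroup.closure (SB cs (m + 1)))
    (hdom : ∀ k < m, 0 ≤ f (rep cs w (simpleRoot k))) (hlast : f (rep cs w (stdVec m)) ≠ 0)
    {k : ℕ} (hk : k ≤ z) : f (rep cs w (stdVec k)) = 0 := by
  obtain ⟨σ, h1, h2⟩ := exists_signed_perm cs (show m + 1 ≤ n by omega) hw
  have hstep : ∀ i, i + 1 < m → f (rep cs w (stdVec i)) ≤ f (rep cs w (stdVec (i + 1))) := by
    intro i hi
    have := hdom (i + 1) hi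
    rw [simpleRoot, map_sub, map_sub] at this
    omega
  have hnonneg : ∀ i < m, 0 ≤ f (rep cs w (stdVec i)) := by
    intro i hi
    induction i with
    | zero => exact hdom 0 hi
    | succ i ih => exact (ih (by omega)).trans (hstep i hi)
  have hmono : ∀ i j, i ≤ j → j < m →
      f (rep cs w (stdVec i)) ≤ f (rep cs w (stdVec j)) := by
    intro i j hij hj
    induction j, hij using Nat.le_induction with
    | base => exact le_rfl
    | succ j _ ih => exact (ih (by omega)).trans (hstep j hj)
  by_contra hne
  have hpos := lt_of_le_of_ne (hnonneg k (by omega)) (Ne.symm hne)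
  -- The values on the first `m` coordinate vectors increase and the last one is nonzero. If the
  -- value at `k` were positive, all `z + 1` known zeros would sit at positions below `k ≤ z`, which
  -- is too few.
  have key : ∀ j ≤ z, σ.symm j < k := by
    intro j hj
    have h3 : σ.symm j < m + 1 := by
      rw [← h1, Equiv.apply_symm_apply]; omega
    have h4 : f (rep cs w (stdVec (σ.symm j))) = 0 := by
      have h5 := h2 (σ.symm j)
      rw [Equiv.apply_symm_apply] at h5
      rcases h5 with h5 | h5
      · rw [h5, h0 j hj]
      · rw [h5, map_neg, h0 j hj, neg_zero]
    by_contra h6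
    rcases Nat.lt_succ_iff_lt_or_eq.1 h3 with h7 | h7
    · have := hmono k _ (not_lt.1 h6) h7
      omega
    · rw [h7] at h4
      exact hlast h4
  have hcard := Finset.card_le_card_of_injOn (s := Finset.range (z + 1)) (t := Finset.range k) σ.symm
    (fun j hj => by
      have := Finset.mem_range.1 (Finset.mem_coe.1 hj)
      exact Finset.mem_coe.2 (Finset.mem_range.2 (key j (by omega))))
    (σ.symm.injective.injOn)
  rw [Finset.card_range, Finset.card_range] at hcard
  omega

variable [Finite W]

/-- A dominant functional is an increasing list of `m + 1` nonnegative values, and restriction to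
`W_m` sorts the absolute values that remain after one entry is set aside as last. Take the list for
`J` with one more zero. Setting a zero aside gives `x_J`; setting a nonzero entry aside leaves all
`z + 1` zeros, hence a set containing the first `z + 1` generators, covered by `ih`. -/
theorem x_mem_map_projLin_of_initial (hm : m < n) {z : ℕ} (hz : z < m)
    (ih : ∀ J ⊆ SB cs m, (∀ k < z + 1, sgen cs k ∈ J) → x (SB cs m) J ∈
      (descentSpace (SB cs (m + 1))).map (projLin (rep cs) (height n) (root cs) (SB cs m)))
    {J : Set W} (hJ : J ⊆ SB cs m) (hzJ : ∀ k < z, sgen cs k ∈ J) (hJz : sgen cs z ∉ J) :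
    x (SB cs m) J ∈
      (descentSpace (SB cs (m + 1))).map (projLin (rep cs) (height n) (root cs) (SB cs m)) := by
  classical
  have hK := positiveSystemB cs hm.le
  have hL := positiveSystemB cs (show m + 1 ≤ n by omega)
  have hKL : SB cs m ⊆ Subgroup.closure (SB cs (m + 1)) :=
    (SB_mono cs m.le_succ).trans Subgroup.subset_closure
  have hΦ := rootsB_mono m.le_succ
  have hmemL : ∀ k ≤ m, sgen cs k ∈ SB cs (m + 1) := fun k hk =>
    (mem_SB cs (show m + 1 ≤ n by omega)).2 ⟨k, by omega, rfl⟩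
  have hmemK : ∀ k < m, sgen cs k ∈ SB cs m := fun k hk => (mem_SB cs hm.le).2 ⟨k, hk, rfl⟩
  -- `J` is shifted by one place and its initial segment lengthened by one: `s_{k+1} ∈ I` exactly
  -- when `s_k ∈ J`, and `t ∈ I`.
  set I : Set W := {s | (∃ k ≤ z, s = sgen cs k) ∨
    ∃ k, z < k ∧ k < m ∧ sgen cs k ∈ J ∧ s = sgen cs (k + 1)}
  have hI : I ⊆ SB cs (m + 1) := by
    rintro s (⟨k, hk, rfl⟩ | ⟨k, -, hk, -, rfl⟩)
    · exact hmemL k (by omega)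
    · exact hmemL (k + 1) hk
  have hIJ : ∀ k < m, sgen cs (k + 1) ∈ I ↔ sgen cs k ∈ J := by
    intro k hk
    constructor
    · rintro (⟨l, hl, h⟩ | ⟨l, -, hlm, hl, h⟩)
      · have := sgen_inj cs (by omega) (by omega) h
        exact hzJ k (by omega)
      · have := sgen_inj cs (by omega) (by omega) h
        obtain rfl : k = l := by omega
        exact hl
    · intro h
      rcases lt_trichotomy k z with h1 | rfl | h1
      · exact Or.inl ⟨k + 1, h1, rfl⟩
      · exact absurd h hJz
      · exact Or.inr ⟨k, h1, hk, h, rfl⟩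
  obtain ⟨f, hf, hfI⟩ := hL.exists_coweight hI
  have hfroot : ∀ k ≤ m, 0 ≤ f (simpleRoot k) := fun k hk => by
    rw [← root_sgen cs (show k < n by omega)]; exact hf _ (hmemL k hk)
  have hfI' : ∀ k ≤ m, f (simpleRoot k) = 0 ↔ sgen cs k ∈ I := fun k hk => by
    rw [← hfI, Set.mem_sep_iff, root_sgen cs (by omega), and_iff_right (hmemL k hk)]
  have h00 : f (stdVec 0) = 0 := (hfI' 0 (by omega)).2 (Or.inl ⟨0, by omega, rfl⟩)
  have h0 : ∀ i ≤ z, f (stdVec i) = 0 := by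
    intro i hi
    induction i with
    | zero => exact h00
    | succ i ihi =>
      have h1 := (hfI' (i + 1) (by omega)).2 (Or.inl ⟨i + 1, hi, rfl⟩)
      rw [simpleRoot, map_sub, ihi (by omega), sub_zero] at h1
      exact h1
  -- `g` moves coordinate `0` to the last place and shifts the others down, so that a functional
  -- vanishing at `e_m` can be compared with the unshifted one.
  obtain ⟨g, hg, hg0, hgs, -⟩ := exists_cycle cs hm
  have hshift : ∀ φ : (ℕ → ℤ) →+ ℤ, φ (stdVec m) = 0 → ∀ k < m,
      φ (rep cs g (simpleRoot (k + 1))) = φ (simpleRoot k) := by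
    intro φ hφ k hk
    cases k with
    | zero =>
      change φ (rep cs g (stdVec (0 + 1) - stdVec 0)) = φ (stdVec 0)
      rw [map_sub, map_sub, hgs 0 hk, hg0, hφ, sub_zero]
    | succ k => rw [simpleRoot, map_sub, hgs _ hk, hgs _ (by omega), simpleRoot]
  have hzero : ∀ d ∈ minReps (SB cs (m + 1)) I,
      SB cs m ∩ MulAut.conj d '' (Subgroup.closure I : Set W) =
        {s ∈ SB cs m | pullback (rep cs) d⁻¹ f (root cs s) = 0} := fun d hd =>
    (hK.zeros_pullback hL hKL hf hfI hd.1).symm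
  set F := {d ∈ minRepsFinset (SB cs (m + 1)) I |
    ∀ s ∈ SB cs m, 0 < height n (rep cs d⁻¹ (root cs s))}
  have hdom : ∀ d ∈ F, ∀ k < m, 0 ≤ f (rep cs d⁻¹ (simpleRoot k)) := by
    intro d hd k hk
    obtain ⟨h1, h2⟩ := Finset.mem_filter.1 hd
    rw [hL.nonneg_iff_height_pos hf hfI (mem_minRepsFinset.1 h1)
      (simpleRoot_mem_rootsB (by omega)), ← root_sgen cs (by omega)]
    exact h2 _ (hmemK k hk)
  -- The minimal representative of `f` transported by `g` is such a `d`: it puts the extra zero in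
  -- the last place. Only a nonzero number of such terms is needed.
  have hne : ∃ d ∈ F, f (rep cs d⁻¹ (stdVec m)) = 0 := by
    obtain ⟨a, ha, h1⟩ := hL.exists_minRep hf hg
    rw [hfI] at ha
    have h2 : f (rep cs a⁻¹ (stdVec m)) = 0 := by
      rw [← pullback_apply, h1, pullback_apply, ← hg0, map_inv_apply_self, h00]
    refine ⟨a, Finset.mem_filter.2 ⟨mem_minRepsFinset.2 ha, fun s hs => ?_⟩, h2⟩
    obtain ⟨k, hk, rfl⟩ := (mem_SB cs hm.le).1 hs
    rw [← hL.nonneg_iff_height_pos hf hfI ha (hΦ (hK.root_mem _ hs)), root_sgen cs (by omega),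
      ← pullback_apply, ← hshift (pullback (rep cs) a⁻¹ f) h2 k hk, h1, pullback_apply,
      map_inv_apply_self]
    exact hfroot _ hk
  -- Moving the last zero back to the front by `g` makes the functional dominant for `W_{m+1}`,
  -- hence equal to `f`; its zeros, shifted down, are those of `J`.
  have hA : ∀ d ∈ F, f (rep cs d⁻¹ (stdVec m)) = 0 →
      SB cs m ∩ MulAut.conj d '' (Subgroup.closure I : Set W) = J := by
    intro d hd h1
    have hd1 := mem_minRepsFinset.1 (Finset.mem_filter.1 hd).1
    rw [hzero d hd1]
    have h2 := (hL.dominant_orbit hf (mul_mem (inv_mem hd1.1) hg) fun s hs => by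
      obtain ⟨_ | k, hk, rfl⟩ := (mem_SB cs (show m + 1 ≤ n by omega)).1 hs
      · rw [root_sgen cs (by omega), map_mul_apply, simpleRoot, hg0, h1]
      · rw [root_sgen cs (by omega), map_mul_apply, ← pullback_apply, hshift _ h1 k (by omega)]
        exact hdom d hd k (by omega)).1
    ext s
    by_cases hs : s ∈ SB cs m
    swap
    · exact iff_of_false (fun h => hs h.1) fun h => hs (hJ h)
    rw [Set.mem_sep_iff, and_iff_right hs]
    obtain ⟨k, hk, rfl⟩ := (mem_SB cs hm.le).1 hs
    rw [root_sgen cs (by omega), ← hshift _ h1 k hk, pullback_apply, ← map_mul_apply,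
      ← pullback_apply, h2, hfI' _ hk, hIJ k hk]
  have hB : ∀ d ∈ F, f (rep cs d⁻¹ (stdVec m)) ≠ 0 →
      x (SB cs m) (SB cs m ∩ MulAut.conj d '' (Subgroup.closure I : Set W)) ∈
        (descentSpace (SB cs (m + 1))).map (projLin (rep cs) (height n) (root cs) (SB cs m)) := by
    intro d hd h1
    have hd1 := mem_minRepsFinset.1 (Finset.mem_filter.1 hd).1
    refine ih _ Set.inter_subset_left fun k hk => ?_
    rw [hzero d hd1]
    refine ⟨hmemK k (by omega), ?_⟩
    have h2 : ∀ i ≤ z, f (rep cs d⁻¹ (stdVec i)) = 0 := fun i hi =>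
      apply_stdVec_eq_zero cs hm hz h0 (inv_mem hd1.1) (hdom d hd) h1 hi
    rw [root_sgen cs (by omega), pullback_apply]
    cases k with
    | zero => exact h2 0 (by omega)
    | succ k => rw [simpleRoot, map_sub, map_sub, h2 _ (by omega), h2 _ (by omega), sub_zero]
  have hsum : projLin (rep cs) (height n) (root cs) (SB cs m) (x (SB cs (m + 1)) I) =
      ((F.filter fun d => f (rep cs d⁻¹ (stdVec m)) = 0).card : ℚ) • x (SB cs m) J +
        ∑ d ∈ F with ¬ f (rep cs d⁻¹ (stdVec m)) = 0,
          x (SB cs m) (SB cs m ∩ MulAut.conj d '' (Subgroup.closure I : Set W)) := by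
    rw [hK.projLin_x hL hΦ hKL hI, ← Finset.sum_filter_add_sum_filter_not _
      (fun d => f (rep cs d⁻¹ (stdVec m)) = 0)]
    congr 1
    rw [Nat.cast_smul_eq_nsmul, ← Finset.sum_const]
    refine Finset.sum_congr rfl fun d hd => ?_
    obtain ⟨h1, h2⟩ := Finset.mem_filter.1 hd
    rw [hA d h1 h2]
  have hmem := Submodule.mem_map_of_mem (f := projLin (rep cs) (height n) (root cs) (SB cs m))
    (x_mem (SB cs (m + 1)) hI)
  rw [hsum] at hmem
  have h3 := (Submodule.add_mem_iff_left _ (sum_mem fun d hd =>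
    hB d (Finset.mem_filter.1 hd).1 (Finset.mem_filter.1 hd).2)).1 hmem
  refine (Submodule.smul_mem_iff _ ?_).1 h3
  obtain ⟨d, hd, h4⟩ := hne
  exact Nat.cast_ne_zero.2 (Finset.card_ne_zero_of_mem (Finset.mem_filter.2 ⟨hd, h4⟩))

/-- Surjectivity of the parabolic restriction in type `B`. -/
theorem x_mem_map_projLin (hm : m < n) {J : Set W} (hJ : J ⊆ SB cs m) :
    x (SB cs m) J ∈
      (descentSpace (SB cs (m + 1))).map (projLin (rep cs) (height n) (root cs) (SB cs m)) := by
  -- Descending induction on the guaranteed initial segment, starting from `J = S_m`, where `x_J =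
  -- 1` is the image of `1`.
  have key : ∀ z ≤ m, ∀ J ⊆ SB cs m, (∀ k < z, sgen cs k ∈ J) → x (SB cs m) J ∈
      (descentSpace (SB cs (m + 1))).map (projLin (rep cs) (height n) (root cs) (SB cs m)) := by
    intro z hz
    induction hz using Nat.decreasingInduction with
    | self =>
      intro J hJ hzJ
      have hK := positiveSystemB cs hm.le
      obtain rfl : J = SB cs m := by
        refine subset_antisymm hJ fun s hs => ?_
        obtain ⟨k, hk, rfl⟩ := (mem_SB cs hm.le).1 hs
        exact hzJ k hk
      refine ⟨_, x_mem (SB cs (m + 1)) subset_rfl, ?_⟩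
      rw [(positiveSystemB cs (show m + 1 ≤ n by omega)).x_self, hK.x_self, MonoidAlgebra.one_def,
        projLin_single, hK.proj_eq_of_pos (one_mem _)]
      intro s hs
      rw [inv_one, one_mul, map_one, Module.End.one_apply]
      exact hK.pos _ (hK.root_mem s hs)
    | of_succ z hz ih =>
      intro J hJ hzJ
      by_cases h : sgen cs z ∈ J
      · refine ih J hJ fun k hk => ?_
        rcases Nat.lt_succ_iff_lt_or_eq.1 hk with h1 | rfl
        · exact hzJ k h1
        · exact h
      · exact x_mem_map_projLin_of_initial cs hm hz ih hJ hzJ h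
  exact key 0 (Nat.zero_le m) J hJ fun k hk => absurd hk (Nat.not_lt_zero k)

theorem surjective_restrictProj (hm : m < n)
    (H : ∀ I ⊆ SB cs (m + 1), projLin (rep cs) (height n) (root cs) (SB cs m)
      (x (SB cs (m + 1)) I) ∈ descentSpace (SB cs m)) :
    Function.Surjective (restrictProj (rep cs) (height n) (root cs) H) := by
  rw [← LinearMap.range_eq_top, eq_top_iff]
  intro a _
  induction a using descentSpace_induction with
  | basis J hJ =>
    obtain ⟨a, ha, h1⟩ := x_mem_map_projLin cs hm hJ
    exact ⟨⟨a, ha⟩, Subtype.ext h1⟩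
  | zero => exact zero_mem _
  | add a b ha hb => exact add_mem (ha trivial) (hb trivial)
  | smul c a ha => exact Submodule.smul_mem _ _ (ha trivial)

end Surjective

end DescentAlgebra

end

/-! ### Assembly of the main theorem -/

open DescentAlgebra in
theorem mainTheorem11 (n : ℕ) [NeZero n] {W : Type*} [Group W] [Finite W]
    (cs : CoxeterSystem (CoxeterMatrix.B n) W) :
    -- the maps are well defined
    (∃! R, IsRestrictionBD (gen cs 0) (SB cs n) (SD cs n) R) ∧
    (2 ≤ n → ∃! R, IsRestrictionBD (gen cs 0) (SB cs (n - 1)) (SD cs (n - 1)) R) ∧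
    (∃! R, IsParabolicRestriction (SB cs n) (SB cs (n - 1)) R) ∧
    (2 ≤ n → ∃! R, IsParabolicRestriction (SD cs n) (SD cs (n - 1)) R) ∧
    (∃! θ, IsTheta (SB cs n) θ) ∧
    (∃! θ, IsTheta (SD cs n) θ) ∧
    -- properties of `Res_n`
    (∀ R, IsRestrictionBD (gen cs 0) (SB cs n) (SD cs n) R →
      (∀ a : descentSpace (SB cs n),
        (1 + MonoidAlgebra.single (gen cs 0) 1) * (R a : MonoidAlgebra ℚ W) =
          (a : MonoidAlgebra ℚ W) * (1 + MonoidAlgebra.single (gen cs 0) 1)) ∧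
      IsAlgebraHom (SB cs n) (SD cs n) R ∧
      (2 ≤ n → ∀ R₁ P P',
        IsRestrictionBD (gen cs 0) (SB cs (n - 1)) (SD cs (n - 1)) R₁ →
        IsParabolicRestriction (SB cs n) (SB cs (n - 1)) P →
        IsParabolicRestriction (SD cs n) (SD cs (n - 1)) P' →
        P' ∘ₗ R = R₁ ∘ₗ P) ∧
      (∀ θ θ', IsTheta (SB cs n) θ → IsTheta (SD cs n) θ' →
        θ' ∘ₗ R = resChar (Subgroup.inclusion (closure_SD_le cs n)) ∘ₗ θ) ∧
      (∀ b : descentSpace (SD cs n),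
        b ∈ LinearMap.range R ↔ conj (gen cs 0) (b : MonoidAlgebra ℚ W) = b)) ∧
    -- surjectivity of the parabolic restriction in type `B`
    (∀ P, IsParabolicRestriction (SB cs n) (SB cs (n - 1)) P → Function.Surjective P) := by
  have hn : 1 ≤ n := NeZero.pos n
  have hn1 : n - 1 ≤ n := Nat.sub_le n 1
  have hB := positiveSystemB cs le_rfl
  have hD := positiveSystemD cs le_rfl
  have hB' := positiveSystemB cs hn1
  have hD' := positiveSystemD cs hn1
  have hSB := SB_mono cs hn1
  have hSD := SD_mono cs hn1
  rw [gen_zero]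
  have hR : ∀ R, IsRestrictionBD (sgen cs 0) (SB cs n) (SD cs n) R ↔ R = restrictionBD cs le_rfl :=
    fun R => isRestrictionBD_iff cs le_rfl hn
  have hP : ∀ P, IsParabolicRestriction (SB cs n) (SB cs (n - 1)) P ↔ P = _ :=
    fun P => hB'.isParabolicRestriction_iff hB (rootsB_mono hn1) hSB
  have hP' : ∀ P, IsParabolicRestriction (SD cs n) (SD cs (n - 1)) P ↔ P = _ :=
    fun P => hD'.isParabolicRestriction_iff hD (rootsD_mono hn1) hSD
  refine ⟨⟨_, (hR _).2 rfl, fun R => (hR R).1⟩,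
    fun h2 => ⟨_, (isRestrictionBD_iff cs hn1 (by omega)).2 rfl,
      fun R => (isRestrictionBD_iff cs hn1 (by omega)).1⟩,
    ⟨_, (hP _).2 rfl, fun P => (hP P).1⟩, fun _ => ⟨_, (hP' _).2 rfl, fun P => (hP' P).1⟩,
    hB.existsUnique_isTheta, hD.existsUnique_isTheta, ?_, ?_⟩
  · intro R h
    obtain rfl := (hR R).1 h
    have ha : ∀ a : descentSpace (SB cs n), (1 + MonoidAlgebra.single (sgen cs 0) 1) *
        (restrictionBD cs le_rfl a : MonoidAlgebra ℚ W) =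
          (a : MonoidAlgebra ℚ W) * (1 + MonoidAlgebra.single (sgen cs 0) 1) :=
      fun a => one_add_mul_projLin cs le_rfl hn a.2
    refine ⟨ha, hD.isAlgebraHom_of hB _ (fun a ha h0 => eq_zero_of_one_add_mul
      (sgen_zero_notMem_closure_SD cs le_rfl hn) ha h0) ha, ?_, ?_,
      mem_range_restrictionBD_iff cs le_rfl hn⟩
    · intro h2 R₁ P P' h3 h4 h5
      obtain rfl := (isRestrictionBD_iff cs hn1 (by omega)).1 h3
      obtain rfl := (hP P).1 h4
      obtain rfl := (hP' P').1 h5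
      refine LinearMap.ext fun a => Subtype.ext ?_
      refine (projLin_projLin (fun w => hD'.proj_proj hD (rootsD_mono hn1)
        (hSD.trans Subgroup.subset_closure) w) (a : MonoidAlgebra ℚ W)).trans ?_
      exact (projLin_projLin (fun w => hD'.proj_proj hB' (rootsD_subset_rootsB _)
        (SD_subset_closure cs _) w) (a : MonoidAlgebra ℚ W)).symm
    · intro θ θ' h3 h4
      exact hD.theta_comp_restrictProj hB (rootsD_subset_rootsB n) (SD_subset_closure cs n) h3 h4
  · intro P h
    obtain rfl := (hP P).1 h
    obtain ⟨m, rfl⟩ : ∃ m, n = m + 1 := ⟨n - 1, by omega⟩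
    exact surjective_restrictProj cs (Nat.lt_succ_self m) _
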